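/- **Theorem 1′ (optimization landscape and generalization of QuadNTK on unwhitened neural features).** *Setting.* Let $P$ be a distribution of $(x,y)\in\mathbb S^{d-1}\times\mathcal Y$. Let $\ell:\mathbb R\times\mathcal Y\to\mathbb R_{\ge 0}$ be a loss, measurable in $y$, with $\ell(0,y)\le 1$ such that for every $y$ the function $\ell(\cdot,y)$ is convex and twice differentiable with $|\partial_z\ell|\le 1$ and $|\partial_z^2\ell|\le K$. Let $\varphi'':\mathbb R\to\mathbb R$ be measurable with $|\varphi''|\le K$ (e.g. $\varphi''(t)=\mathbf 1\{t\ge 0\}$, with $K= 1$). Fix $D,m,n\ge 1$, $v_1,\dots,v_D\in\mathbb R^d$ and $b\in\mathbb R^D$, and put $$g(x)=\big(\mathbf 1\{v_j^\top x+b_j\ge 0\}\big)_{j\le D},\qquad f^Q_W(x)=\frac1{2\sqrt m}\sum_{r=1}^m a_r\,\varphi''(w_{0,r}^\top g(x))\,(w_r^\top g(x))^2,$$ where $W=[w_1,\dots,w_m]^\top\in\mathbb R^{m\times D}$, $a\in\{\pm1\}^m$, $W_0=[w_{0,1},\dots,w_{0,m}]^\top\in\mathbb R^{m\times D}$. Let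 $\Sigma=\mathbb E_x[g(x)g(x)^\top]$ and suppose $\lambda_{\min}(\Sigma)\ge\kappa$ for a constant $\kappa>0$. Let $\tilde S_{n_0}=(\tilde x_1,\dots,\tilde x_{n_0})$ be i.i.d. from the $x$-marginal of $P$, let $\hat\Sigma=\frac1{n_0}\sum_{i\le n_0}g(\tilde x_i)g(\tilde x_i)^\top$ and $h(x)=\hat\Sigma^{-1/2}g(x)$. For $S_n=((x_i,y_i))_{i\le n}$ put $$\mathcal R(f)=\mathbb E_{(x,y)\sim P}[\ell(f(x),y)],\quad \hat{\mathcal R}(f)=\frac1n\sum_{i\le n}\ell(f(x_i),y_i),\quad \hat{\mathcal R}^{\rm dreg}_\lambda(f^Q_W)=\hat{\mathcal R}(f^Q_W)+\lambda\|W\hat\Sigma^{1/2}\|_{2,4}^4,$$ where $\|W\|_{2,4}=(\sum_r\|w_r\|_2^4)^{1/4}$. A second-order stationary point is a $W$ at which the gradient vanishes and the Hessian is positive semidefinite. 1. **(Optimization)** For all $\kappa,K>0$ and $0<\tau_1\le\tau_2$ there is $C>0$, depending only on $\kappa,K,\tau_1,\tau_2$, such that the following holds for all $d,D,m,n,n_0$,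 $\mathcal Y$, $P,\ell,\varphi'',v,b$ as above, all $a,W_0,S_n$, all $\varepsilon,\delta>0$, all $\tau\in[\tau_1,\tau_2]$ and all radii $B_{w,\star}>0$. If $$m\ge C D^2B_{w,\star}^4\varepsilon^{-1}\quad\text{and}\quad n_0\ge C\delta^{-2}D(1+\log D),$$ then with probability at least $1-\delta$ over $\tilde S_{n_0}$ the minimum of $\hat{\mathcal R}(f^Q_W)$ over $\{\|W\hat\Sigma^{1/2}\|_{2,4}\le B_{w,\star}\}$ is attained and there is a regularization coefficient $\lambda>0$ (which may depend on the data, $a$ and $W_0$) such that every second-order stationary point $\hat W$ of $W\mapsto\hat{\mathcal R}^{\rm dreg}_\lambda(f^Q_W)$ satisfies $\|\hat W\hat\Sigma^{1/2}\|_{2,4}\le C B_{w,\star}$ and $$\hat{\mathcal R}^{\rm dreg}_\lambda(f^Q_{\hat W})\le(1+\tau)\min_{\|W\hat\Sigma^{1/2}\|_{2,4}\le B_{w,\star}}\hat{\mathcal R}(f^Q_W)+\varepsilon .$$ 2. **(Generalization)** For all $\kappa,K>0$ there is $C>0$, depending only on $\kappa,K$, such that the following holds for all $d,D,m,n,n_0$,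 $\mathcal Y$, $P,\ell,\varphi'',v,b$ as above, all $\delta>0$, $B_w>0$ and all $B_g>0$ with $\|g(x)\|_2\le B_g$ almost surely. Let $a_r\sim{\rm Unif}\{\pm1\}$ and $w_{0,r}\sim N(0,I_D)$ be independent of each other and of $\tilde S_{n_0}$. If $n_0\ge C\delta^{-2}D(1+\log D)$, then with probability at least $1-\delta$ over $(a,W_0,\tilde S_{n_0})$, $$\mathbb E_{S_n\sim P^n}\Big[\sup_{\|W\hat\Sigma^{1/2}\|_{2,4}\le B_w}\big|\mathcal R(f^Q_W)-\hat{\mathcal R}(f^Q_W)\big|\Big]\le C\left(\frac{B_g^2B_w^2M_{g,\rm op}}{\sqrt n}\sqrt{1+\log(Dm)}+\frac1{\sqrt n}\right),$$ where $M_{g,\rm op}^2=B_g^{-2}\,\mathbb E_{x_1,\dots,x_n}\big\|\frac1n\sum_{i\le n}h(x_i)h(x_i)^\top\big\|_{\rm op}$, with $x_1,\dots,x_n$ i.i.d. from the $x$-marginal of $P$ and $h$ held fixed. -/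

import Mathlib

open MeasureTheory ProbabilityTheory

noncomputable section

namespace QuadNTK

/-- The input space: the unit sphere of `ℝ^d`. -/
abbrev Input (d : ℕ) : Type := Metric.sphere (0 : EuclideanSpace ℝ (Fin d)) 1

/-- The matrices `W ∈ ℝ^{m × D}`, given by their rows `w_1, …, w_m ∈ ℝ^D` (Euclidean norm). -/
abbrev Weights (m D : ℕ) : Type := Fin m → EuclideanSpace ℝ (Fin D)

/-- `p` holds with probability at least `1 - δ` under `μ`. The (outer) measure of the failure set
is used, so that `p` holds on a measurable event of probability at least `1 - δ`, whether or not
`p` is itself measurable. -/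
def WithProbAtLeast {Ω : Type*} [MeasurableSpace Ω] (μ : Measure Ω) (δ : ℝ) (p : Ω → Prop) :
    Prop :=
  μ {ω | ¬ p ω} ≤ ENNReal.ofReal δ

/-! ### Loss function -/

/-- A loss `ℓ(z, y)` that is measurable in `y`, nonnegative, with `ℓ(0, y) ≤ 1`, and, for every
label `y`, convex and twice differentiable in `z` with first derivative bounded by `1` and second
derivative bounded by `K`. -/
structure IsLoss {Y : Type*} [MeasurableSpace Y] (K : ℝ) (loss : ℝ → Y → ℝ) : Prop where
  measurable : ∀ z, Measurable (loss z)
  nonneg : ∀ z y, 0 ≤ loss z y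
  zero_le_one : ∀ y, loss 0 y ≤ 1
  convex : ∀ y, ConvexOn ℝ Set.univ (fun z => loss z y)
  differentiable : ∀ y, Differentiable ℝ (fun z => loss z y)
  differentiable_deriv : ∀ y, Differentiable ℝ (deriv (fun z => loss z y))
  abs_deriv_le : ∀ y z, |deriv (fun z => loss z y) z| ≤ 1
  abs_deriv_deriv_le : ∀ y z, |deriv (deriv (fun z => loss z y)) z| ≤ K

/-! ### Features and covariances -/

section Features

variable {d D : ℕ}

/-- The random features `g(x) = (1{v_jᵀ x + b_j ≥ 0})_{j ≤ D}`. -/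
def feature (V : Fin D → EuclideanSpace ℝ (Fin d)) (b : Fin D → ℝ) (x : Input d) :
    EuclideanSpace ℝ (Fin D) :=
  WithLp.toLp 2 fun j =>
    Set.indicator (Set.Ici (0 : ℝ)) (fun _ => (1 : ℝ))
      (inner ℝ (V j) (x : EuclideanSpace ℝ (Fin d)) + b j)

/-- The population covariance `Σ = E_x[g(x) g(x)ᵀ]`. -/
def cov (g : Input d → EuclideanSpace ℝ (Fin D)) (μ : Measure (Input d)) :
    Matrix (Fin D) (Fin D) ℝ :=
  Matrix.of fun i j => ∫ x, g x i * g x j ∂μ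

/-- The empirical second moment matrix `(1/N) ∑_i g(x_i) g(x_i)ᵀ`. -/
def empCov {N : ℕ} (g : Input d → EuclideanSpace ℝ (Fin D)) (xs : Fin N → Input d) :
    Matrix (Fin D) (Fin D) ℝ :=
  (1 / (N : ℝ)) • ∑ i, Matrix.vecMulVec (g (xs i)) (g (xs i))

open scoped MatrixOrder in
/-- The positive semidefinite square root `A^{1/2}` of a positive semidefinite matrix. -/
def psdSqrt (A : Matrix (Fin D) (Fin D) ℝ) : Matrix (Fin D) (Fin D) ℝ := CFC.sqrt A

/-- The whitened features `h(x) = A^{-1/2} g(x)`. -/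
def whiten (A : Matrix (Fin D) (Fin D) ℝ) (g : Input d → EuclideanSpace ℝ (Fin D)) (x : Input d) :
    EuclideanSpace ℝ (Fin D) :=
  WithLp.toLp 2 ((psdSqrt A)⁻¹.mulVec (g x))

/-- The number `M_{g,op}`, with
`M_{g,op}² = B_g⁻² E ‖(1/n) ∑_{i ≤ n} h(x_i) h(x_i)ᵀ‖_op`, where `h = A^{-1/2} g` and
`x_1, …, x_n` are i.i.d. from `μ`. -/
def opMoment (n : ℕ) (Bg : ℝ) (A : Matrix (Fin D) (Fin D) ℝ)
    (g : Input d → EuclideanSpace ℝ (Fin D)) (μ : Measure (Input d)) : ℝ :=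
  Real.sqrt ((Bg ^ 2)⁻¹ *
    ∫ xs : Fin n → Input d, ‖Matrix.toEuclideanCLM (𝕜 := ℝ) (empCov (whiten A g) xs)‖
      ∂(Measure.pi fun _ => μ))

end Features

/-! ### Model, norms and risks -/

section Model

variable {d D m : ℕ} {Y : Type*}

/-- The model `f^Q_W(x) = (1/(2√m)) ∑_r a_r φ''(w_{0,r}ᵀ g(x)) (w_rᵀ g(x))²`;
`phi2` is the function `φ''`. -/
def model (phi2 : ℝ → ℝ) (g : Input d → EuclideanSpace ℝ (Fin D)) (a : Fin m → ℝ)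
    (W0 W : Weights m D) (x : Input d) : ℝ :=
  1 / (2 * Real.sqrt m) *
    ∑ r, a r * phi2 (inner ℝ (W0 r) (g x)) * (inner ℝ (W r) (g x)) ^ 2

/-- The matrix product `W A`, row by row. -/
def rowMul (W : Weights m D) (A : Matrix (Fin D) (Fin D) ℝ) : Weights m D :=
  fun r => WithLp.toLp 2 (Matrix.vecMul (W r) A)

/-- `‖W‖_{2,4} = (∑_r ‖w_r‖_2^4)^{1/4}`. -/
def norm24 (W : Weights m D) : ℝ := (∑ r, ‖W r‖ ^ 4) ^ (1 / 4 : ℝ)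

/-- The ball `{W : ‖W A^{1/2}‖_{2,4} ≤ B}`. -/
def ball24 (m : ℕ) (A : Matrix (Fin D) (Fin D) ℝ) (B : ℝ) : Set (Weights m D) :=
  {W | norm24 (rowMul W (psdSqrt A)) ≤ B}

/-- The population risk `R(f) = E_{(x,y)}[ℓ(f(x), y)]`. -/
def risk [MeasurableSpace Y] (P : Measure (Input d × Y)) (loss : ℝ → Y → ℝ)
    (f : Input d → ℝ) : ℝ :=
  ∫ z, loss (f z.1) z.2 ∂P

/-- The empirical risk `(1/n) ∑_i ℓ(f(x_i), y_i)`. -/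
def empRisk {n : ℕ} (S : Fin n → Input d × Y) (loss : ℝ → Y → ℝ) (f : Input d → ℝ) : ℝ :=
  1 / (n : ℝ) * ∑ i, loss (f (S i).1) (S i).2

/-- The empirical risk with data-dependent regularizer, `R̂(f^Q_W) + λ ‖W A^{1/2}‖_{2,4}^4`. -/
def regRisk {n : ℕ} (S : Fin n → Input d × Y) (loss : ℝ → Y → ℝ) (phi2 : ℝ → ℝ)
    (g : Input d → EuclideanSpace ℝ (Fin D)) (a : Fin m → ℝ) (W0 : Weights m D)
    (A : Matrix (Fin D) (Fin D) ℝ) (lam : ℝ) (W : Weights m D) : ℝ :=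
  empRisk S loss (model phi2 g a W0 W) + lam * norm24 (rowMul W (psdSqrt A)) ^ 4

/-- Second-order stationary point: the gradient vanishes and the Hessian is positive
semidefinite. -/
def IsSOSP (F : Weights m D → ℝ) (W : Weights m D) : Prop :=
  fderiv ℝ F W = 0 ∧ ∀ U, 0 ≤ fderiv ℝ (fderiv ℝ F) W U U

/-- `E_{S_n} sup_{‖W A^{1/2}‖_{2,4} ≤ B} |R(f^Q_W) - R̂(f^Q_W)|`, for `S_n` i.i.d. from `P`
(a number in `[0, ∞]`). -/
def expectedGap [MeasurableSpace Y] (n : ℕ) (P : Measure (Input d × Y)) (loss : ℝ → Y → ℝ)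
    (phi2 : ℝ → ℝ) (g : Input d → EuclideanSpace ℝ (Fin D)) (a : Fin m → ℝ) (W0 : Weights m D)
    (A : Matrix (Fin D) (Fin D) ℝ) (B : ℝ) : ENNReal :=
  ∫⁻ S : Fin n → Input d × Y,
    ⨆ W ∈ ball24 m A B,
      ENNReal.ofReal |risk P loss (model phi2 g a W0 W) - empRisk S loss (model phi2 g a W0 W)|
    ∂(Measure.pi fun _ => P)

end Model

/-! ### Random initialization -/

/-- The uniform distribution on `{-1, 1}`. -/
def rademacher : Measure ℝ := (2⁻¹ : NNReal) • (Measure.dirac 1 + Measure.dirac (-1))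

/-- The law of `(a, W_0)`: independent `a_r ~ Unif{±1}` and `w_{0,r} ~ N(0, I_D)`, `r ≤ m`. -/
def initLaw (m D : ℕ) : Measure ((Fin m → ℝ) × Weights m D) :=
  (Measure.pi fun _ => rademacher).prod
    (Measure.pi fun _ => stdGaussian (EuclideanSpace ℝ (Fin D)))

end QuadNTK

end

open MeasureTheory ProbabilityTheory

namespace QuadNTK

/-! ### Random signs -/

/-! Both halves rest on one random event, that the empirical covariance satisfies `κ/2 ≤ Σ̂`; on it
everything else is deterministic in `Σ̂`. After whitening by the population covariance the features
are isotropic with squared norm at most `D/κ`. Symmetrization (`integral_iSup_sub_le`) and the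
matrix Khintchine inequality (`exists_khintchine_bound`) bound the mean lower deviation by a small
multiple of the sample size, and Markov's inequality finishes (`measure_isotropic_lower_le`,
`withProbAtLeast_empCov_lower`). Markov is where the factor `δ⁻²` comes from.

Optimization. Let `W` be a second-order stationary point and `U` a minimizer in the ball. The model
is a quadratic form, so vanishing of the gradient along `W` itself identifies the mean of `ℓ' f_W`
with a negative multiple of the regularizer. Flipping the signs of the rows of `U` changes neither
`f_U` nor any row norm, whereas in the square of the cross term of `W` and `U` all off-diagonal
products average to zero. Averaging the Hessian inequality over the flips therefore leaves a
curvature error of order `D²/m`, and bounds the mean of `ℓ' f_U` from below. Convexity of the loss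
compares the two means with the risks (`empRisk_add_le_of_isSOSP`). Choosing `λ` proportional to `(τ
M + ε)/B⁴`, where `M` is the minimal risk, turns the comparison into the two claimed bounds
(`bounds_of_landscape_inequality`, `landscape`).

Generalization. Symmetrization and contraction (`sum_iSup_contraction`) reduce the gap to the
Rademacher average of the models. In whitened coordinates this average is a sum over rows `r` of
quadratic forms of the matrices `∑ i, s i c r i h i h iᵀ`, with `|c r i| ≤ K`. The largest of their
`m` norms is controlled by Khintchine at the cost of `log (D m)`, and Cauchy–Schwarz turns the sum
of squared row norms into `√m` times the squared (2,4)-norm, which cancels the normalization of the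
model (`rademacher_model_le`). The supremum over the ball is reached from finite sets of weights by
monotone convergence (`expectedGap_le`).

Khintchine is proved with even trace moments. Flipping one sign acts as a discrete integration by
parts, and a trace inequality of Heinz type closes a recursion in the order of the moment. -/

/-- A sign as a real number. -/
def rsign (u : ℤˣ) : ℝ := ((u : ℤ) : ℝ)

@[simp] lemma rsign_one : rsign 1 = 1 := by simp [rsign]

@[simp] lemma rsign_neg (u : ℤˣ) : rsign (-u) = -rsign u := by simp [rsign]

@[simp] lemma rsign_mul_self (u : ℤˣ) : rsign u * rsign u = 1 := by
  rcases Int.units_eq_one_or u with rfl | rfl <;> simp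

@[simp] lemma abs_rsign (u : ℤˣ) : |rsign u| = 1 := by
  rcases Int.units_eq_one_or u with rfl | rfl <;> simp

section Signs

variable {ι : Type*} [DecidableEq ι]

/-- Flip the sign at one index. -/
def flipSign (i : ι) : (ι → ℤˣ) ≃ (ι → ℤˣ) := Equiv.mulRight (Pi.mulSingle i (-1))

@[simp] lemma flipSign_same (i : ι) (s : ι → ℤˣ) : flipSign i s i = -s i := by
  simp [flipSign]

lemma flipSign_of_ne {i j : ι} (h : j ≠ i) (s : ι → ℤˣ) : flipSign i s j = s j := by
  simp [flipSign, h]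

variable [Fintype ι]

lemma sum_signs_neg {E : Type*} [AddCommMonoid E] (F : (ι → ℤˣ) → E) :
    ∑ s : ι → ℤˣ, F (fun i => -s i) = ∑ s, F s :=
  Equiv.sum_comp (Equiv.neg (ι → ℤˣ)) F

lemma sum_signs_mul_of_ne {i j : ι} (h : i ≠ j) :
    ∑ s : ι → ℤˣ, rsign (s i) * rsign (s j) = 0 := by
  have h1 := (flipSign i).sum_comp fun s : ι → ℤˣ => rsign (s i) * rsign (s j)
  simp only [flipSign_same, flipSign_of_ne h.symm, rsign_neg, neg_mul,
    Finset.sum_neg_distrib] at h1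
  linarith

lemma card_signs_pos : (0 : ℝ) < Fintype.card (ι → ℤˣ) := by
  exact_mod_cast Fintype.card_pos

end Signs

/-! ### Noncommutative Khintchine inequality -/

section Khintchine

open Matrix

variable {n : Type*} [Fintype n] [DecidableEq n]

lemma exists_orthogonal_diagonalization {A : Matrix n n ℝ} (hA : A.IsHermitian) :
    ∃ (U : Matrix n n ℝ) (l : n → ℝ), U * Uᵀ = 1 ∧ Uᵀ * U = 1 ∧
      ∀ k : ℕ, A ^ k = U * diagonal (fun i => l i ^ k) * Uᵀ := by
  have hU : star (hA.eigenvectorUnitary : Matrix n n ℝ) =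
      (hA.eigenvectorUnitary : Matrix n n ℝ)ᵀ := by
    rw [star_eq_conjTranspose, conjTranspose_eq_transpose_of_trivial]
  have h1 : (hA.eigenvectorUnitary : Matrix n n ℝ) * (hA.eigenvectorUnitary : Matrix n n ℝ)ᵀ = 1 := by
    rw [← hU]; exact Unitary.mul_star_self_of_mem hA.eigenvectorUnitary.2
  have h2 : (hA.eigenvectorUnitary : Matrix n n ℝ)ᵀ * (hA.eigenvectorUnitary : Matrix n n ℝ) = 1 := by
    rw [← hU]; exact Unitary.star_mul_self_of_mem hA.eigenvectorUnitary.2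
  have h3 : A = (hA.eigenvectorUnitary : Matrix n n ℝ) * diagonal hA.eigenvalues *
      (hA.eigenvectorUnitary : Matrix n n ℝ)ᵀ := by
    have := hA.spectral_theorem
    rw [Unitary.conjStarAlgAut_apply, hU] at this
    simpa using this
  generalize (hA.eigenvectorUnitary : Matrix n n ℝ) = U at h1 h2 h3
  refine ⟨U, hA.eigenvalues, h1, h2, fun k => ?_⟩
  generalize hA.eigenvalues = l at h3
  induction k with
  | zero => simp [h1]
  | succ k ih =>
    rw [pow_succ, ih]
    nth_rw 1 [h3]
    have : ∀ (U D E : Matrix n n ℝ), Uᵀ * U = 1 →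
        U * D * Uᵀ * (U * E * Uᵀ) = U * (D * E) * Uᵀ := by
      intro U D E h
      calc U * D * Uᵀ * (U * E * Uᵀ) = U * D * (Uᵀ * U) * E * Uᵀ := by simp only [Matrix.mul_assoc]
        _ = _ := by rw [h]; simp only [Matrix.mul_assoc, Matrix.mul_one]
    rw [this _ _ _ h2, diagonal_mul_diagonal]
    simp only [pow_succ]

/-- For absolute values the difference of the two sides is `(|x|^j - |y|^j) (|x|^k - |y|^k)`, whose
factors have the same sign. Evenness of `j + k` makes the right side insensitive to the absolute
values. -/
lemma pow_mul_pow_add_le (x y : ℝ) {j k : ℕ} (h : Even (j + k)) :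
    x ^ j * y ^ k + x ^ k * y ^ j ≤ x ^ (j + k) + y ^ (j + k) := by
  have h1 : x ^ (j + k) = |x| ^ (j + k) := (h.pow_abs x).symm
  have h2 : y ^ (j + k) = |y| ^ (j + k) := (h.pow_abs y).symm
  have h3 : x ^ j * y ^ k ≤ |x| ^ j * |y| ^ k := by
    rw [← abs_pow, ← abs_pow, ← abs_mul]; exact le_abs_self _
  have h4 : x ^ k * y ^ j ≤ |x| ^ k * |y| ^ j := by
    rw [← abs_pow, ← abs_pow, ← abs_mul]; exact le_abs_self _
  have h5 : 0 ≤ (|x| ^ j - |y| ^ j) * (|x| ^ k - |y| ^ k) := by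
    rcases le_total |x| |y| with hxy | hxy
    · exact mul_nonneg_of_nonpos_of_nonpos
        (sub_nonpos.2 (pow_le_pow_left₀ (abs_nonneg _) hxy _))
        (sub_nonpos.2 (pow_le_pow_left₀ (abs_nonneg _) hxy _))
    · exact mul_nonneg (sub_nonneg.2 (pow_le_pow_left₀ (abs_nonneg _) hxy _))
        (sub_nonneg.2 (pow_le_pow_left₀ (abs_nonneg _) hxy _))
  rw [h1, h2, pow_add, pow_add]
  nlinarith

/-- In eigenbases of `W` and `Y` every trace becomes a sum over pairs of eigenvalues with the
nonnegative weights `(Vᵀ H U) b a ^ 2`, so the scalar inequality applies pair by pair although `W`,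
`Y` and `H` need not commute. -/
lemma trace_pow_mul_pow_add_le {W Y H : Matrix n n ℝ} (hW : W.IsHermitian) (hY : Y.IsHermitian)
    (hH : H.IsHermitian) {j k : ℕ} (hjk : Even (j + k)) :
    trace (H * W ^ j * H * Y ^ k) + trace (H * W ^ k * H * Y ^ j) ≤
      trace (H * H * W ^ (j + k)) + trace (H * H * Y ^ (j + k)) := by
  obtain ⟨U, l, hU1, hU2, hUp⟩ := exists_orthogonal_diagonalization hW
  obtain ⟨V, r, hV1, hV2, hVp⟩ := exists_orthogonal_diagonalization hY
  have hHt : Hᵀ = H := by rw [← conjTranspose_eq_transpose_of_trivial]; exact hH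
  have key : ∀ j k : ℕ, trace (H * W ^ j * H * Y ^ k) =
      ∑ b, ∑ a, (Vᵀ * H * U) b a ^ 2 * (l a ^ j * r b ^ k) := by
    intro j k
    set G := Vᵀ * H * U with hG
    have hGt : Gᵀ = Uᵀ * H * V := by
      rw [hG, transpose_mul, transpose_mul, transpose_transpose, hHt, Matrix.mul_assoc]
    have h1 : trace (H * W ^ j * H * Y ^ k) =
        trace (G * diagonal (fun i => l i ^ j) * (Gᵀ * diagonal (fun i => r i ^ k))) := by
      rw [hUp, hVp, hGt, hG]
      calc _ = trace ((H * U * diagonal (fun i => l i ^ j) * Uᵀ * H * V *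
              diagonal (fun i => r i ^ k)) * Vᵀ) := by simp only [Matrix.mul_assoc]
        _ = _ := by rw [trace_mul_comm]; simp only [Matrix.mul_assoc]
    rw [h1, trace]
    refine Finset.sum_congr rfl fun b _ => ?_
    rw [diag_apply, mul_apply]
    refine Finset.sum_congr rfl fun a _ => ?_
    rw [mul_diagonal, mul_diagonal, transpose_apply]
    ring
  have e1 : trace (H * H * W ^ (j + k)) = trace (H * W ^ (j + k) * H * Y ^ 0) := by
    rw [pow_zero, Matrix.mul_one, Matrix.mul_assoc, trace_mul_comm]
  have e2 : trace (H * H * Y ^ (j + k)) = trace (H * W ^ 0 * H * Y ^ (j + k)) := by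
    rw [pow_zero, Matrix.mul_one]
  rw [e1, e2, key, key, key, key]
  simp only [← Finset.sum_add_distrib, ← mul_add]
  refine Finset.sum_le_sum fun b _ => Finset.sum_le_sum fun a _ => ?_
  refine mul_le_mul_of_nonneg_left ?_ (sq_nonneg _)
  simpa using pow_mul_pow_add_le (l a) (r b) hjk

/-- Reflecting the sum pairs the index `j` with `2p - j`. Each of the `2p + 1` pairs is bounded by
the same quantity, and every term is counted twice. -/
lemma trace_mul_sub_pow_le {W Y H : Matrix n n ℝ} (hW : W.IsHermitian) (hY : Y.IsHermitian)
    (hH : H.IsHermitian) (p : ℕ) :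
    ∑ j ∈ Finset.range (2 * p + 1), trace (H * W ^ j * H * Y ^ (2 * p - j)) ≤
      (2 * p + 1) / 2 * (trace (H * H * W ^ (2 * p)) + trace (H * H * Y ^ (2 * p))) := by
  have h1 := Finset.sum_range_reflect
    (fun j => trace (H * W ^ j * H * Y ^ (2 * p - j))) (2 * p + 1)
  have h2 : ∑ j ∈ Finset.range (2 * p + 1), (trace (H * W ^ j * H * Y ^ (2 * p - j)) +
      trace (H * W ^ (2 * p - j) * H * Y ^ j)) ≤ ∑ j ∈ Finset.range (2 * p + 1),
        (trace (H * H * W ^ (2 * p)) + trace (H * H * Y ^ (2 * p))) := by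
    refine Finset.sum_le_sum fun j hj => ?_
    have hj' : j + (2 * p - j) = 2 * p := by have := Finset.mem_range.1 hj; omega
    have := trace_pow_mul_pow_add_le hW hY hH (j := j) (k := 2 * p - j) (by rw [hj']; simp)
    rwa [hj'] at this
  have h3 : ∑ j ∈ Finset.range (2 * p + 1), trace (H * W ^ (2 * p - j) * H * Y ^ j) =
      ∑ j ∈ Finset.range (2 * p + 1), trace (H * W ^ j * H * Y ^ (2 * p - j)) := by
    rw [← h1]
    refine Finset.sum_congr rfl fun j hj => ?_
    have := Finset.mem_range.1 hj
    rw [show 2 * p + 1 - 1 - j = 2 * p - j by omega, show 2 * p - (2 * p - j) = j by omega]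
  rw [Finset.sum_add_distrib, h3, Finset.sum_const, Finset.card_range, nsmul_eq_mul] at h2
  push_cast at h2
  linarith

lemma pow_sub_pow_eq_sum {R : Type*} [Ring R] (W Y : R) (N : ℕ) :
    W ^ (N + 1) - Y ^ (N + 1) =
      ∑ j ∈ Finset.range (N + 1), W ^ j * (W - Y) * Y ^ (N - j) := by
  induction N with
  | zero => simp
  | succ N ih =>
    rw [Finset.sum_range_succ, Nat.sub_self, pow_zero, mul_one]
    have : ∑ j ∈ Finset.range (N + 1), W ^ j * (W - Y) * Y ^ (N + 1 - j) =
        (∑ j ∈ Finset.range (N + 1), W ^ j * (W - Y) * Y ^ (N - j)) * Y := by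
      rw [Finset.sum_mul]
      refine Finset.sum_congr rfl fun j hj => ?_
      have := Finset.mem_range.1 hj
      rw [show N + 1 - j = (N - j) + 1 by omega, pow_succ, ← mul_assoc]
    rw [this, ← ih]
    rw [pow_succ W (N + 1), pow_succ Y (N + 1)]
    noncomm_ring

variable {ι : Type*} [Fintype ι] [DecidableEq ι]

/-- The Rademacher series `∑ i, s i X i`. -/
def signSum (X : ι → Matrix n n ℝ) (s : ι → ℤˣ) : Matrix n n ℝ := ∑ i, rsign (s i) • X i

omit [Fintype n] [DecidableEq n] [DecidableEq ι] in
lemma signSum_isHermitian {X : ι → Matrix n n ℝ} (hX : ∀ i, (X i).IsHermitian) (s : ι → ℤˣ) :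
    (signSum X s).IsHermitian := by
  rw [signSum, Matrix.IsHermitian, conjTranspose_sum]
  refine Finset.sum_congr rfl fun i _ => ?_
  rw [conjTranspose_smul, hX i]; simp

omit [Fintype n] [DecidableEq n] in
lemma signSum_sub_flipSign (X : ι → Matrix n n ℝ) (s : ι → ℤˣ) (i : ι) :
    signSum X s - signSum X (flipSign i s) = (2 * rsign (s i)) • X i := by
  rw [signSum, signSum, ← Finset.sum_sub_distrib, Finset.sum_eq_single i]
  · rw [flipSign_same, rsign_neg, neg_smul, sub_neg_eq_add, ← add_smul, two_mul]
  · intro j _ hj; rw [flipSign_of_ne hj, sub_self]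
  · simp

/-- Discrete integration by parts. Pairing `s` with the pattern flipped at `i` replaces the odd
power by a difference of odd powers of two matrices that differ by `2 s i X i`. Telescoping this
difference produces a second factor `X i` and removes the sign, since its square is one. -/
lemma sum_sign_mul_trace_le {X : ι → Matrix n n ℝ} (hX : ∀ i, (X i).IsHermitian) (p : ℕ) (i : ι) :
    ∑ s, rsign (s i) * trace (X i * signSum X s ^ (2 * p + 1)) ≤
      (2 * p + 1) * ∑ s, trace (X i * X i * signSum X s ^ (2 * p)) := by
  have h1 := (flipSign i).sum_comp fun s : ι → ℤˣ =>
    rsign (s i) * trace (X i * signSum X s ^ (2 * p + 1))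
  have h2 := (flipSign i).sum_comp fun s : ι → ℤˣ => trace (X i * X i * signSum X s ^ (2 * p))
  simp only [flipSign_same, rsign_neg, neg_mul, Finset.sum_neg_distrib] at h1
  have h3 : ∀ s : ι → ℤˣ, rsign (s i) * trace (X i * signSum X s ^ (2 * p + 1)) -
      rsign (s i) * trace (X i * signSum X (flipSign i s) ^ (2 * p + 1)) ≤
      (2 * p + 1) * (trace (X i * X i * signSum X s ^ (2 * p)) +
        trace (X i * X i * signSum X (flipSign i s) ^ (2 * p))) := by
    intro s
    have h4 : rsign (s i) * trace (X i * signSum X s ^ (2 * p + 1)) -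
      rsign (s i) * trace (X i * signSum X (flipSign i s) ^ (2 * p + 1)) =
      2 * ∑ j ∈ Finset.range (2 * p + 1), trace (X i * signSum X s ^ j * X i *
        signSum X (flipSign i s) ^ (2 * p - j)) := by
      rw [← mul_sub, ← trace_sub, ← Matrix.mul_sub, pow_sub_pow_eq_sum, signSum_sub_flipSign,
        Finset.mul_sum, trace_sum, Finset.mul_sum, Finset.mul_sum]
      refine Finset.sum_congr rfl fun j _ => ?_
      rw [Matrix.mul_smul, Matrix.smul_mul, Matrix.mul_smul, trace_smul, smul_eq_mul, ← mul_assoc,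
        mul_comm (rsign (s i)), mul_assoc 2, rsign_mul_self, mul_one]
      simp only [Matrix.mul_assoc]
    rw [h4]
    have := trace_mul_sub_pow_le (signSum_isHermitian hX s)
      (signSum_isHermitian hX (flipSign i s)) (hX i) p
    linarith
  have h5 := Finset.sum_le_sum fun s (_ : s ∈ Finset.univ) => h3 s
  rw [Finset.sum_sub_distrib, ← Finset.mul_sum, Finset.sum_add_distrib, h2] at h5
  linarith

omit [DecidableEq n] in
-- The left trace is the sum of the quadratic form of `V` over the columns of `Q`, and `trace (Q *
-- Q)` is the sum of their squared lengths.
lemma trace_mul_mul_self_le {V Q : Matrix n n ℝ} (hQ : Q.IsHermitian) {v : ℝ}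
    (hV : ∀ u : n → ℝ, u ⬝ᵥ V *ᵥ u ≤ v * (u ⬝ᵥ u)) :
    trace (V * (Q * Q)) ≤ v * trace (Q * Q) := by
  have hQt : Qᵀ = Q := by rw [← conjTranspose_eq_transpose_of_trivial]; exact hQ
  have e1 : trace (V * (Q * Q)) = ∑ a, (Qᵀ a) ⬝ᵥ V *ᵥ (Qᵀ a) := by
    rw [← Matrix.mul_assoc, trace_mul_comm, trace]
    refine Finset.sum_congr rfl fun a _ => ?_
    rw [diag_apply, mul_apply, dotProduct]
    refine Finset.sum_congr rfl fun b _ => ?_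
    rw [hQt, mul_apply, mulVec, dotProduct]
    congr 1
    refine Finset.sum_congr rfl fun c _ => ?_
    conv_rhs => rw [← hQt, transpose_apply]
  have e2 : trace (Q * Q) = ∑ a, (Qᵀ a) ⬝ᵥ (Qᵀ a) := by
    rw [trace]
    refine Finset.sum_congr rfl fun a _ => ?_
    rw [diag_apply, mul_apply, dotProduct]
    refine Finset.sum_congr rfl fun b _ => ?_
    rw [hQt]
    conv_lhs => rw [← hQt, transpose_apply, hQt]
    conv_rhs => rw [← hQt, transpose_apply, ← transpose_apply Q, hQt]
    rw [← transpose_apply Q, hQt]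
  rw [e1, e2, Finset.mul_sum]
  exact Finset.sum_le_sum fun a _ => hV _

/-- One step of the moment recursion. -/
lemma sum_trace_signSum_pow_succ_le {X : ι → Matrix n n ℝ} (hX : ∀ i, (X i).IsHermitian) {v : ℝ}
    (hv : ∀ u : n → ℝ, u ⬝ᵥ (∑ i, X i * X i) *ᵥ u ≤ v * (u ⬝ᵥ u)) (p : ℕ) :
    ∑ s, trace (signSum X s ^ (2 * (p + 1))) ≤
      (2 * p + 1) * v * ∑ s, trace (signSum X s ^ (2 * p)) := by
  have h1 : ∀ s : ι → ℤˣ, trace (signSum X s ^ (2 * (p + 1))) =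
      ∑ i, rsign (s i) * trace (X i * signSum X s ^ (2 * p + 1)) := by
    intro s
    -- One factor of the even power is peeled off and expanded as the series, so that each summand
    -- carries a single explicit sign.
    rw [show 2 * (p + 1) = (2 * p + 1) + 1 by ring, pow_succ']
    conv_lhs => rw [signSum]
    rw [Finset.sum_mul, trace_sum]
    refine Finset.sum_congr rfl fun i _ => ?_
    rw [Matrix.smul_mul, trace_smul, smul_eq_mul]; rfl
  have h2 : ∀ s : ι → ℤˣ, ∑ i, trace (X i * X i * signSum X s ^ (2 * p)) ≤
      v * trace (signSum X s ^ (2 * p)) := by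
    intro s
    rw [← trace_sum, ← Finset.sum_mul, two_mul, pow_add]
    exact trace_mul_mul_self_le ((signSum_isHermitian hX s).pow p) hv
  simp only [h1]
  rw [Finset.sum_comm]
  calc ∑ i, ∑ s, rsign (s i) * trace (X i * signSum X s ^ (2 * p + 1))
      ≤ ∑ i, (2 * p + 1) * ∑ s, trace (X i * X i * signSum X s ^ (2 * p)) :=
        Finset.sum_le_sum fun i _ => sum_sign_mul_trace_le hX p i
    _ = (2 * p + 1) * ∑ s, ∑ i, trace (X i * X i * signSum X s ^ (2 * p)) := by
        rw [← Finset.mul_sum, Finset.sum_comm]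
    _ ≤ (2 * p + 1) * ∑ s, v * trace (signSum X s ^ (2 * p)) := by
        gcongr with s _
        exact h2 s
    _ = _ := by rw [← Finset.mul_sum]; ring

lemma trace_pow_two_mul_nonneg {Z : Matrix n n ℝ} (hZ : Z.IsHermitian) (p : ℕ) :
    0 ≤ trace (Z ^ (2 * p)) := by
  obtain ⟨U, l, hU1, hU2, hUp⟩ := exists_orthogonal_diagonalization hZ
  rw [hUp, trace_mul_comm, ← Matrix.mul_assoc, hU2, Matrix.one_mul, trace_diagonal]
  exact Finset.sum_nonneg fun i _ => (even_two_mul p).pow_nonneg _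

/-- Noncommutative Khintchine inequality for even moments. -/
theorem sum_trace_signSum_pow_le {X : ι → Matrix n n ℝ} (hX : ∀ i, (X i).IsHermitian) {v : ℝ}
    (hv0 : 0 ≤ v) (hv : ∀ u : n → ℝ, u ⬝ᵥ (∑ i, X i * X i) *ᵥ u ≤ v * (u ⬝ᵥ u)) {p q : ℕ}
    (hpq : p ≤ q) :
    ∑ s, trace (signSum X s ^ (2 * p)) ≤
      (2 * q * v) ^ p * (Fintype.card (ι → ℤˣ) * Fintype.card n) := by
  induction p with
  | zero => simp
  | succ p ih =>
    -- The product of the recursion factors `2p + 1` is bounded by a power: with the final order `q`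
    -- frozen, each factor is at most `2q`.
    have hp : (p : ℝ) + 1 ≤ q := by exact_mod_cast hpq
    have h0 : 0 ≤ ∑ s, trace (signSum X s ^ (2 * p)) :=
      Finset.sum_nonneg fun s _ => trace_pow_two_mul_nonneg (signSum_isHermitian hX s) p
    calc _ ≤ (2 * p + 1) * v * ∑ s, trace (signSum X s ^ (2 * p)) :=
          sum_trace_signSum_pow_succ_le hX hv p
      _ ≤ (2 * q * v) * ∑ s, trace (signSum X s ^ (2 * p)) := by
          gcongr; linarith
      _ ≤ (2 * q * v) * ((2 * q * v) ^ p * (Fintype.card (ι → ℤˣ) * Fintype.card n)) := by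
          gcongr; exact ih (by omega)
      _ = _ := by ring

/-- Quadratic forms are controlled by trace moments. -/
lemma quadForm_pow_le {Z : Matrix n n ℝ} (hZ : Z.IsHermitian) {p : ℕ} (u : n → ℝ) (hp : 0 < p) :
    |u ⬝ᵥ Z *ᵥ u| ^ (2 * p) ≤ (u ⬝ᵥ u) ^ (2 * p) * trace (Z ^ (2 * p)) := by
  obtain ⟨U, l, hU1, hU2, hUp⟩ := exists_orthogonal_diagonalization hZ
  have h1 : trace (Z ^ (2 * p)) = ∑ i, l i ^ (2 * p) := by
    rw [hUp, trace_mul_comm, ← Matrix.mul_assoc, hU2, Matrix.one_mul, trace_diagonal]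
  have h2 : ∀ w : n → ℝ, u ⬝ᵥ (U * diagonal w * Uᵀ) *ᵥ u = ∑ i, w i * (Uᵀ *ᵥ u) i ^ 2 := by
    intro w
    rw [← mulVec_mulVec, ← mulVec_mulVec, dotProduct_mulVec, ← mulVec_transpose, dotProduct]
    refine Finset.sum_congr rfl fun i _ => ?_
    rw [mulVec_diagonal]; ring
  set c := fun i => (Uᵀ *ᵥ u) i ^ 2 with hc
  have h3 : u ⬝ᵥ u = ∑ i, c i := by
    have := h2 1
    rw [show diagonal (1 : n → ℝ) = 1 from diagonal_one, Matrix.mul_one, hU1, one_mulVec] at this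
    simpa using this
  have h4 : u ⬝ᵥ Z *ᵥ u = ∑ i, l i * c i := by
    have := h2 l
    rw [← this]
    have := hUp 1
    simp only [pow_one] at this
    rw [← this]
  rw [h1, h3, h4]
  have hc0 : ∀ i, 0 ≤ c i := fun i => sq_nonneg _
  have h5 : |∑ i, l i * c i| ≤ ∑ i, c i * |l i| := by
    refine (Finset.abs_sum_le_sum_abs _ _).trans (le_of_eq ?_)
    refine Finset.sum_congr rfl fun i _ => ?_
    rw [abs_mul, abs_of_nonneg (hc0 i), mul_comm]
  have hT0 : 0 ≤ ∑ i, l i ^ (2 * p) := Finset.sum_nonneg fun i _ => (even_two_mul p).pow_nonneg _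
  -- The Schatten norm of order `2p`, which dominates every eigenvalue in absolute value.
  set t := (∑ i, l i ^ (2 * p)) ^ ((2 * p : ℕ) : ℝ)⁻¹ with ht
  have ht0 : 0 ≤ t := by positivity
  have htp : t ^ (2 * p) = ∑ i, l i ^ (2 * p) := Real.rpow_inv_natCast_pow hT0 (by omega)
  have h6 : ∀ i, |l i| ≤ t := by
    intro i
    refine le_of_pow_le_pow_left₀ (n := 2 * p) (by omega) ht0 ?_
    rw [htp, (even_two_mul p).pow_abs]
    exact Finset.single_le_sum (f := fun i => l i ^ (2 * p))
      (fun i _ => (even_two_mul p).pow_nonneg _) (Finset.mem_univ i)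
  have h7 : |∑ i, l i * c i| ≤ (∑ i, c i) * t := by
    refine h5.trans ?_
    rw [Finset.sum_mul]
    exact Finset.sum_le_sum fun i _ => mul_le_mul_of_nonneg_left (h6 i) (hc0 i)
  calc _ ≤ ((∑ i, c i) * t) ^ (2 * p) := pow_le_pow_left₀ (abs_nonneg _) h7 _
    _ = _ := by rw [mul_pow, htp]

lemma exp_le_four_pow (p : ℕ) : Real.exp p ≤ 4 ^ p := by
  rw [← Real.exp_one_pow]
  exact pow_le_pow_left₀ (Real.exp_pos _).le (by have := Real.exp_one_lt_d9; linarith) _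

/-- Noncommutative Khintchine inequality for the largest norm in a finite family of Rademacher
series. The function `N` bounds all the norms. -/
theorem exists_khintchine_bound {ρ : Type*} [Fintype ρ] [Nonempty ρ] [Nonempty n]
    {X : ρ → ι → Matrix n n ℝ} (hX : ∀ r i, (X r i).IsHermitian) {v : ℝ} (hv0 : 0 ≤ v)
    (hv : ∀ r, ∀ u : n → ℝ, u ⬝ᵥ (∑ i, X r i * X r i) *ᵥ u ≤ v * (u ⬝ᵥ u)) :
    ∃ N : (ι → ℤˣ) → ℝ, (∀ s, 0 ≤ N s) ∧
      (∀ s r u, |u ⬝ᵥ signSum (X r) s *ᵥ u| ≤ N s * (u ⬝ᵥ u)) ∧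
      (Fintype.card (ι → ℤˣ) : ℝ)⁻¹ * ∑ s, N s ≤
        4 * √(v * (1 + Real.log (Fintype.card n * Fintype.card ρ))) := by
  set R : ℝ := Fintype.card n * Fintype.card ρ with hR
  have hR1 : 1 ≤ R := by
    have h1 : (1 : ℝ) ≤ Fintype.card n := by exact_mod_cast Fintype.card_pos
    have h2 : (1 : ℝ) ≤ Fintype.card ρ := by exact_mod_cast Fintype.card_pos
    nlinarith
  have hL0 : 0 ≤ Real.log R := Real.log_nonneg hR1
  set c : ℝ := (Fintype.card (ι → ℤˣ) : ℝ) with hc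
  have hc0 : 0 < c := card_signs_pos
  -- At order about `log R` the `2p`-th root of `R` is bounded by a constant, so passing from norms
  -- to traces, and from one matrix to the whole family, costs only the factor `√(1 + log R)`. The
  -- added one keeps `p` positive when `R = 1`.
  set p := ⌈Real.log R⌉₊ + 1 with hp
  have hp0 : 0 < p := by omega
  have hpL : Real.log R ≤ p := by
    have := Nat.le_ceil (Real.log R); rw [hp]; push_cast; linarith
  have hpU : (p : ℝ) ≤ 2 * (1 + Real.log R) := by
    have := Nat.ceil_lt_add_one hL0; rw [hp]; push_cast; linarith
  have hT0 : ∀ s r, 0 ≤ trace (signSum (X r) s ^ (2 * p)) := fun s r =>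
    trace_pow_two_mul_nonneg (signSum_isHermitian (hX r) s) p
  -- Summing the trace moments over `r` before taking the root plays the role of a union bound over
  -- the family.
  set N : (ι → ℤˣ) → ℝ := fun s =>
    (∑ r, trace (signSum (X r) s ^ (2 * p))) ^ ((2 * p : ℕ) : ℝ)⁻¹ with hN
  have hS0 : ∀ s, 0 ≤ ∑ r, trace (signSum (X r) s ^ (2 * p)) := fun s =>
    Finset.sum_nonneg fun r _ => hT0 s r
  have hN0 : ∀ s, 0 ≤ N s := fun s => Real.rpow_nonneg (hS0 s) _
  have hNp : ∀ s, N s ^ (2 * p) = ∑ r, trace (signSum (X r) s ^ (2 * p)) := fun s =>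
    Real.rpow_inv_natCast_pow (hS0 s) (by omega)
  refine ⟨N, hN0, fun s r u => ?_, ?_⟩
  · have hu : 0 ≤ u ⬝ᵥ u := Finset.sum_nonneg fun i _ => mul_self_nonneg _
    refine le_of_pow_le_pow_left₀ (n := 2 * p) (by omega) (mul_nonneg (hN0 s) hu) ?_
    rw [mul_pow, hNp, mul_comm (∑ r, _)]
    refine (quadForm_pow_le (signSum_isHermitian (hX r) s) u hp0).trans ?_
    refine mul_le_mul_of_nonneg_left ?_ (pow_nonneg hu _)
    exact Finset.single_le_sum (f := fun r => trace (signSum (X r) s ^ (2 * p)))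
      (fun r _ => hT0 s r) (Finset.mem_univ r)
  · refine le_of_pow_le_pow_left₀ (n := 2 * p) (by omega) (by positivity) ?_
    have h1 : (c⁻¹ * ∑ s, N s) ^ (2 * p) ≤ c⁻¹ * ∑ s, N s ^ (2 * p) := by
      rw [Finset.mul_sum, Finset.mul_sum]
      refine Real.pow_arith_mean_le_arith_mean_pow _ _ _ (fun _ _ => by positivity) ?_
        (fun s _ => hN0 s) _
      rw [Finset.sum_const, Finset.card_univ, nsmul_eq_mul, ← hc, mul_inv_cancel₀ hc0.ne']
    have h2 : ∑ s, N s ^ (2 * p) ≤ (2 * p * v) ^ p * (c * R) := by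
      simp only [hNp]
      rw [Finset.sum_comm]
      calc _ ≤ ∑ r : ρ, (2 * p * v) ^ p * (c * Fintype.card n) :=
            Finset.sum_le_sum fun r _ => sum_trace_signSum_pow_le (hX r) hv0 (hv r) le_rfl
        _ = _ := by
            rw [Finset.sum_const, Finset.card_univ, nsmul_eq_mul, hR]; ring
    -- Replacing `e` by `4` makes the total constant `4 * 4 = 16` inside the `p`-th power, that is,
    -- `4` outside the square root.
    have h3 : R ≤ 4 ^ p := by
      calc R = Real.exp (Real.log R) := (Real.exp_log (by linarith)).symm
        _ ≤ Real.exp p := Real.exp_le_exp.2 hpL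
        _ ≤ _ := exp_le_four_pow p
    calc _ ≤ c⁻¹ * ((2 * p * v) ^ p * (c * R)) := h1.trans (by gcongr)
      _ = (2 * p * v) ^ p * R := by field_simp
      _ ≤ (2 * (2 * (1 + Real.log R)) * v) ^ p * 4 ^ p := by gcongr
      _ = _ := by
          rw [pow_mul, mul_pow 4, Real.sq_sqrt (by positivity), ← mul_pow]; congr 1; ring

end Khintchine

end QuadNTK

namespace QuadNTK

/-! ### Symmetrization and contraction -/

section FiniteSup

variable {T : Type*} [Finite T]

lemma le_iSup_of_finite (f : T → ℝ) (t : T) : f t ≤ ⨆ t, f t :=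
  le_ciSup (Set.finite_range f).bddAbove t

end FiniteSup

section BoundedSup

variable {T : Type*}

lemma le_iSup_of_abs_le {f : T → ℝ} {b : ℝ} (h : ∀ t, |f t| ≤ b) (t : T) : f t ≤ ⨆ t, f t :=
  le_ciSup (f := f) ⟨b, by rintro _ ⟨t, rfl⟩; exact (abs_le.1 (h t)).2⟩ t

lemma abs_iSup_le [Nonempty T] {f : T → ℝ} {b : ℝ} (h : ∀ t, |f t| ≤ b) :
    |⨆ t, f t| ≤ b := by
  obtain ⟨t⟩ := ‹Nonempty T›
  refine abs_le.2 ⟨(abs_le.1 (h t)).1.trans (le_iSup_of_abs_le h t), ?_⟩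
  have : Nonempty T := ⟨t⟩
  exact ciSup_le fun t => (abs_le.1 (h t)).2

lemma iSup_add_le_of_abs_le [Nonempty T] {f g : T → ℝ} {b c : ℝ} (hf : ∀ t, |f t| ≤ b)
    (hg : ∀ t, |g t| ≤ c) : ⨆ t, (f t + g t) ≤ (⨆ t, f t) + ⨆ t, g t :=
  ciSup_le fun t => add_le_add (le_iSup_of_abs_le hf t) (le_iSup_of_abs_le hg t)

end BoundedSup

section Symmetrization

variable {X : Type*} [MeasurableSpace X] {μ : Measure X} [IsProbabilityMeasure μ] {n : ℕ}

lemma integrable_of_abs_le {Ω : Type*} [MeasurableSpace Ω] {ν : Measure Ω} [IsFiniteMeasure ν]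
    {f : Ω → ℝ} (hf : Measurable f) {b : ℝ} (hb : ∀ x, |f x| ≤ b) : Integrable f ν :=
  Integrable.of_bound hf.aestronglyMeasurable b (Filter.Eventually.of_forall hb)

/-- Exchange the coordinates with a negative sign between two samples. -/
def swapSigns (s : Fin n → ℤˣ) (z : (Fin n → X) × (Fin n → X)) : (Fin n → X) × (Fin n → X) :=
  (fun i => if s i = 1 then z.1 i else z.2 i, fun i => if s i = 1 then z.2 i else z.1 i)

/-- A pair of samples is rearranged into a sample of pairs. There the map acts coordinatewise, as
the identity or as the swap on `μ.prod μ`. -/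
lemma measurePreserving_swapSigns (s : Fin n → ℤˣ) :
    MeasurePreserving (swapSigns s : (Fin n → X) × (Fin n → X) → _)
      ((Measure.pi fun _ => μ).prod (Measure.pi fun _ => μ))
      ((Measure.pi fun _ => μ).prod (Measure.pi fun _ => μ)) := by
  have h1 := measurePreserving_arrowProdEquivProdArrow X X (Fin n) (fun _ => μ) (fun _ => μ)
  have h2 : MeasurePreserving
      (fun (a : Fin n → X × X) i => (if s i = 1 then id else Prod.swap) (a i))
      (Measure.pi fun _ => μ.prod μ) (Measure.pi fun _ => μ.prod μ) := by
    refine measurePreserving_pi _ _ fun i => ?_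
    split_ifs
    · exact MeasurePreserving.id _
    · exact Measure.measurePreserving_swap
  have h3 := h1.comp (h2.comp (h1.symm _))
  convert h3 using 1
  funext z
  ext i <;> by_cases h : s i = 1 <;>
    simp [swapSigns, h, MeasurableEquiv.arrowProdEquivProdArrow, Equiv.arrowProdEquivProdArrow]

lemma integral_pi_sum_eval {f : X → ℝ} (hf : Integrable f μ) :
    ∫ x : Fin n → X, ∑ i, f (x i) ∂(Measure.pi fun _ => μ) = n * ∫ x, f x ∂μ := by
  rw [integral_finsetSum]
  · have : ∀ i : Fin n, ∫ x : Fin n → X, f (x i) ∂(Measure.pi fun _ => μ) = ∫ x, f x ∂μ :=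
      fun i => integral_comp_eval (μ := fun _ : Fin n => μ) (i := i) hf.aestronglyMeasurable
    simp [this]
  · intro i _
    exact integrable_comp_eval (μ := fun _ : Fin n => μ) (i := i) hf

variable {T : Type*} [Countable T]

lemma abs_sum_rsign_mul_le (s : Fin n → ℤˣ) {v : Fin n → ℝ} {b : ℝ} (hv : ∀ i, |v i| ≤ b) :
    |∑ i, rsign (s i) * v i| ≤ n * b := by
  refine (Finset.abs_sum_le_sum_abs _ _).trans ?_
  calc _ ≤ ∑ _i : Fin n, b := Finset.sum_le_sum fun i _ => by
        rw [abs_mul, abs_rsign, one_mul]; exact hv i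
    _ = _ := by simp

lemma measurable_iSup_sum_rsign {F : T → X → ℝ} (hF : ∀ t, Measurable (F t)) (s : Fin n → ℤˣ) :
    Measurable fun x : Fin n → X => ⨆ t, ∑ i, rsign (s i) * F t (x i) := by
  refine Measurable.iSup fun t => ?_
  exact Finset.measurable_sum _ fun i _ => ((hF t).comp (measurable_pi_apply i)).const_mul _

lemma integrable_iSup_sum_rsign [Nonempty T] {F : T → X → ℝ} (hF : ∀ t, Measurable (F t)) {b : ℝ}
    (hb : ∀ t x, |F t x| ≤ b) (s : Fin n → ℤˣ) :
    Integrable (fun x : Fin n → X => ⨆ t, ∑ i, rsign (s i) * F t (x i))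
      (Measure.pi fun _ => μ) :=
  integrable_of_abs_le (measurable_iSup_sum_rsign hF s) (b := n * b) fun _ =>
    abs_iSup_le fun t => abs_sum_rsign_mul_le s fun _ => hb t _

/-- The expectation of the class is written as the mean over a ghost sample and the supremum is
moved inside. The joint law does not change when coordinates are exchanged according to `s`, which
inserts the signs; the supremum of the difference is then split into one supremum for each sample.
-/
lemma integral_iSup_sub_le_of_sign [Nonempty T] {F : T → X → ℝ} (hF : ∀ t, Measurable (F t)) {b : ℝ}
    (hb : ∀ t x, |F t x| ≤ b) (s : Fin n → ℤˣ) :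
    ∫ x : Fin n → X, ⨆ t, (n * ∫ y, F t y ∂μ - ∑ i, F t (x i)) ∂(Measure.pi fun _ => μ) ≤
      (∫ x : Fin n → X, ⨆ t, ∑ i, rsign (s i) * F t (x i) ∂(Measure.pi fun _ => μ)) +
      ∫ x : Fin n → X, ⨆ t, ∑ i, rsign (-s i) * F t (x i) ∂(Measure.pi fun _ => μ) := by
  set π : Measure (Fin n → X) := Measure.pi fun _ => μ with hπ
  have hFi : ∀ t, Integrable (F t) μ := fun t => integrable_of_abs_le (hF t) (hb t)
  have hsum : ∀ t (x : Fin n → X), |∑ i, F t (x i)| ≤ n * b := fun t x => by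
    simpa using abs_sum_rsign_mul_le (fun _ => 1) fun i => hb t (x i)
  have hint : ∀ t, |∫ y, F t y ∂μ| ≤ b := fun t => by
    have := norm_integral_le_of_norm_le_const (μ := μ) (f := F t) (C := b)
      (Filter.Eventually.of_forall (hb t))
    simpa using this
  have hms : ∀ t, Measurable fun x : Fin n → X => ∑ i, F t (x i) := fun t =>
    Finset.measurable_sum _ fun i _ => (hF t).comp (measurable_pi_apply i)
  set G : (Fin n → X) × (Fin n → X) → ℝ := fun z => ⨆ t, (∑ i, F t (z.2 i) - ∑ i, F t (z.1 i))
    with hG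
  have hGm : Measurable G := Measurable.iSup fun t =>
    ((hms t).comp measurable_snd).sub ((hms t).comp measurable_fst)
  have hGb : ∀ z, |G z| ≤ n * b + n * b := fun z => abs_iSup_le fun t =>
    (abs_sub _ _).trans (add_le_add (hsum t _) (hsum t _))
  have hGi : Integrable G (π.prod π) := integrable_of_abs_le hGm hGb
  have h1 : ∫ x, ⨆ t, (n * ∫ y, F t y ∂μ - ∑ i, F t (x i)) ∂π ≤ ∫ z, G z ∂(π.prod π) := by
    rw [integral_prod _ hGi]
    refine integral_mono ?_ hGi.integral_prod_left fun x => ciSup_le fun t => ?_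
    · refine integrable_of_abs_le (Measurable.iSup fun t => measurable_const.sub (hms t))
        (b := n * b + n * b) fun x => abs_iSup_le fun t => ?_
      refine (abs_sub _ _).trans (add_le_add ?_ (hsum t _))
      rw [abs_mul, Nat.abs_cast]
      exact mul_le_mul_of_nonneg_left (hint t) (Nat.cast_nonneg n)
    · have h2 : n * ∫ y, F t y ∂μ - ∑ i, F t (x i) =
          ∫ x', (∑ i, F t (x' i) - ∑ i, F t (x i)) ∂π := by
        rw [integral_sub (integrable_of_abs_le (hms t) (hsum t)) (integrable_const _),
          integral_pi_sum_eval (hFi t)]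
        simp
      rw [h2]
      refine integral_mono ?_ ?_ fun x' =>
        le_iSup_of_abs_le (fun t => (abs_sub _ _).trans (add_le_add (hsum t x') (hsum t x))) t
      · exact (integrable_of_abs_le (hms t) (hsum t)).sub (integrable_const _)
      · exact integrable_of_abs_le (hGm.comp measurable_prodMk_left) fun x' => hGb (x, x')
  have h3 : ∫ z, G z ∂(π.prod π) = ∫ z, G (swapSigns s z) ∂(π.prod π) := by
    have hmp := measurePreserving_swapSigns (μ := μ) s
    have := integral_map (μ := π.prod π) hmp.measurable.aemeasurable (f := G)
      hGm.aestronglyMeasurable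
    rwa [show Measure.map (swapSigns s) (π.prod π) = π.prod π from hmp.map_eq] at this
  rw [h3] at h1
  refine h1.trans ?_
  have i1 := integrable_iSup_sum_rsign (μ := μ) hF hb s
  have i2 := integrable_iSup_sum_rsign (μ := μ) hF hb fun i => -s i
  have h4 : ∀ z, G (swapSigns s z) ≤ (⨆ t, ∑ i, rsign (s i) * F t (z.2 i)) +
      ⨆ t, ∑ i, rsign (-s i) * F t (z.1 i) := by
    intro z
    refine le_trans (le_of_eq ?_) (iSup_add_le_of_abs_le
      (fun t => abs_sum_rsign_mul_le s fun i => hb t (z.2 i))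
      (fun t => abs_sum_rsign_mul_le (fun i => -s i) fun i => hb t (z.1 i)))
    refine iSup_congr fun t => ?_
    rw [← Finset.sum_sub_distrib, ← Finset.sum_add_distrib]
    refine Finset.sum_congr rfl fun i _ => ?_
    rcases Int.units_eq_one_or (s i) with h | h <;> simp [swapSigns, h] <;> ring
  calc _ ≤ ∫ z, ((⨆ t, ∑ i, rsign (s i) * F t (z.2 i)) +
      ⨆ t, ∑ i, rsign (-s i) * F t (z.1 i)) ∂(π.prod π) :=
        integral_mono ((measurePreserving_swapSigns (μ := μ) s).integrable_comp_of_integrable hGi)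
          ((i1.comp_snd π).add (i2.comp_fst π)) h4
    _ = _ := by
        rw [integral_add (i1.comp_snd π) (i2.comp_fst π),
          integral_fun_snd (fun x : Fin n → X => ⨆ t, ∑ i, rsign (s i) * F t (x i)),
          integral_fun_fst (fun x : Fin n → X => ⨆ t, ∑ i, rsign (-s i) * F t (x i))]
        simp [π]

/-- Symmetrization for a countable class of bounded functions. -/
theorem integral_iSup_sub_le [Nonempty T] {F : T → X → ℝ} (hF : ∀ t, Measurable (F t)) {b : ℝ}
    (hb : ∀ t x, |F t x| ≤ b) :
    ∫ x : Fin n → X, ⨆ t, (n * ∫ y, F t y ∂μ - ∑ i, F t (x i)) ∂(Measure.pi fun _ => μ) ≤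
      2 * ∫ x : Fin n → X, (Fintype.card (Fin n → ℤˣ) : ℝ)⁻¹ *
        ∑ s : Fin n → ℤˣ, ⨆ t, ∑ i, rsign (s i) * F t (x i) ∂(Measure.pi fun _ => μ) := by
  -- Summed over all sign patterns, the terms with `s` and with `-s` agree, hence the factor two.
  have h1 := Finset.sum_le_sum fun s (_ : s ∈ Finset.univ) =>
    integral_iSup_sub_le_of_sign (μ := μ) (n := n) hF hb s
  rw [Finset.sum_const, Finset.sum_add_distrib, Finset.card_univ, nsmul_eq_mul,
    sum_signs_neg fun s : Fin n → ℤˣ =>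
      ∫ x : Fin n → X, ⨆ t, ∑ i, rsign (s i) * F t (x i) ∂(Measure.pi fun _ => μ)] at h1
  rw [integral_const_mul, integral_finsetSum _ fun s _ =>
    integrable_iSup_sum_rsign (μ := μ) hF hb s]
  have hc : (0 : ℝ) < Fintype.card (Fin n → ℤˣ) := card_signs_pos
  rw [← mul_assoc, mul_comm 2, mul_assoc, inv_mul_eq_div, le_div_iff₀ hc]
  linarith

end Symmetrization

/-! ### Contraction principle for Rademacher averages -/

section Contraction

variable {T : Type*} [Finite T] [Nonempty T]

/-- Let `t` and `t'` attain the two suprema on the left. Only `w t - w t'` enters, and it is at most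
`|v t - v t'|`. The sign of `v t - v t'` decides which of the two points is tested in which supremum
on the right. -/
lemma iSup_add_iSup_contraction (u v w : T → ℝ) (h : ∀ t t', |w t - w t'| ≤ |v t - v t'|) :
    (⨆ t, (u t + w t)) + (⨆ t, (u t - w t)) ≤ (⨆ t, (u t + v t)) + ⨆ t, (u t - v t) := by
  obtain ⟨t, ht⟩ := exists_eq_ciSup_of_finite (f := fun t => u t + w t)
  obtain ⟨t', ht'⟩ := exists_eq_ciSup_of_finite (f := fun t => u t - w t)
  rw [← ht, ← ht']
  have h1 := le_iSup_of_finite (fun t => u t + v t) t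
  have h2 := le_iSup_of_finite (fun t => u t - v t) t'
  have h3 := le_iSup_of_finite (fun t => u t + v t) t'
  have h4 := le_iSup_of_finite (fun t => u t - v t) t
  have h5 := (le_abs_self _).trans (h t t')
  rcases abs_cases (v t - v t') with ⟨h6, _⟩ | ⟨h6, _⟩ <;> linarith

variable {ι : Type*} [Fintype ι] [DecidableEq ι]

/-- The contraction principle for Rademacher averages of finite classes. -/
theorem sum_iSup_contraction (v : T → ι → ℝ) (ψ : ι → ℝ → ℝ)
    (hψ : ∀ i x y, |ψ i x - ψ i y| ≤ |x - y|) :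
    ∑ s : ι → ℤˣ, ⨆ t, ∑ i, rsign (s i) * ψ i (v t i) ≤
      ∑ s : ι → ℤˣ, ⨆ t, ∑ i, rsign (s i) * v t i := by
  -- The functions `ψ i` are removed one coordinate at a time; `A` is the set of coordinates already
  -- treated.
  have key : ∀ A : Finset ι, ∑ s : ι → ℤˣ, ⨆ t, ∑ i, rsign (s i) * ψ i (v t i) ≤
      ∑ s : ι → ℤˣ, ⨆ t, ∑ i, rsign (s i) * (if i ∈ A then v t i else ψ i (v t i)) := by
    intro A
    induction A using Finset.induction_on with
    | empty => simp
    | insert j A hj ih =>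
      refine ih.trans ?_
      have hsplit : ∀ (s : ι → ℤˣ) (t : T) (A : Finset ι),
          ∑ i, rsign (s i) * (if i ∈ A then v t i else ψ i (v t i)) =
          (∑ i ∈ Finset.univ.erase j, rsign (s i) * (if i ∈ A then v t i else ψ i (v t i))) +
            rsign (s j) * (if j ∈ A then v t j else ψ j (v t j)) := fun s t A =>
        (Finset.sum_erase_add _ _ (Finset.mem_univ j)).symm
      have hoff : ∀ (s : ι → ℤˣ) (t : T),
          ∑ i ∈ Finset.univ.erase j, rsign (s i) *
            (if i ∈ insert j A then v t i else ψ i (v t i)) =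
          ∑ i ∈ Finset.univ.erase j, rsign (s i) * (if i ∈ A then v t i else ψ i (v t i)) := by
        intro s t
        refine Finset.sum_congr rfl fun i hi => ?_
        simp [Finset.mem_insert, Finset.ne_of_mem_erase hi]
      have hflip : ∀ (s : ι → ℤˣ) (t : T),
          ∑ i ∈ Finset.univ.erase j, rsign (flipSign j s i) *
            (if i ∈ A then v t i else ψ i (v t i)) =
          ∑ i ∈ Finset.univ.erase j, rsign (s i) * (if i ∈ A then v t i else ψ i (v t i)) := by
        intro s t
        refine Finset.sum_congr rfl fun i hi => ?_
        rw [flipSign_of_ne (Finset.ne_of_mem_erase hi)]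
      -- Pairing `s` with its flip at `j` gives two suprema whose remaining coordinates agree, which
      -- is the two-point situation of `iSup_add_iSup_contraction`.
      have h1 := (flipSign j).sum_comp fun s : ι → ℤˣ =>
        ⨆ t, ∑ i, rsign (s i) * (if i ∈ A then v t i else ψ i (v t i))
      have h2 := (flipSign j).sum_comp fun s : ι → ℤˣ =>
        ⨆ t, ∑ i, rsign (s i) * (if i ∈ insert j A then v t i else ψ i (v t i))
      simp only [hsplit, hoff, hflip, hj, if_false, Finset.mem_insert_self, if_true,
        flipSign_same, rsign_neg] at h1 h2 ⊢
      have h3 : ∀ s : ι → ℤˣ, _ := fun s => iSup_add_iSup_contraction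
        (fun t => ∑ i ∈ Finset.univ.erase j, rsign (s i) *
          (if i ∈ A then v t i else ψ i (v t i)))
        (fun t => rsign (s j) * v t j) (fun t => rsign (s j) * ψ j (v t j)) fun t t' => by
          rw [← mul_sub, ← mul_sub, abs_mul, abs_mul, abs_rsign, one_mul, one_mul]
          exact hψ _ _ _
      have h4 := Finset.sum_le_sum fun s (_ : s ∈ Finset.univ) => h3 s
      simp only [Finset.sum_add_distrib, sub_eq_add_neg, ← neg_mul] at h4
      linarith
  simpa using key Finset.univ

end Contraction

end QuadNTK

namespace QuadNTK

/-! ### Square roots and whitening -/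

section Whitening

open Matrix

variable {D : ℕ}

open scoped MatrixOrder in
lemma psdSqrt_mul_self {A : Matrix (Fin D) (Fin D) ℝ} (hA : A.PosSemidef) :
    psdSqrt A * psdSqrt A = A :=
  CFC.sqrt_mul_sqrt_self A hA.nonneg

open scoped MatrixOrder in
lemma psdSqrt_transpose (A : Matrix (Fin D) (Fin D) ℝ) : (psdSqrt A)ᵀ = psdSqrt A := by
  have h : (psdSqrt A).PosSemidef := (CFC.sqrt_nonneg A).posSemidef
  have := h.isHermitian
  rwa [Matrix.IsHermitian, conjTranspose_eq_transpose_of_trivial] at this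

lemma dotProduct_eq_inner (x y : EuclideanSpace ℝ (Fin D)) :
    inner ℝ x y = x.ofLp ⬝ᵥ y.ofLp := by
  rw [EuclideanSpace.inner_eq_star_dotProduct, star_trivial, dotProduct_comm]

lemma norm_sq_eq_dotProduct (x : EuclideanSpace ℝ (Fin D)) :
    ‖x‖ ^ 2 = x.ofLp ⬝ᵥ x.ofLp := by
  rw [← real_inner_self_eq_norm_sq, dotProduct_eq_inner]

lemma psdSqrt_mulVec_dotProduct {A : Matrix (Fin D) (Fin D) ℝ} (hA : A.PosSemidef)
    (u : Fin D → ℝ) : (psdSqrt A *ᵥ u) ⬝ᵥ (psdSqrt A *ᵥ u) = u ⬝ᵥ A *ᵥ u := by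
  nth_rw 3 [← psdSqrt_mul_self hA]
  rw [← mulVec_mulVec, dotProduct_mulVec u, ← mulVec_transpose, psdSqrt_transpose]

lemma isUnit_det_psdSqrt {A : Matrix (Fin D) (Fin D) ℝ} (hA : A.PosSemidef) {c : ℝ} (hc : 0 < c)
    (h : ∀ u : Fin D → ℝ, c * (u ⬝ᵥ u) ≤ u ⬝ᵥ A *ᵥ u) : IsUnit (psdSqrt A).det := by
  rw [← Matrix.isUnit_iff_isUnit_det, ← Matrix.mulVec_injective_iff_isUnit]
  refine (injective_iff_map_eq_zero (mulVecLin (psdSqrt A))).2 fun u hu => ?_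
  have hu' : psdSqrt A *ᵥ u = 0 := hu
  have h1 := psdSqrt_mulVec_dotProduct hA u
  rw [hu', dotProduct_zero] at h1
  have h2 := h u
  have h3 : 0 ≤ u ⬝ᵥ u := Finset.sum_nonneg fun i _ => mul_self_nonneg _
  exact dotProduct_self_eq_zero.1 (by nlinarith)

lemma psdSqrt_mulVec_inv_mulVec {A : Matrix (Fin D) (Fin D) ℝ} (hA : A.PosSemidef) {c : ℝ}
    (hc : 0 < c) (h : ∀ u : Fin D → ℝ, c * (u ⬝ᵥ u) ≤ u ⬝ᵥ A *ᵥ u) (u : Fin D → ℝ) :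
    psdSqrt A *ᵥ ((psdSqrt A)⁻¹ *ᵥ u) = u := by
  rw [mulVec_mulVec, mul_nonsing_inv _ (isUnit_det_psdSqrt hA hc h), one_mulVec]

/-- The lower bound on `A` is evaluated at the whitened vector itself. This is how whitening costs
at most a factor `1/c` in squared norm. -/
lemma inv_psdSqrt_mulVec_dotProduct_le {A : Matrix (Fin D) (Fin D) ℝ} (hA : A.PosSemidef) {c : ℝ}
    (hc : 0 < c) (h : ∀ u : Fin D → ℝ, c * (u ⬝ᵥ u) ≤ u ⬝ᵥ A *ᵥ u) (u : Fin D → ℝ) :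
    c * (((psdSqrt A)⁻¹ *ᵥ u) ⬝ᵥ ((psdSqrt A)⁻¹ *ᵥ u)) ≤ u ⬝ᵥ u := by
  have h1 := h ((psdSqrt A)⁻¹ *ᵥ u)
  rwa [← psdSqrt_mulVec_dotProduct hA, psdSqrt_mulVec_inv_mulVec hA hc h] at h1

lemma vecMul_psdSqrt (A : Matrix (Fin D) (Fin D) ℝ) (u : Fin D → ℝ) :
    u ᵥ* psdSqrt A = psdSqrt A *ᵥ u := by
  rw [← mulVec_transpose, psdSqrt_transpose]

/-- Inner products in terms of whitened vectors. -/
lemma dotProduct_eq_psdSqrt_dotProduct {A : Matrix (Fin D) (Fin D) ℝ} (hA : A.PosSemidef) {c : ℝ}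
    (hc : 0 < c) (h : ∀ u : Fin D → ℝ, c * (u ⬝ᵥ u) ≤ u ⬝ᵥ A *ᵥ u) (u w : Fin D → ℝ) :
    (psdSqrt A *ᵥ w) ⬝ᵥ ((psdSqrt A)⁻¹ *ᵥ u) = w ⬝ᵥ u := by
  rw [← vecMul_psdSqrt, ← dotProduct_mulVec, psdSqrt_mulVec_inv_mulVec hA hc h]

lemma norm_sq_rowMul_psdSqrt {m : ℕ} {A : Matrix (Fin D) (Fin D) ℝ} (hA : A.PosSemidef)
    (W : Weights m D) (r : Fin m) :
    ‖rowMul W (psdSqrt A) r‖ ^ 2 = (W r).ofLp ⬝ᵥ A *ᵥ (W r).ofLp := by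
  rw [norm_sq_eq_dotProduct, rowMul]
  simp only [vecMul_psdSqrt]
  exact psdSqrt_mulVec_dotProduct hA _

lemma norm_sq_le_rowMul_psdSqrt {m : ℕ} {A : Matrix (Fin D) (Fin D) ℝ} (hA : A.PosSemidef)
    {c : ℝ} (h : ∀ u : Fin D → ℝ, c * (u ⬝ᵥ u) ≤ u ⬝ᵥ A *ᵥ u)
    (W : Weights m D) (r : Fin m) :
    c * ‖W r‖ ^ 2 ≤ ‖rowMul W (psdSqrt A) r‖ ^ 2 := by
  rw [norm_sq_rowMul_psdSqrt hA, norm_sq_eq_dotProduct]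
  exact h _

lemma norm24_nonneg {m : ℕ} (W : Weights m D) : 0 ≤ norm24 W :=
  Real.rpow_nonneg (Finset.sum_nonneg fun r _ => by positivity) _

lemma norm24_pow_four {m : ℕ} (W : Weights m D) : norm24 W ^ 4 = ∑ r, ‖W r‖ ^ 4 := by
  have h0 : 0 ≤ ∑ r, ‖W r‖ ^ 4 := Finset.sum_nonneg fun r _ => by positivity
  rw [norm24, ← Real.rpow_natCast, ← Real.rpow_mul h0]
  norm_num

end Whitening

/-! ### Rank-one matrices and empirical second moments -/

section SecondMoment

open Matrix

variable {D : ℕ}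

lemma vecMulVec_isHermitian (u : Fin D → ℝ) : (vecMulVec u u).IsHermitian := by
  rw [Matrix.IsHermitian, conjTranspose_eq_transpose_of_trivial, transpose_vecMulVec]

lemma dotProduct_vecMulVec_mulVec (u w : Fin D → ℝ) :
    u ⬝ᵥ vecMulVec w w *ᵥ u = (w ⬝ᵥ u) ^ 2 := by
  rw [vecMulVec_mulVec, dotProduct_smul]
  simp [dotProduct_comm u w, sq]

lemma vecMulVec_mul_self (u : Fin D → ℝ) :
    vecMulVec u u * vecMulVec u u = (u ⬝ᵥ u) • vecMulVec u u := by
  ext i j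
  simp only [vecMulVec_mul_vecMulVec, vecMulVec_apply, Matrix.smul_apply, Pi.smul_apply,
    smul_eq_mul]
  ring

lemma dotProduct_sum_mulVec {ι : Type*} (s : Finset ι) (M : ι → Matrix (Fin D) (Fin D) ℝ)
    (u : Fin D → ℝ) : u ⬝ᵥ (∑ i ∈ s, M i) *ᵥ u = ∑ i ∈ s, u ⬝ᵥ M i *ᵥ u := by
  rw [sum_mulVec, dotProduct_sum]

lemma dotProduct_smul_mulVec (c : ℝ) (M : Matrix (Fin D) (Fin D) ℝ)
    (u : Fin D → ℝ) : u ⬝ᵥ (c • M) *ᵥ u = c * (u ⬝ᵥ M *ᵥ u) := by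
  rw [smul_mulVec, dotProduct_smul, smul_eq_mul]

lemma dotProduct_empCov_mulVec {d N : ℕ} (g : Input d → EuclideanSpace ℝ (Fin D))
    (xs : Fin N → Input d) (u : Fin D → ℝ) :
    u ⬝ᵥ empCov g xs *ᵥ u = (1 / (N : ℝ)) * ∑ i, ((g (xs i)).ofLp ⬝ᵥ u) ^ 2 := by
  rw [empCov, dotProduct_smul_mulVec, dotProduct_sum_mulVec]
  simp only [dotProduct_vecMulVec_mulVec]

lemma posSemidef_of_quadForm_nonneg {M : Matrix (Fin D) (Fin D) ℝ} (hM : Mᵀ = M)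
    (h : ∀ u : Fin D → ℝ, 0 ≤ u ⬝ᵥ M *ᵥ u) : M.PosSemidef := by
  refine Matrix.PosSemidef.of_dotProduct_mulVec_nonneg ?_ fun u => ?_
  · rw [Matrix.IsHermitian, conjTranspose_eq_transpose_of_trivial, hM]
  · rw [star_trivial]; exact h u

lemma empCov_posSemidef {d N : ℕ} (g : Input d → EuclideanSpace ℝ (Fin D))
    (xs : Fin N → Input d) : (empCov g xs).PosSemidef := by
  refine posSemidef_of_quadForm_nonneg ?_ fun u => ?_
  · rw [empCov, transpose_smul, transpose_sum]
    simp [transpose_vecMulVec]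
  · rw [dotProduct_empCov_mulVec]
    exact mul_nonneg (by positivity) (Finset.sum_nonneg fun i _ => sq_nonneg _)

lemma dotProduct_sq_le (u w : Fin D → ℝ) : (u ⬝ᵥ w) ^ 2 ≤ (u ⬝ᵥ u) * (w ⬝ᵥ w) := by
  have := Finset.sum_mul_sq_le_sq_mul_sq Finset.univ u w
  simpa [dotProduct, sq] using this

/-- Khintchine bound for the rank one matrices `c r i • h i h iᵀ`. -/
lemma exists_khintchine_bound_rankOne {ι ρ : Type*} [Fintype ι] [DecidableEq ι] [Fintype ρ]
    [Nonempty ρ] (hD : 0 < D) {c : ρ → ι → ℝ} {h : ι → Fin D → ℝ} {K b Λ : ℝ} (hb : 0 ≤ b)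
    (hΛ : 0 ≤ Λ) (hc : ∀ r i, |c r i| ≤ K) (hh : ∀ i, h i ⬝ᵥ h i ≤ b)
    (hsum : ∀ u : Fin D → ℝ, ∑ i, (h i ⬝ᵥ u) ^ 2 ≤ Λ * (u ⬝ᵥ u)) :
    ∃ N : (ι → ℤˣ) → ℝ, (∀ s, 0 ≤ N s) ∧
      (∀ s r u, |∑ i, rsign (s i) * (c r i * (h i ⬝ᵥ u) ^ 2)| ≤ N s * (u ⬝ᵥ u)) ∧
      (Fintype.card (ι → ℤˣ) : ℝ)⁻¹ * ∑ s, N s ≤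
        4 * √(K ^ 2 * b * Λ * (1 + Real.log (D * Fintype.card ρ))) := by
  have : Nonempty (Fin D) := ⟨⟨0, hD⟩⟩
  obtain ⟨N, hN0, hN1, hN2⟩ := exists_khintchine_bound
    (X := fun (r : ρ) (i : ι) => c r i • vecMulVec (h i) (h i)) (v := K ^ 2 * b * Λ)
    (fun r i => by
      have := vecMulVec_isHermitian (h i)
      rw [Matrix.IsHermitian, conjTranspose_smul, this, star_trivial])
    (by positivity)
    (fun r u => by
      rw [dotProduct_sum_mulVec]
      -- The square of a rank-one matrix `h hᵀ` is `‖h‖²` times itself, so the variance proxy is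
      -- linear, not quadratic, in the largest eigenvalue `Λ`.
      calc _ ≤ ∑ i, K ^ 2 * b * (h i ⬝ᵥ u) ^ 2 := by
            refine Finset.sum_le_sum fun i _ => ?_
            rw [smul_mul_smul_comm, vecMulVec_mul_self, smul_smul, dotProduct_smul_mulVec,
              dotProduct_vecMulVec_mulVec]
            refine mul_le_mul_of_nonneg_right ?_ (sq_nonneg _)
            refine mul_le_mul ?_ (hh i) (Finset.sum_nonneg fun i _ => mul_self_nonneg _)
              (sq_nonneg _)
            rw [← sq, ← sq_abs]
            exact pow_le_pow_left₀ (abs_nonneg _) (hc r i) 2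
        _ ≤ _ := by
            rw [← Finset.mul_sum, mul_assoc (K ^ 2 * b)]
            exact mul_le_mul_of_nonneg_left (hsum u) (by positivity))
  refine ⟨N, hN0, fun s r u => ?_, by simpa using hN2⟩
  have := hN1 s r u
  rw [signSum, dotProduct_sum_mulVec] at this
  simpa only [smul_smul, dotProduct_smul_mulVec, dotProduct_vecMulVec_mulVec, mul_assoc] using this

end SecondMoment

end QuadNTK

namespace QuadNTK

/-! ### Concentration of the empirical covariance -/

section Concentration

open Matrix

variable {D : ℕ}

/-- A dense sequence in the closed unit ball. -/
noncomputable def unitSeq (D : ℕ) (t : ℕ) : EuclideanSpace ℝ (Fin D) :=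
  have : Nonempty (Metric.closedBall (0 : EuclideanSpace ℝ (Fin D)) 1) := ⟨⟨0, by simp⟩⟩
  (TopologicalSpace.denseSeq (Metric.closedBall (0 : EuclideanSpace ℝ (Fin D)) 1) t : _)

lemma unitSeq_dotProduct_le (t : ℕ) : (unitSeq D t).ofLp ⬝ᵥ (unitSeq D t).ofLp ≤ 1 := by
  rw [← norm_sq_eq_dotProduct]
  have h : ‖unitSeq D t‖ ≤ 1 := by
    have : Nonempty (Metric.closedBall (0 : EuclideanSpace ℝ (Fin D)) 1) := ⟨⟨0, by simp⟩⟩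
    have := (TopologicalSpace.denseSeq (Metric.closedBall (0 : EuclideanSpace ℝ (Fin D)) 1) t).2
    exact mem_closedBall_zero_iff.1 this
  exact pow_le_one₀ (norm_nonneg _) h

lemma le_of_forall_unitSeq_le {f : EuclideanSpace ℝ (Fin D) → ℝ} (hf : Continuous f) {c : ℝ}
    (h : ∀ t, f (unitSeq D t) ≤ c) {u : EuclideanSpace ℝ (Fin D)} (hu : ‖u‖ ≤ 1) : f u ≤ c := by
  have : Nonempty (Metric.closedBall (0 : EuclideanSpace ℝ (Fin D)) 1) := ⟨⟨0, by simp⟩⟩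
  have hd := TopologicalSpace.denseRange_denseSeq
    (Metric.closedBall (0 : EuclideanSpace ℝ (Fin D)) 1)
  exact hd.induction_on (p := fun u : Metric.closedBall (0 : EuclideanSpace ℝ (Fin D)) 1 =>
    f u ≤ c) ⟨u, by simpa using hu⟩
    (isClosed_le (hf.comp continuous_subtype_val) continuous_const) h

lemma continuous_quadratic {n : ℕ} (h : Fin n → Fin D → ℝ) (a b : ℝ) :
    Continuous fun u : EuclideanSpace ℝ (Fin D) =>
      a * ∑ i, (h i ⬝ᵥ u.ofLp) ^ 2 + b * ‖u‖ ^ 2 := by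
  simp only [dotProduct]
  fun_prop

/-- Scaling a quadratic inequality from the unit ball to the whole space. -/
lemma quadratic_le_of_unitSeq {n : ℕ} (h : Fin n → Fin D → ℝ) (a b c : ℝ)
    (H : ∀ t, a * ∑ i, (h i ⬝ᵥ (unitSeq D t).ofLp) ^ 2 + b * ‖unitSeq D t‖ ^ 2 ≤ c)
    (u : Fin D → ℝ) : a * ∑ i, (h i ⬝ᵥ u) ^ 2 + b * (u ⬝ᵥ u) ≤ c * (u ⬝ᵥ u) := by
  have h1 : ∀ w : EuclideanSpace ℝ (Fin D), ‖w‖ ≤ 1 →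
      a * ∑ i, (h i ⬝ᵥ w.ofLp) ^ 2 + b * ‖w‖ ^ 2 ≤ c := fun w hw =>
    le_of_forall_unitSeq_le (continuous_quadratic h a b) H hw
  set v : EuclideanSpace ℝ (Fin D) := WithLp.toLp 2 u with hv
  have hvu : v.ofLp = u := rfl
  by_cases h0 : v = 0
  · have : u = 0 := by rw [← hvu, h0]; rfl
    simp [this]
  · have hn : 0 < ‖v‖ := norm_pos_iff.2 h0
    have h2 := h1 (‖v‖⁻¹ • v) (by rw [norm_smul]; simp [hn.ne'])
    have h3 : ‖‖v‖⁻¹ • v‖ = 1 := by rw [norm_smul]; simp [hn.ne']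
    rw [h3] at h2
    have h4 : ∀ i, (h i ⬝ᵥ (‖v‖⁻¹ • v).ofLp) ^ 2 = (‖v‖ ^ 2)⁻¹ * (h i ⬝ᵥ u) ^ 2 := by
      intro i
      rw [WithLp.ofLp_smul, hvu, dotProduct_smul, smul_eq_mul, mul_pow, inv_pow]
    simp only [h4, ← Finset.mul_sum] at h2
    rw [← hvu, ← norm_sq_eq_dotProduct]
    simp only [hvu]
    have h5 := mul_le_mul_of_nonneg_right h2 (sq_nonneg ‖v‖)
    field_simp at h5
    linarith

variable {X : Type*} [MeasurableSpace X] {μ : Measure X} [IsProbabilityMeasure μ]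

/-- Lower tail of the empirical second moment of bounded isotropic random vectors. -/
theorem measure_isotropic_lower_le (hD : 0 < D) {n : ℕ} (hn0 : 0 < n) {z : X → Fin D → ℝ}
    (hz : Measurable z) {b : ℝ} (hb : ∀ x, z x ⬝ᵥ z x ≤ b)
    (hiso : ∀ u, ∫ x, (z x ⬝ᵥ u) ^ 2 ∂μ = u ⬝ᵥ u) {δ : ℝ} (hδ : 0 < δ)
    (hn : 1024 * (b * (1 + Real.log D)) ≤ δ ^ 2 * n) :
    Measure.pi (fun _ : Fin n => μ)
      {xs | ¬ ∀ u, (n : ℝ) / 2 * (u ⬝ᵥ u) ≤ ∑ i, (z (xs i) ⬝ᵥ u) ^ 2} ≤ ENNReal.ofReal δ := by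
  set π : Measure (Fin n → X) := Measure.pi fun _ => μ with hπ
  -- For `δ ≥ 1` there is nothing to prove. Below, `δ < 1` is needed to deduce `q ^ 2 ≤ n` from the
  -- sample size condition.
  rcases le_or_gt 1 δ with hδ1 | hδ1
  · exact prob_le_one.trans (by simpa using ENNReal.ofReal_le_ofReal hδ1)
  obtain ⟨x₀⟩ := nonempty_of_isProbabilityMeasure μ
  have hb0 : 0 ≤ b := le_trans (Finset.sum_nonneg fun i _ => mul_self_nonneg _) (hb x₀)
  have hL0 : 0 ≤ Real.log D := Real.log_nonneg (by exact_mod_cast hD)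
  have hnpos : (0 : ℝ) < n := by exact_mod_cast hn0
  set u : ℕ → Fin D → ℝ := fun t => (unitSeq D t).ofLp with hu
  have hu1 : ∀ t, u t ⬝ᵥ u t ≤ 1 := unitSeq_dotProduct_le
  have hF0 : ∀ t x, 0 ≤ (z x ⬝ᵥ u t) ^ 2 := fun t x => sq_nonneg _
  have hFb : ∀ t x, (z x ⬝ᵥ u t) ^ 2 ≤ b := fun t x =>
    (dotProduct_sq_le _ _).trans (by
      have h1 : 0 ≤ u t ⬝ᵥ u t := Finset.sum_nonneg fun i _ => mul_self_nonneg _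
      calc _ ≤ b * 1 := mul_le_mul (hb x) (hu1 t) h1 hb0
        _ = b := mul_one b)
  have hFm : ∀ (σ : ℝ) t, Measurable fun x => σ * (z x ⬝ᵥ u t) ^ 2 := by
    intro σ t
    have : Measurable fun x => z x ⬝ᵥ u t :=
      Finset.measurable_sum _ fun i _ => ((measurable_pi_apply i).comp hz).mul_const _
    exact (this.pow_const 2).const_mul σ
  have hFσ : ∀ (σ : ℝ), |σ| = 1 → ∀ t x, |σ * (z x ⬝ᵥ u t) ^ 2| ≤ b := by
    intro σ hσ t x
    rw [abs_mul, hσ, one_mul, abs_of_nonneg (hF0 t x)]; exact hFb t x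
  -- the largest eigenvalue
  set Λ : (Fin n → X) → ℝ := fun x => ⨆ t, ∑ i, (z (x i) ⬝ᵥ u t) ^ 2 with hΛ
  have hSb : ∀ (x : Fin n → X) t, |∑ i, (z (x i) ⬝ᵥ u t) ^ 2| ≤ n * b := fun x t => by
    simpa using abs_sum_rsign_mul_le (fun _ => 1) fun i => by
      simpa using hFσ 1 (by simp) t (x i)
  have hΛb : ∀ x, |Λ x| ≤ n * b := fun x => abs_iSup_le (hSb x)
  have hΛ0 : ∀ x, 0 ≤ Λ x := fun x =>
    le_trans (Finset.sum_nonneg fun i _ => hF0 0 (x i)) (le_iSup_of_abs_le (hSb x) 0)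
  have hΛm : Measurable Λ := Measurable.iSup fun t => Finset.measurable_sum _ fun i _ => by
    simpa [Function.comp_def] using (hFm 1 t).comp (measurable_pi_apply i)
  have hΛi : Integrable Λ π := integrable_of_abs_le hΛm hΛb
  have hΛu : ∀ x w, ∑ i, (z (x i) ⬝ᵥ w) ^ 2 ≤ Λ x * (w ⬝ᵥ w) := by
    intro x w
    have := quadratic_le_of_unitSeq (fun i => z (x i)) 1 0 (Λ x)
      (fun t => by simpa using le_iSup_of_abs_le (hSb x) t) w
    simpa using this
  -- Rademacher averages
  have hrad : ∀ (σ : ℝ), |σ| = 1 → ∀ x : Fin n → X, (Fintype.card (Fin n → ℤˣ) : ℝ)⁻¹ *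
      ∑ s : Fin n → ℤˣ, ⨆ t, ∑ i, rsign (s i) * (σ * (z (x i) ⬝ᵥ u t) ^ 2) ≤
      4 * √(b * (1 + Real.log D) * Λ x) := by
    intro σ hσ x
    obtain ⟨N, hN0, hN1, hN2⟩ := exists_khintchine_bound_rankOne (ρ := Unit) hD
      (c := fun _ _ => σ) (h := fun i => z (x i)) (K := 1) hb0 (hΛ0 x) (fun _ _ => hσ.le)
      (fun i => hb (x i)) (hΛu x)
    have h1 : ∀ s : Fin n → ℤˣ, ⨆ t, ∑ i, rsign (s i) * (σ * (z (x i) ⬝ᵥ u t) ^ 2) ≤ N s :=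
      fun s => ciSup_le fun t => (le_abs_self _).trans <| (hN1 s () (u t)).trans <| by
        simpa using mul_le_mul_of_nonneg_left (hu1 t) (hN0 s)
    calc _ ≤ (Fintype.card (Fin n → ℤˣ) : ℝ)⁻¹ * ∑ s, N s := by
          gcongr with s _; exact h1 s
      _ ≤ _ := hN2.trans (le_of_eq (by congr 2; simp; ring))
  -- The factor `8` is `2` from symmetrization times `4` from Khintchine.
  set q : ℝ := 8 * √(b * (1 + Real.log D)) with hq
  have hq0 : 0 ≤ q := by positivity
  have hq2 : q ^ 2 = 64 * (b * (1 + Real.log D)) := by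
    rw [hq, mul_pow, Real.sq_sqrt (by positivity)]; norm_num
  have hsqrt : ∀ x, 2 * (4 * √(b * (1 + Real.log D) * Λ x)) = q * √(Λ x) := by
    intro x; rw [Real.sqrt_mul (by positivity), hq]; ring
  obtain ⟨J, hJ⟩ : ∃ J, J = ∫ x, q * √(Λ x) ∂π := ⟨_, rfl⟩
  have hsym : ∀ (σ : ℝ), |σ| = 1 →
      ∫ x : Fin n → X, ⨆ t, (n * ∫ y, σ * (z y ⬝ᵥ u t) ^ 2 ∂μ -
        ∑ i, σ * (z (x i) ⬝ᵥ u t) ^ 2) ∂π ≤ J := by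
    intro σ hσ
    rw [hJ]
    refine (integral_iSup_sub_le (μ := μ) (n := n) (hFm σ) (hFσ σ hσ)).trans ?_
    rw [← integral_const_mul]
    refine integral_mono ?_ ?_ fun x => ?_
    · exact ((integrable_finsetSum _ fun s _ => integrable_iSup_sum_rsign (μ := μ) (hFm σ)
        (hFσ σ hσ) s).const_mul _).const_mul _
    · refine (integrable_of_abs_le (hΛm.sqrt) (b := √(n * b)) fun x => ?_).const_mul _
      rw [abs_of_nonneg (Real.sqrt_nonneg _)]
      exact Real.sqrt_le_sqrt ((le_abs_self _).trans (hΛb x))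
    · exact (mul_le_mul_of_nonneg_left (hrad σ hσ x) (by norm_num)).trans (hsqrt x).le
  have hI : ∀ t, ∫ y, (z y ⬝ᵥ u t) ^ 2 ∂μ = u t ⬝ᵥ u t := fun t => hiso (u t)
  simp only [integral_const_mul, hI] at hsym
  have hint : ∀ {a c : ℝ} , Integrable (fun x => a * Λ x + c) π := fun {a c} =>
    (hΛi.const_mul a).add (integrable_const c)
  have hsqi : Integrable (fun x => q * √(Λ x)) π := by
    refine (integrable_of_abs_le (hΛm.sqrt) (b := √(n * b)) fun x => ?_).const_mul _
    rw [abs_of_nonneg (Real.sqrt_nonneg _)]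
    exact Real.sqrt_le_sqrt ((le_abs_self _).trans (hΛb x))
  have habs1 : ∀ (x : Fin n → X) t, |n * (u t ⬝ᵥ u t) - ∑ i, (z (x i) ⬝ᵥ u t) ^ 2| ≤
      n + n * b := by
    intro x t
    refine (abs_sub _ _).trans (add_le_add ?_ (hSb x t))
    have h1 : 0 ≤ u t ⬝ᵥ u t := Finset.sum_nonneg fun i _ => mul_self_nonneg _
    rw [abs_of_nonneg (by positivity)]
    nlinarith [hu1 t]
  -- the mean of the largest eigenvalue
  have hqn : q ^ 2 ≤ n := by
    have : δ ^ 2 ≤ 1 := pow_le_one₀ hδ.le hδ1.le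
    nlinarith
  have hmean : ∫ x, Λ x ∂π ≤ 3 * n := by
    have h1 := hsym (-1) (by simp)
    have h2 : ∫ x, (1 * Λ x + (-n : ℝ)) ∂π ≤ J := by
      refine le_trans (integral_mono hint ?_ fun x => ?_) h1
      · refine integrable_of_abs_le (Measurable.iSup fun t => ?_) (b := n + n * b) fun x =>
          abs_iSup_le fun t => ?_
        · exact measurable_const.sub (Finset.measurable_sum _ fun i _ =>
            (hFm (-1) t).comp (measurable_pi_apply i))
        · have := habs1 x t
          rw [← Finset.mul_sum, ← abs_neg]
          convert this using 2; ring
      · simp only [one_mul, ← sub_eq_add_neg, sub_le_iff_le_add]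
        refine ciSup_le fun t => ?_
        have h3 := le_iSup_of_abs_le (f := fun t => (n : ℝ) * (-1 * (u t ⬝ᵥ u t)) -
          ∑ i, -1 * (z (x i) ⬝ᵥ u t) ^ 2) (b := n + n * b) (fun t => by
            have := habs1 x t
            rw [← Finset.mul_sum, ← abs_neg]
            convert this using 2; ring) t
        simp only [← Finset.mul_sum] at h3 ⊢
        nlinarith [hu1 t]
    -- Self-bounding: the deviation of `Λ` is controlled by the mean of `q √Λ`, half of which is
    -- absorbed on the left. This gives a mean of at most `2 n + q ^ 2`.
    have h4 : J ≤ ∫ x, (1 / 2 * Λ x + q ^ 2 / 2) ∂π := by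
      rw [hJ]
      refine integral_mono hsqi hint fun x => ?_
      have := Real.sq_sqrt (hΛ0 x)
      simp only
      nlinarith [sq_nonneg (q - √(Λ x))]
    have h5 := h2.trans h4
    rw [integral_add (hΛi.const_mul _) (integrable_const _),
      integral_add (hΛi.const_mul _) (integrable_const _), integral_const_mul,
      integral_const_mul] at h5
    simp at h5
    linarith
  -- the lower deviation
  set A : (Fin n → X) → ℝ := fun x => ⨆ t, (n * (u t ⬝ᵥ u t) - ∑ i, (z (x i) ⬝ᵥ u t) ^ 2) with hA
  have hAu : ∀ x w, -1 * ∑ i, (z (x i) ⬝ᵥ w) ^ 2 + n * (w ⬝ᵥ w) ≤ A x * (w ⬝ᵥ w) := by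
    intro x w
    refine quadratic_le_of_unitSeq (fun i => z (x i)) (-1) n (A x) (fun t => ?_) w
    have := le_iSup_of_abs_le (habs1 x) t
    rw [norm_sq_eq_dotProduct]
    simp only [hA]
    linarith
  have hA0 : ∀ x, 0 ≤ A x := by
    intro x
    have := le_of_forall_unitSeq_le (continuous_quadratic (fun i => z (x i)) (-1) n) (c := A x)
      (fun t => by
        have := le_iSup_of_abs_le (habs1 x) t
        rw [norm_sq_eq_dotProduct]
        simp only [hA]
        linarith) (u := 0) (by simp)
    simpa using this
  have hAi : Integrable A π := by
    refine integrable_of_abs_le (Measurable.iSup fun t => ?_) (b := n + n * b) fun x =>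
      abs_iSup_le (habs1 x)
    refine measurable_const.sub (Finset.measurable_sum _ fun i _ => ?_)
    simpa [Function.comp_def] using (hFm 1 t).comp (measurable_pi_apply i)
  have hAmean : ∫ x, A x ∂π ≤ δ * (n / 2) := by
    have h1 := hsym 1 (by simp)
    simp only [one_mul] at h1
    have hsn := Real.sq_sqrt hnpos.le
    have hsn0 : 0 < √(n : ℝ) := Real.sqrt_pos.2 hnpos
    -- The arithmetic–geometric inequality is now balanced at `Λ ≈ n`, using the bound on the mean
    -- of `Λ`. The result is `J ≤ 2 q √n`.
    have h2 : J ≤ ∫ x, (q / (2 * √n) * Λ x + q * √n / 2) ∂π := by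
      rw [hJ]
      refine integral_mono hsqi hint fun x => ?_
      have h3 := Real.sq_sqrt (hΛ0 x)
      have h4 : √(Λ x) ≤ (Λ x / √n + √n) / 2 := by
        rw [le_div_iff₀ (by norm_num), div_add' _ _ _ hsn0.ne', le_div_iff₀ hsn0]
        nlinarith [sq_nonneg (√n - √(Λ x))]
      calc q * √(Λ x) ≤ q * ((Λ x / √n + √n) / 2) := mul_le_mul_of_nonneg_left h4 hq0
        _ = _ := by field_simp
    rw [integral_add (hΛi.const_mul _) (integrable_const _), integral_const_mul] at h2
    simp only [integral_const, probReal_univ, one_smul] at h2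
    have h5 : q / (2 * √n) * ∫ x, Λ x ∂π ≤ q / (2 * √n) * (3 * n) :=
      mul_le_mul_of_nonneg_left hmean (by positivity)
    have h6 : q / (2 * √n) * (3 * n) = 3 * (q * √n) / 2 := by
      field_simp; rw [hsn]
    -- Squared, this is the sample size condition, since `1024 = 16 * 64`.
    have h7 : 4 * q ≤ δ * √n := by
      refine le_of_pow_le_pow_left₀ two_ne_zero (by positivity) ?_
      rw [mul_pow 4 q, mul_pow δ, hq2, hsn]; linarith
    have h8 : 4 * q * √n ≤ δ * √n * √n := mul_le_mul_of_nonneg_right h7 hsn0.le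
    calc _ ≤ 2 * (q * √n) := by linarith
      _ ≤ _ := by nlinarith
  have hmarkov := mul_meas_ge_le_integral_of_nonneg (μ := π) (Filter.Eventually.of_forall hA0)
    hAi (n / 2)
  have hsub : {xs | ¬ ∀ u, (n : ℝ) / 2 * (u ⬝ᵥ u) ≤ ∑ i, (z (xs i) ⬝ᵥ u) ^ 2} ⊆
      {x | (n : ℝ) / 2 ≤ A x} := by
    intro x hx
    simp only [Set.mem_ofPred_eq, not_forall, not_le] at hx ⊢
    obtain ⟨w, hw⟩ := hx
    have h1 := hAu x w
    have h2 : 0 ≤ w ⬝ᵥ w := Finset.sum_nonneg fun i _ => mul_self_nonneg _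
    by_contra h3
    push Not at h3
    nlinarith
  refine (measure_mono hsub).trans ?_
  rw [← ofReal_measureReal]
  refine ENNReal.ofReal_le_ofReal ?_
  have h1 := hmarkov.trans hAmean
  have h2 : (0 : ℝ) < n / 2 := by positivity
  nlinarith

lemma dotProduct_cov_mulVec {d : ℕ} {μ : Measure (Input d)} [IsFiniteMeasure μ]
    {g : Input d → EuclideanSpace ℝ (Fin D)} (hg : Measurable g) {b : ℝ}
    (hb : ∀ x, ‖g x‖ ≤ b) (u : Fin D → ℝ) :
    u ⬝ᵥ cov g μ *ᵥ u = ∫ x, ((g x).ofLp ⬝ᵥ u) ^ 2 ∂μ := by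
  have hcoord : ∀ i, Measurable fun x => g x i := fun i =>
    (measurable_pi_apply i).comp ((WithLp.measurable_ofLp 2 _).comp hg)
  have hgi : ∀ x i, |g x i| ≤ b := fun x i => (PiLp.norm_apply_le (g x) i).trans (hb x)
  have hint : ∀ i j, Integrable (fun x => g x i * g x j) μ := fun i j =>
    integrable_of_abs_le ((hcoord i).mul (hcoord j)) (b := b * b) fun x => by
      rw [abs_mul]
      exact mul_le_mul (hgi x i) (hgi x j) (abs_nonneg _) ((abs_nonneg _).trans (hgi x i))
  have h1 : ∀ x, ((g x).ofLp ⬝ᵥ u) ^ 2 = ∑ i, ∑ j, u i * u j * (g x i * g x j) := by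
    intro x
    rw [sq, dotProduct, Finset.sum_mul_sum]
    exact Finset.sum_congr rfl fun i _ => Finset.sum_congr rfl fun j _ => by ring
  simp only [h1]
  rw [integral_finsetSum _ fun i _ => integrable_finsetSum _ fun j _ => (hint i j).const_mul _,
    dotProduct]
  refine Finset.sum_congr rfl fun i _ => ?_
  rw [integral_finsetSum _ fun j _ => (hint i j).const_mul _, mulVec, dotProduct, Finset.mul_sum]
  refine Finset.sum_congr rfl fun j _ => ?_
  rw [integral_const_mul, cov, of_apply]
  ring

/-- With high probability the empirical covariance inherits half of the lower bound on the
population covariance. -/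
theorem withProbAtLeast_empCov_lower {d : ℕ} {μ : Measure (Input d)} [IsProbabilityMeasure μ]
    (hD : 0 < D) {g : Input d → EuclideanSpace ℝ (Fin D)} (hg : Measurable g)
    (hgD : ∀ x, ‖g x‖ ^ 2 ≤ D) {κ : ℝ} (hκ : 0 < κ) (hcov : (cov g μ - κ • 1).PosSemidef)
    {δ : ℝ} (hδ : 0 < δ) {n : ℕ}
    (hn : 1024 * κ⁻¹ * (δ ^ 2)⁻¹ * D * (1 + Real.log D) ≤ n) :
    WithProbAtLeast (Measure.pi fun _ : Fin n => μ) δ fun xs =>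
      ∀ u : Fin D → ℝ, κ / 2 * (u ⬝ᵥ u) ≤ u ⬝ᵥ empCov g xs *ᵥ u := by
  have hDR : (0 : ℝ) < D := by exact_mod_cast hD
  have hL0 : 0 ≤ Real.log D := Real.log_nonneg (by exact_mod_cast hD)
  have hn0 : 0 < n := by
    have : (0 : ℝ) < n := lt_of_lt_of_le (by positivity) hn
    exact_mod_cast this
  have hgb : ∀ x, ‖g x‖ ≤ √(D : ℝ) := fun x => Real.le_sqrt_of_sq_le (hgD x)
  have hquad := dotProduct_cov_mulVec (μ := μ) hg hgb
  have hlow : ∀ u : Fin D → ℝ, κ * (u ⬝ᵥ u) ≤ u ⬝ᵥ cov g μ *ᵥ u := by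
    intro u
    have := hcov.dotProduct_mulVec_nonneg u
    rw [star_trivial, sub_mulVec, dotProduct_sub, dotProduct_smul_mulVec, one_mulVec] at this
    linarith
  have hpsd : (cov g μ).PosSemidef := by
    refine posSemidef_of_quadForm_nonneg ?_ fun u => ?_
    · ext i j; simp [cov, mul_comm]
    · rw [hquad]; exact integral_nonneg fun x => sq_nonneg _
  set A := cov g μ with hA
  -- Whitening by the population covariance makes the deviation relative: the empirical form is at
  -- least half of the population form, which is at least `κ`.
  set z : Input d → Fin D → ℝ := fun x => (psdSqrt A)⁻¹ *ᵥ (g x).ofLp with hz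
  have hzm : Measurable z := by
    refine measurable_pi_lambda _ fun i => ?_
    change Measurable fun x => ∑ j, (psdSqrt A)⁻¹ i j * (g x).ofLp j
    refine Finset.measurable_sum _ fun j _ => ?_
    exact (((measurable_pi_apply j).comp ((WithLp.measurable_ofLp 2 _).comp hg))).const_mul _
  have hzdot : ∀ x w, (psdSqrt A *ᵥ w) ⬝ᵥ z x = w ⬝ᵥ (g x).ofLp := fun x w =>
    dotProduct_eq_psdSqrt_dotProduct hpsd hκ hlow _ w
  have hzb : ∀ x, z x ⬝ᵥ z x ≤ D / κ := fun x => by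
    rw [le_div_iff₀ hκ, mul_comm]
    refine (inv_psdSqrt_mulVec_dotProduct_le hpsd hκ hlow _).trans ?_
    rw [← norm_sq_eq_dotProduct]; exact hgD x
  have hiso : ∀ u, ∫ x, (z x ⬝ᵥ u) ^ 2 ∂μ = u ⬝ᵥ u := by
    intro u
    have h1 := psdSqrt_mulVec_inv_mulVec hpsd hκ hlow u
    have h2 : ∀ x, z x ⬝ᵥ u = (g x).ofLp ⬝ᵥ ((psdSqrt A)⁻¹ *ᵥ u) := by
      intro x
      rw [dotProduct_comm (g x).ofLp, ← hzdot, h1, dotProduct_comm]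
    simp only [h2]
    rw [← hquad, ← psdSqrt_mulVec_dotProduct hpsd, h1]
  have hmain := measure_isotropic_lower_le hD hn0 hzm hzb hiso hδ (by
    have h1 := mul_le_mul_of_nonneg_left hn (sq_nonneg δ)
    have h2 : δ ^ 2 * (1024 * κ⁻¹ * (δ ^ 2)⁻¹ * D * (1 + Real.log D)) =
        1024 * (D / κ * (1 + Real.log D)) := by field_simp
    rwa [h2] at h1)
  refine (measure_mono ?_).trans hmain
  intro xs hxs
  rw [Set.mem_ofPred_eq] at hxs ⊢
  refine fun h => hxs fun u => ?_
  have h1 := h (psdSqrt A *ᵥ u)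
  rw [psdSqrt_mulVec_dotProduct hpsd] at h1
  have h2 : ∀ i, (z (xs i) ⬝ᵥ psdSqrt A *ᵥ u) ^ 2 = ((g (xs i)).ofLp ⬝ᵥ u) ^ 2 := by
    intro i
    rw [dotProduct_comm, hzdot, dotProduct_comm]
  simp only [h2] at h1
  rw [dotProduct_empCov_mulVec, one_div, inv_mul_eq_div, le_div_iff₀ (by exact_mod_cast hn0)]
  have h3 := mul_le_mul_of_nonneg_left (hlow u) (by positivity : (0 : ℝ) ≤ n / 2)
  linarith

lemma measurable_feature {d : ℕ} (V : Fin D → EuclideanSpace ℝ (Fin d)) (b : Fin D → ℝ) :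
    Measurable (feature V b) := by
  refine (WithLp.measurable_toLp 2 _).comp (measurable_pi_lambda _ fun j => ?_)
  refine (measurable_const.indicator measurableSet_Ici).comp ?_
  exact (Continuous.measurable (by fun_prop))

lemma norm_feature_sq_le {d : ℕ} (V : Fin D → EuclideanSpace ℝ (Fin d)) (b : Fin D → ℝ)
    (x : Input d) : ‖feature V b x‖ ^ 2 ≤ D := by
  rw [EuclideanSpace.norm_sq_eq]
  calc _ ≤ ∑ _j : Fin D, (1 : ℝ) := by
        refine Finset.sum_le_sum fun j _ => ?_
        simp only [feature, Set.indicator]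
        split_ifs <;> simp
    _ = D := by simp

end Concentration

end QuadNTK

namespace QuadNTK

/-! ### Optimization landscape -/

section Loss

variable {Y : Type*} [MeasurableSpace Y] {K : ℝ} {loss : ℝ → Y → ℝ}

lemma IsLoss.lipschitz (h : IsLoss K loss) (y : Y) (a b : ℝ) :
    |loss a y - loss b y| ≤ |a - b| := by
  have := Convex.norm_image_sub_le_of_norm_deriv_le (f := fun z => loss z y) (C := 1)
    (s := Set.univ) (x := b) (y := a) (fun x _ => (h.differentiable y) x)
    (fun x _ => h.abs_deriv_le y x) convex_univ trivial trivial
  simpa using this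

lemma IsLoss.tangent_le (h : IsLoss K loss) (y : Y) (a b : ℝ) :
    loss a y + deriv (fun z => loss z y) a * (b - a) ≤ loss b y := by
  have hd := ((h.differentiable y) a).hasDerivAt
  rcases lt_trichotomy a b with hab | hab | hab
  · have h1 := (h.convex y).le_slope_of_hasDerivAt (Set.mem_univ a) (Set.mem_univ b) hab hd
    rw [slope_def_field, le_div_iff₀ (by linarith)] at h1
    linarith
  · subst hab; simp
  · have h1 := (h.convex y).slope_le_of_hasDerivAt (Set.mem_univ b) (Set.mem_univ a) hab hd
    rw [slope_def_field, div_le_iff₀ (by linarith)] at h1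
    linarith

end Loss

/-! ### First and second derivatives along lines -/

section LineDerivatives

variable {E : Type*} [NormedAddCommGroup E] [NormedSpace ℝ E]

lemma hasDerivAt_comp_line {F : E → ℝ} (hF : Differentiable ℝ F) (W U : E) (t : ℝ) :
    HasDerivAt (fun t : ℝ => F (W + t • U)) (fderiv ℝ F (W + t • U) U) t := by
  have h1 : HasDerivAt (fun t : ℝ => W + t • U) U t := by
    simpa using ((hasDerivAt_id t).smul_const U).const_add W
  exact (hF _).hasFDerivAt.comp_hasDerivAt t h1

lemma hasDerivAt_fderiv_comp_line {F : E → ℝ} {W : E} (hF : DifferentiableAt ℝ (fderiv ℝ F) W)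
    (U : E) :
    HasDerivAt (fun t : ℝ => fderiv ℝ F (W + t • U) U) (fderiv ℝ (fderiv ℝ F) W U U) 0 := by
  have h1 : HasDerivAt (fun t : ℝ => W + t • U) U 0 := by
    simpa using ((hasDerivAt_id (0 : ℝ)).smul_const U).const_add W
  have h2 : HasFDerivAt (fderiv ℝ F) (fderiv ℝ (fderiv ℝ F) W) (W + (0 : ℝ) • U) := by
    simpa using hF.hasFDerivAt
  have h3 := h2.comp_hasDerivAt (0 : ℝ) h1
  exact ((ContinuousLinearMap.apply ℝ ℝ U).hasFDerivAt.comp_hasDerivAt (0 : ℝ) h3)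

/-- First and second order conditions along a line, for a function that is explicitly known on
the line. -/
lemma line_conditions {F : E → ℝ} (hF : Differentiable ℝ F) {W U : E}
    (hF2 : DifferentiableAt ℝ (fderiv ℝ F) W) {p p' : ℝ → ℝ} {p'' : ℝ}
    (hp : ∀ t : ℝ, F (W + t • U) = p t) (hp' : ∀ t, HasDerivAt p (p' t) t)
    (hp'' : HasDerivAt p' p'' 0) :
    fderiv ℝ F W U = p' 0 ∧ fderiv ℝ (fderiv ℝ F) W U U = p'' := by
  have h1 : ∀ t, fderiv ℝ F (W + t • U) U = p' t := by
    intro t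
    have := hasDerivAt_comp_line hF W U t
    simp only [hp] at this
    exact this.unique (hp' t)
  refine ⟨by simpa using h1 0, ?_⟩
  have h2 := hasDerivAt_fderiv_comp_line hF2 U
  simp only [h1] at h2
  exact h2.unique hp''

end LineDerivatives

section Landscape

variable {d D m n : ℕ} {Y : Type*}

lemma rowMul_add_smul (W U : Weights m D) (A : Matrix (Fin D) (Fin D) ℝ) (t : ℝ) (r : Fin m) :
    rowMul (W + t • U) A r = rowMul W A r + t • rowMul U A r := by
  ext j
  simp [rowMul, Matrix.add_vecMul, Matrix.smul_vecMul]

/-- The polarized model: the derivative of `t ↦ f_{W + t U}(x)` at `0`. -/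
noncomputable def modelCross (phi2 : ℝ → ℝ) (g : Input d → EuclideanSpace ℝ (Fin D)) (a : Fin m → ℝ)
    (W0 W U : Weights m D) (x : Input d) : ℝ :=
  1 / Real.sqrt m *
    ∑ r, a r * phi2 (inner ℝ (W0 r) (g x)) * (inner ℝ (W r) (g x)) * (inner ℝ (U r) (g x))

variable (phi2 : ℝ → ℝ) (g : Input d → EuclideanSpace ℝ (Fin D)) (a : Fin m → ℝ)
  (W0 : Weights m D)

lemma model_add_smul (W U : Weights m D) (x : Input d) (t : ℝ) :
    model phi2 g a W0 (W + t • U) x = model phi2 g a W0 W x +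
      t * modelCross phi2 g a W0 W U x + t ^ 2 * model phi2 g a W0 U x := by
  have h : (1 : ℝ) / Real.sqrt m = 1 / (2 * Real.sqrt m) * 2 := by
    rw [one_div, one_div, mul_inv]; ring
  simp only [model, modelCross, h, Finset.mul_sum, ← Finset.sum_add_distrib]
  refine Finset.sum_congr rfl fun r _ => ?_
  simp only [Pi.add_apply, Pi.smul_apply, inner_add_left, real_inner_smul_left]
  ring

lemma modelCross_self (W : Weights m D) (x : Input d) :
    modelCross phi2 g a W0 W W x = 2 * model phi2 g a W0 W x := by
  have h : (1 : ℝ) / Real.sqrt m = 1 / (2 * Real.sqrt m) * 2 := by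
    rw [one_div, one_div, mul_inv]; ring
  simp only [model, modelCross, h, Finset.mul_sum]
  exact Finset.sum_congr rfl fun r _ => by ring

/-- Each row enters only through a square. Among the terms of the expansion along a line, only the
cross term therefore sees the signs of the direction. -/
lemma model_rsign_smul (U : Weights m D) (s : Fin m → ℤˣ) (x : Input d) :
    model phi2 g a W0 (fun r => rsign (s r) • U r) x = model phi2 g a W0 U x := by
  simp only [model, real_inner_smul_left, mul_pow]
  congr 1
  refine Finset.sum_congr rfl fun r _ => ?_
  rw [show rsign (s r) ^ 2 = 1 by rw [sq, rsign_mul_self], one_mul]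

lemma norm_rowMul_rsign_smul (U : Weights m D) (A : Matrix (Fin D) (Fin D) ℝ) (s : Fin m → ℤˣ)
    (r : Fin m) : ‖rowMul (fun r => rsign (s r) • U r) A r‖ = ‖rowMul U A r‖ := by
  have : rowMul (fun r => rsign (s r) • U r) A r = rsign (s r) • rowMul U A r := by
    ext j; simp [rowMul, Matrix.smul_vecMul]
  rw [this, norm_smul, Real.norm_eq_abs, abs_rsign, one_mul]

lemma contDiff_model (x : Input d) : ContDiff ℝ 2 fun W => model phi2 g a W0 W x := by
  unfold model
  have : ∀ r : Fin m, ContDiff ℝ 2 fun W : Weights m D => inner ℝ (W r) (g x) := fun r =>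
    (contDiff_apply ℝ (EuclideanSpace ℝ (Fin D)) r).inner ℝ contDiff_const
  fun_prop

lemma contDiff_rowMul (A : Matrix (Fin D) (Fin D) ℝ) (r : Fin m) :
    ContDiff ℝ 2 fun W : Weights m D => rowMul W A r := by
  let L : Weights m D →ₗ[ℝ] EuclideanSpace ℝ (Fin D) :=
    { toFun := fun W => rowMul W A r
      map_add' := fun W U => by simpa using rowMul_add_smul W U A 1 r
      map_smul' := fun t U => by
        have h0 : rowMul (0 : Weights m D) A r = 0 := by ext j; simp [rowMul]
        simpa [h0] using rowMul_add_smul 0 U A t r }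
  exact (LinearMap.toContinuousLinearMap L).contDiff

lemma contDiff_norm24_rowMul_pow (A : Matrix (Fin D) (Fin D) ℝ) :
    ContDiff ℝ 2 fun W : Weights m D => norm24 (rowMul W A) ^ 4 := by
  simp only [norm24_pow_four]
  refine ContDiff.sum fun r _ => ?_
  have : (fun W : Weights m D => ‖rowMul W A r‖ ^ 4) = fun W => (‖rowMul W A r‖ ^ 2) ^ 2 := by
    funext W; ring
  rw [this]
  exact ((contDiff_rowMul A r).norm_sq ℝ).pow 2

variable [MeasurableSpace Y] {K : ℝ} {loss : ℝ → Y → ℝ} (S : Fin n → Input d × Y)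
  (A : Matrix (Fin D) (Fin D) ℝ) (lam : ℝ)

lemma hasFDerivAt_regRisk (hl : IsLoss K loss) (W : Weights m D) :
    HasFDerivAt (regRisk S loss phi2 g a W0 A lam)
      ((1 / (n : ℝ)) • (∑ i, deriv (fun z => loss z (S i).2) (model phi2 g a W0 W (S i).1) •
        fderiv ℝ (fun W => model phi2 g a W0 W (S i).1) W) +
        lam • fderiv ℝ (fun W => norm24 (rowMul W (psdSqrt A)) ^ 4) W) W := by
  unfold regRisk empRisk
  refine HasFDerivAt.add (HasFDerivAt.const_mul (HasFDerivAt.fun_sum fun i _ => ?_) _)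
    (HasFDerivAt.const_mul ?_ _)
  · exact ((hl.differentiable (S i).2) _).hasDerivAt.comp_hasFDerivAt W
      (((contDiff_model phi2 g a W0 (S i).1).differentiable (by norm_num)) W).hasFDerivAt
  · exact (((contDiff_norm24_rowMul_pow (psdSqrt A)).differentiable (by norm_num)) W).hasFDerivAt

lemma differentiable_fderiv_of_contDiff_two {E : Type*} [NormedAddCommGroup E] [NormedSpace ℝ E]
    {f : E → ℝ} (hf : ContDiff ℝ 2 f) : Differentiable ℝ (fderiv ℝ f) :=
  (hf.fderiv_right (m := 1) (by norm_num)).differentiable (by norm_num)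

/-- The loss is twice differentiable but its second derivative need not be continuous, so `ContDiff
ℝ 2` is not available for the risk. Differentiability of the gradient is read off from its explicit
formula. -/
lemma differentiable_fderiv_regRisk (hl : IsLoss K loss) :
    Differentiable ℝ (fderiv ℝ (regRisk S loss phi2 g a W0 A lam)) := by
  have h1 : fderiv ℝ (regRisk S loss phi2 g a W0 A lam) = fun W =>
      ((1 / (n : ℝ)) • (∑ i, deriv (fun z => loss z (S i).2) (model phi2 g a W0 W (S i).1) •
        fderiv ℝ (fun W => model phi2 g a W0 W (S i).1) W) +
        lam • fderiv ℝ (fun W => norm24 (rowMul W (psdSqrt A)) ^ 4) W) :=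
    funext fun W => (hasFDerivAt_regRisk phi2 g a W0 S A lam hl W).fderiv
  rw [h1]
  refine Differentiable.fun_add (Differentiable.fun_const_smul (Differentiable.fun_sum fun i _ =>
    Differentiable.fun_smul ?_ ?_) _) (Differentiable.fun_const_smul ?_ _)
  · exact (hl.differentiable_deriv (S i).2).comp
      ((contDiff_model phi2 g a W0 (S i).1).differentiable (by norm_num))
  · exact differentiable_fderiv_of_contDiff_two (contDiff_model phi2 g a W0 (S i).1)
  · exact differentiable_fderiv_of_contDiff_two (contDiff_norm24_rowMul_pow (psdSqrt A))

/-- The derivatives of the regularized risk along a line. -/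
lemma regRisk_line_derivatives (hl : IsLoss K loss) (W U : Weights m D) :
    fderiv ℝ (regRisk S loss phi2 g a W0 A lam) W U =
      1 / (n : ℝ) * ∑ i, deriv (fun z => loss z (S i).2) (model phi2 g a W0 W (S i).1) *
        modelCross phi2 g a W0 W U (S i).1 +
      lam * ∑ r, 4 * ‖rowMul W (psdSqrt A) r‖ ^ 2 *
        inner ℝ (rowMul W (psdSqrt A) r) (rowMul U (psdSqrt A) r) ∧
    fderiv ℝ (fderiv ℝ (regRisk S loss phi2 g a W0 A lam)) W U U =
      1 / (n : ℝ) * ∑ i, (deriv (deriv (fun z => loss z (S i).2)) (model phi2 g a W0 W (S i).1) *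
        modelCross phi2 g a W0 W U (S i).1 ^ 2 +
        2 * (deriv (fun z => loss z (S i).2) (model phi2 g a W0 W (S i).1) *
          model phi2 g a W0 U (S i).1)) +
      lam * ∑ r, (8 * inner ℝ (rowMul W (psdSqrt A) r) (rowMul U (psdSqrt A) r) ^ 2 +
        4 * ‖rowMul W (psdSqrt A) r‖ ^ 2 * ‖rowMul U (psdSqrt A) r‖ ^ 2) := by
  set f := fun i => model phi2 g a W0 W (S i).1 with hf
  set c := fun i => modelCross phi2 g a W0 W U (S i).1 with hc
  set e := fun i => model phi2 g a W0 U (S i).1 with he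
  set x := fun r => rowMul W (psdSqrt A) r with hx
  set y := fun r => rowMul U (psdSqrt A) r with hy
  have hq : ∀ (α β γ t : ℝ), HasDerivAt (fun t : ℝ => α + t * β + t ^ 2 * γ) (β + 2 * t * γ) t := by
    intro α β γ t
    have h1 := (((hasDerivAt_id t).mul_const β).const_add α).add
      (((hasDerivAt_id t).pow 2).mul_const γ)
    refine HasDerivAt.congr_deriv h1 ?_
    simp
  have hq' : ∀ (β γ t : ℝ), HasDerivAt (fun t : ℝ => β + 2 * t * γ) (2 * γ) t := by
    intro β γ t
    have h1 := (((hasDerivAt_id t).const_mul 2).mul_const γ).const_add β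
    refine HasDerivAt.congr_deriv h1 ?_
    simp
  -- On a line the model values and the squared row norms are exact quadratic polynomials in `t`, so
  -- one-variable calculus gives both derivatives.
  have key := line_conditions (F := regRisk S loss phi2 g a W0 A lam) (W := W) (U := U)
    (fun W => (hasFDerivAt_regRisk phi2 g a W0 S A lam hl W).differentiableAt)
    (differentiable_fderiv_regRisk phi2 g a W0 S A lam hl W)
    (p := fun t => 1 / (n : ℝ) * ∑ i, loss (f i + t * c i + t ^ 2 * e i) (S i).2 +
      lam * ∑ r, (‖x r‖ ^ 2 + t * (2 * inner ℝ (x r) (y r)) + t ^ 2 * ‖y r‖ ^ 2) ^ 2)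
    (p' := fun t => 1 / (n : ℝ) * ∑ i, deriv (fun z => loss z (S i).2)
        (f i + t * c i + t ^ 2 * e i) * (c i + 2 * t * e i) +
      lam * ∑ r, (2 * (‖x r‖ ^ 2 + t * (2 * inner ℝ (x r) (y r)) + t ^ 2 * ‖y r‖ ^ 2) *
        (2 * inner ℝ (x r) (y r) + 2 * t * ‖y r‖ ^ 2)))
    (p'' := 1 / (n : ℝ) * ∑ i, (deriv (deriv (fun z => loss z (S i).2))
        (f i) * (c i) * (c i) + deriv (fun z => loss z (S i).2) (f i) * (2 * e i)) +
      lam * ∑ r, (2 * (2 * inner ℝ (x r) (y r)) * (2 * inner ℝ (x r) (y r)) +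
        2 * ‖x r‖ ^ 2 * (2 * ‖y r‖ ^ 2))) ?_ ?_ ?_
  · rw [key.1, key.2]
    constructor
    · simp only [zero_mul, add_zero, ne_eq, OfNat.ofNat_ne_zero, not_false_eq_true, zero_pow,
        mul_zero]
      congr 2
      exact Finset.sum_congr rfl fun r _ => by ring
    · congr 2
      · exact Finset.sum_congr rfl fun i _ => by ring
      · exact Finset.sum_congr rfl fun r _ => by ring
  · intro t
    simp only [regRisk, empRisk, norm24_pow_four, model_add_smul, rowMul_add_smul]
    congr 2
    refine Finset.sum_congr rfl fun r _ => ?_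
    rw [show (4 : ℕ) = 2 * 2 by norm_num, pow_mul, norm_add_sq_real, real_inner_smul_right,
      norm_smul, mul_pow, Real.norm_eq_abs, sq_abs]
    ring
  · intro t
    refine HasDerivAt.add (HasDerivAt.const_mul _ (HasDerivAt.fun_sum fun i _ => ?_))
      (HasDerivAt.const_mul _ (HasDerivAt.fun_sum fun r _ => ?_))
    · exact ((hl.differentiable (S i).2) _).hasDerivAt.comp t (hq _ _ _ t)
    · have := (hq (‖x r‖ ^ 2) (2 * inner ℝ (x r) (y r)) (‖y r‖ ^ 2) t).pow 2
      refine HasDerivAt.congr_deriv this ?_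
      simp
  · refine HasDerivAt.add (HasDerivAt.const_mul _ (HasDerivAt.fun_sum fun i _ => ?_))
      (HasDerivAt.const_mul _ (HasDerivAt.fun_sum fun r _ => ?_))
    · have h1 := ((hl.differentiable_deriv (S i).2) (f i + 0 * c i + 0 ^ 2 * e i)).hasDerivAt.comp
        (0 : ℝ) (hq (f i) (c i) (e i) 0)
      have h2 := h1.mul (hq' (c i) (e i) 0)
      refine HasDerivAt.congr_deriv h2 ?_
      simp
    · have h1 := ((hq (‖x r‖ ^ 2) (2 * inner ℝ (x r) (y r)) (‖y r‖ ^ 2) 0).const_mul 2).mul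
        (hq' (2 * inner ℝ (x r) (y r)) (‖y r‖ ^ 2) 0)
      refine HasDerivAt.congr_deriv h1 ?_
      simp

end Landscape

end QuadNTK

namespace QuadNTK

/-! ### Averages over row signs and second-order stationary points -/

section SignAverages

variable {ι : Type*} [Fintype ι] [DecidableEq ι]

/-- Distinct signs are orthogonal, so only the diagonal of the expanded square survives. -/
lemma sum_signs_sq (k : ι → ℝ) :
    ∑ s : ι → ℤˣ, (∑ r, rsign (s r) * k r) ^ 2 = Fintype.card (ι → ℤˣ) * ∑ r, k r ^ 2 := by
  have h1 : ∀ s : ι → ℤˣ, (∑ r, rsign (s r) * k r) ^ 2 =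
      ∑ r, ∑ r', rsign (s r) * rsign (s r') * (k r * k r') := by
    intro s
    rw [sq, Finset.sum_mul_sum]
    exact Finset.sum_congr rfl fun r _ => Finset.sum_congr rfl fun r' _ => by ring
  simp only [h1]
  rw [Finset.sum_comm, Finset.mul_sum]
  refine Finset.sum_congr rfl fun r _ => ?_
  rw [Finset.sum_comm, Finset.sum_eq_single r]
  · simp only [rsign_mul_self, one_mul, Finset.sum_const, Finset.card_univ, nsmul_eq_mul, sq]
  · intro r' _ hr
    rw [← Finset.sum_mul, sum_signs_mul_of_ne hr.symm, zero_mul]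
  · simp

end SignAverages

section Landscape

variable {d D m n : ℕ} {Y : Type*} [MeasurableSpace Y] {K : ℝ} {loss : ℝ → Y → ℝ}
  {phi2 : ℝ → ℝ} {g : Input d → EuclideanSpace ℝ (Fin D)} {a : Fin m → ℝ} {W0 : Weights m D}
  {S : Fin n → Input d × Y} {A : Matrix (Fin D) (Fin D) ℝ}

lemma modelCross_rsign_smul (W U : Weights m D) (s : Fin m → ℤˣ) (x : Input d) :
    modelCross phi2 g a W0 W (fun r => rsign (s r) • U r) x =
      ∑ r, rsign (s r) * (1 / Real.sqrt m * (a r * phi2 (inner ℝ (W0 r) (g x)) *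
        (inner ℝ (W r) (g x)) * (inner ℝ (U r) (g x)))) := by
  rw [modelCross, Finset.mul_sum]
  refine Finset.sum_congr rfl fun r _ => ?_
  rw [real_inner_smul_left]; ring

/-- The average over sign flips of the squared cross term. -/
lemma sum_signs_modelCross_sq_le (hphi : ∀ t, |phi2 t| ≤ K)
    (ha : ∀ r, a r = 1 ∨ a r = -1) (hg : ∀ x, ‖g x‖ ^ 2 ≤ D) (hA : A.PosSemidef) {c : ℝ}
    (hc : 0 < c) (h : ∀ u : Fin D → ℝ, c * (u ⬝ᵥ u) ≤ u ⬝ᵥ A.mulVec u)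
    (W U : Weights m D) (x : Input d) :
    ∑ s : Fin m → ℤˣ, modelCross phi2 g a W0 W (fun r => rsign (s r) • U r) x ^ 2 ≤
      Fintype.card (Fin m → ℤˣ) * (K ^ 2 * D ^ 2 / (m * c ^ 2) *
        ∑ r, ‖rowMul W (psdSqrt A) r‖ ^ 2 * ‖rowMul U (psdSqrt A) r‖ ^ 2) := by
  simp only [modelCross_rsign_smul]
  rw [sum_signs_sq]
  refine mul_le_mul_of_nonneg_left ?_ (Nat.cast_nonneg _)
  rw [Finset.mul_sum]
  refine Finset.sum_le_sum fun r _ => ?_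
  -- Cauchy–Schwarz uses up one factor `D` per inner product, and the lower bound on `A` exchanges
  -- Euclidean for whitened row norms. Two such factors and the squared normalization give `D² / (m
  -- c²)`.
  have h1 : ∀ V : Weights m D, inner ℝ (V r) (g x) ^ 2 ≤
      ‖rowMul V (psdSqrt A) r‖ ^ 2 / c * D := by
    intro V
    have h2 : |inner ℝ (V r) (g x)| ^ 2 ≤ (‖V r‖ * ‖g x‖) ^ 2 :=
      pow_le_pow_left₀ (abs_nonneg _) (abs_real_inner_le_norm _ _) 2
    rw [sq_abs, mul_pow] at h2
    refine h2.trans (mul_le_mul ?_ (hg x) (sq_nonneg _) (by positivity))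
    rw [le_div_iff₀ hc, mul_comm]
    exact norm_sq_le_rowMul_psdSqrt hA h V r
  have ha2 : a r ^ 2 = 1 := by rcases ha r with h | h <;> simp [h]
  have hp2 : phi2 (inner ℝ (W0 r) (g x)) ^ 2 ≤ K ^ 2 := by
    rw [← sq_abs]; exact pow_le_pow_left₀ (abs_nonneg _) (hphi _) 2
  calc _ = 1 / m * (phi2 (inner ℝ (W0 r) (g x)) ^ 2 * (inner ℝ (W r) (g x) ^ 2 *
        inner ℝ (U r) (g x) ^ 2)) := by
        rw [mul_pow, div_pow, Real.sq_sqrt (Nat.cast_nonneg m), mul_pow, mul_pow, mul_pow, ha2]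
        ring
    _ ≤ 1 / m * (K ^ 2 * ((‖rowMul W (psdSqrt A) r‖ ^ 2 / c * D) *
        (‖rowMul U (psdSqrt A) r‖ ^ 2 / c * D))) := by
        gcongr
        · exact h1 W
        · exact h1 U
    _ = _ := by field_simp

lemma sum_norm_sq_mul_le (W U : Weights m D) :
    ∑ r, ‖W r‖ ^ 2 * ‖U r‖ ^ 2 ≤ norm24 W ^ 2 * norm24 U ^ 2 := by
  refine le_of_pow_le_pow_left₀ two_ne_zero (by positivity) ?_
  have := Finset.sum_mul_sq_le_sq_mul_sq Finset.univ (fun r => ‖W r‖ ^ 2) (fun r => ‖U r‖ ^ 2)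
  refine this.trans (le_of_eq ?_)
  rw [mul_pow, ← pow_mul, ← pow_mul, norm24_pow_four, norm24_pow_four]
  simp only [← pow_mul]

/-- At a second-order stationary point the risk is comparable to that of any other weights. -/
theorem empRisk_add_le_of_isSOSP (hl : IsLoss K loss) (hK : 0 < K) (hphi : ∀ t, |phi2 t| ≤ K)
    (hn : 0 < n) (ha : ∀ r, a r = 1 ∨ a r = -1) (hg : ∀ x, ‖g x‖ ^ 2 ≤ D)
    (hA : A.PosSemidef) {c : ℝ} (hc : 0 < c)
    (h : ∀ u : Fin D → ℝ, c * (u ⬝ᵥ u) ≤ u ⬝ᵥ A.mulVec u) {lam : ℝ} (hlam : 0 < lam)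
    {W : Weights m D} (hW : IsSOSP (regRisk S loss phi2 g a W0 A lam) W) (U : Weights m D) :
    empRisk S loss (model phi2 g a W0 W) + 2 * lam * norm24 (rowMul W (psdSqrt A)) ^ 4 ≤
      empRisk S loss (model phi2 g a W0 U) +
        (K ^ 3 * D ^ 2 / (m * c ^ 2) / 2 + 6 * lam) *
          (norm24 (rowMul W (psdSqrt A)) ^ 2 * norm24 (rowMul U (psdSqrt A)) ^ 2) := by
  set x := rowMul W (psdSqrt A) with hx
  set y := rowMul U (psdSqrt A) with hy
  set l' : Fin n → ℝ := fun i => deriv (fun z => loss z (S i).2) (model phi2 g a W0 W (S i).1)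
    with hl'
  set l'' : Fin n → ℝ := fun i =>
    deriv (deriv (fun z => loss z (S i).2)) (model phi2 g a W0 W (S i).1) with hl''
  set f : Fin n → ℝ := fun i => model phi2 g a W0 W (S i).1 with hf
  set e : Fin n → ℝ := fun i => model phi2 g a W0 U (S i).1 with he
  set P := ∑ r, ‖x r‖ ^ 2 * ‖y r‖ ^ 2 with hP
  set Q := K ^ 2 * D ^ 2 / (m * c ^ 2) with hQ
  have hnR : (0 : ℝ) < n := by exact_mod_cast hn
  -- The direction is `W` itself, as in Euler's identity: the model is homogeneous of degree two and
  -- the regularizer of degree four.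
  have hgrad : 1 / (n : ℝ) * ∑ i, l' i * (2 * f i) + 4 * lam * norm24 x ^ 4 = 0 := by
    have h1 := (regRisk_line_derivatives phi2 g a W0 S A lam hl W W).1
    rw [hW.1] at h1
    simp only [modelCross_self] at h1
    rw [norm24_pow_four]
    have h2 : ∑ r, 4 * ‖x r‖ ^ 2 * inner ℝ (x r) (x r) = 4 * ∑ r, ‖x r‖ ^ 4 := by
      rw [Finset.mul_sum]
      refine Finset.sum_congr rfl fun r _ => ?_
      rw [real_inner_self_eq_norm_sq]; ring
    rw [h2] at h1
    simp only [zero_apply] at h1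
    linarith
  set N : ℝ := (Fintype.card (Fin m → ℤˣ) : ℝ) with hN
  have hN0 : 0 < N := card_signs_pos
  -- Nonnegativity of the Hessian in all sign flips of `U`, averaged. The regularizer contributes
  -- `12 = 8 + 4` after Cauchy–Schwarz in each row.
  have hhess : 0 ≤ 1 / (n : ℝ) * ∑ i, (K * (Q * P) + 2 * (l' i * e i)) + lam * (12 * P) := by
    set β : (Fin m → ℤˣ) → Fin n → ℝ := fun s i =>
      modelCross phi2 g a W0 W (fun r => rsign (s r) • U r) (S i).1 with hβ
    have h1 : ∀ s : Fin m → ℤˣ, 0 ≤ 1 / (n : ℝ) * ∑ i, (K * β s i ^ 2 + 2 * (l' i * e i)) +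
        lam * (12 * P) := by
      intro s
      have h2 := (regRisk_line_derivatives phi2 g a W0 S A lam hl W
        (fun r => rsign (s r) • U r)).2
      have h3 := hW.2 (fun r => rsign (s r) • U r)
      rw [h2] at h3
      simp only [model_rsign_smul, norm_rowMul_rsign_smul] at h3
      refine h3.trans (add_le_add ?_ ?_)
      · refine mul_le_mul_of_nonneg_left (Finset.sum_le_sum fun i _ => ?_) (by positivity)
        have := (le_abs_self _).trans (hl.abs_deriv_deriv_le (S i).2 (f i))
        gcongr
      · refine mul_le_mul_of_nonneg_left ?_ hlam.le
        rw [Finset.mul_sum]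
        refine Finset.sum_le_sum fun r _ => ?_
        have h4 := abs_real_inner_le_norm (x r)
          (rowMul (fun r => rsign (s r) • U r) (psdSqrt A) r)
        rw [norm_rowMul_rsign_smul] at h4
        have h5 := pow_le_pow_left₀ (abs_nonneg _) h4 2
        rw [sq_abs, mul_pow] at h5
        change inner ℝ (x r) _ ^ 2 ≤ ‖x r‖ ^ 2 * ‖y r‖ ^ 2 at h5
        change 8 * inner ℝ (x r) _ ^ 2 + 4 * ‖x r‖ ^ 2 * ‖y r‖ ^ 2 ≤ _
        linarith
    have h2 := Finset.sum_nonneg fun s (_ : s ∈ Finset.univ) => h1 s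
    rw [Finset.sum_add_distrib, ← Finset.mul_sum, Finset.sum_comm] at h2
    have h3 : ∀ i, ∑ s : Fin m → ℤˣ, (K * β s i ^ 2 + 2 * (l' i * e i)) ≤
        N * (K * (Q * P) + 2 * (l' i * e i)) := by
      intro i
      rw [Finset.sum_add_distrib, ← Finset.mul_sum, Finset.sum_const, Finset.card_univ,
        nsmul_eq_mul]
      have := mul_le_mul_of_nonneg_left
        (sum_signs_modelCross_sq_le (W0 := W0) hphi ha hg hA hc h W U (S i).1) hK.le
      change K * ∑ s, β s i ^ 2 ≤ K * (N * (Q * P)) at this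
      linarith
    have h4 : 0 ≤ 1 / (n : ℝ) * ∑ i, N * (K * (Q * P) + 2 * (l' i * e i)) +
        N * (lam * (12 * P)) := by
      refine h2.trans (add_le_add ?_ ?_)
      · exact mul_le_mul_of_nonneg_left (Finset.sum_le_sum fun i _ => h3 i) (by positivity)
      · rw [Finset.sum_const, Finset.card_univ, nsmul_eq_mul]
    rw [← Finset.mul_sum] at h4
    have h5 : 0 ≤ N * (1 / (n : ℝ) * ∑ i, (K * (Q * P) + 2 * (l' i * e i)) +
        lam * (12 * P)) := by linarith
    exact nonneg_of_mul_nonneg_right h5 hN0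
  have hconv : empRisk S loss (model phi2 g a W0 W) + 1 / (n : ℝ) * ∑ i, l' i * (e i - f i) ≤
      empRisk S loss (model phi2 g a W0 U) := by
    rw [empRisk, empRisk, ← mul_add, ← Finset.sum_add_distrib]
    refine mul_le_mul_of_nonneg_left (Finset.sum_le_sum fun i _ => ?_) (by positivity)
    exact hl.tangent_le _ _ _
  have hPle : P ≤ norm24 x ^ 2 * norm24 y ^ 2 := sum_norm_sq_mul_le x y
  have hQ0 : 0 ≤ Q := by positivity
  have e1 : 1 / (n : ℝ) * ∑ i, (K * (Q * P) + 2 * (l' i * e i)) =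
      K * Q * P + 2 * (1 / (n : ℝ) * ∑ i, l' i * e i) := by
    rw [Finset.sum_add_distrib, Finset.sum_const, Finset.card_univ, Fintype.card_fin,
      nsmul_eq_mul, ← Finset.mul_sum]
    field_simp
  have e2 : 1 / (n : ℝ) * ∑ i, l' i * (2 * f i) = 2 * (1 / (n : ℝ) * ∑ i, l' i * f i) := by
    rw [Finset.mul_sum, Finset.mul_sum, Finset.mul_sum]
    exact Finset.sum_congr rfl fun i _ => by ring
  have e3 : 1 / (n : ℝ) * ∑ i, l' i * (e i - f i) =
      1 / (n : ℝ) * ∑ i, l' i * e i - 1 / (n : ℝ) * ∑ i, l' i * f i := by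
    simp only [mul_sub, Finset.sum_sub_distrib]
  rw [e1] at hhess
  rw [e2] at hgrad
  rw [e3] at hconv
  have e4 : K ^ 3 * D ^ 2 / (m * c ^ 2) / 2 = K * Q / 2 := by rw [hQ]; ring
  rw [e4]
  -- The conclusion is the convexity inequality plus half of the averaged Hessian inequality and
  -- half of the gradient identity, with `P` replaced by the product of squared norms.
  have h6 : (K * Q / 2 + 6 * lam) * P ≤ (K * Q / 2 + 6 * lam) *
      (norm24 x ^ 2 * norm24 y ^ 2) := mul_le_mul_of_nonneg_left hPle (by positivity)
  linarith

lemma continuous_norm24 : Continuous (norm24 : Weights m D → ℝ) := by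
  unfold norm24
  refine Continuous.rpow_const (by fun_prop) fun _ => Or.inr (by norm_num)

lemma continuous_rowMul (A : Matrix (Fin D) (Fin D) ℝ) :
    Continuous fun W : Weights m D => rowMul W A :=
  continuous_pi fun r => (contDiff_rowMul A r).continuous

lemma norm_le_norm24 (W : Weights m D) (r : Fin m) : ‖W r‖ ≤ norm24 W := by
  refine le_of_pow_le_pow_left₀ (n := 4) (by norm_num) (norm24_nonneg _) ?_
  rw [norm24_pow_four]
  exact Finset.single_le_sum (f := fun r => ‖W r‖ ^ 4) (fun r _ => by positivity)
    (Finset.mem_univ r)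

lemma isClosed_ball24 (A : Matrix (Fin D) (Fin D) ℝ) (B : ℝ) : IsClosed (ball24 m A B) :=
  isClosed_le (continuous_norm24.comp (continuous_rowMul _)) continuous_const

lemma isCompact_ball24 (hA : A.PosSemidef) {c : ℝ} (hc : 0 < c)
    (h : ∀ u : Fin D → ℝ, c * (u ⬝ᵥ u) ≤ u ⬝ᵥ A.mulVec u) (B : ℝ) :
    IsCompact (ball24 m A B) := by
  refine Metric.isCompact_of_isClosed_isBounded (isClosed_ball24 A B) ?_
  refine (Metric.isBounded_closedBall (x := 0) (r := √(B ^ 2 / c))).subset fun W hW => ?_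
  rw [mem_closedBall_zero_iff, pi_norm_le_iff_of_nonneg (Real.sqrt_nonneg _)]
  intro r
  refine Real.le_sqrt_of_sq_le ?_
  rw [le_div_iff₀ hc, mul_comm]
  refine (norm_sq_le_rowMul_psdSqrt hA h W r).trans ?_
  exact pow_le_pow_left₀ (norm_nonneg _) ((norm_le_norm24 _ r).trans hW) 2

lemma zero_mem_ball24 {B : ℝ} (hB : 0 ≤ B) : (0 : Weights m D) ∈ ball24 m A B := by
  have : rowMul (0 : Weights m D) (psdSqrt A) = 0 := by ext r j; simp [rowMul]
  rw [ball24, Set.mem_ofPred_eq, this]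
  simpa [norm24] using hB

lemma continuous_empRisk_model (hl : IsLoss K loss) :
    Continuous fun W => empRisk S loss (model phi2 g a W0 W) := by
  unfold empRisk
  refine continuous_const.mul (continuous_finsetSum _ fun i _ => ?_)
  exact (hl.differentiable (S i).2).continuous.comp (contDiff_model phi2 g a W0 (S i).1).continuous

lemma empRisk_nonneg (hl : IsLoss K loss) (f : Input d → ℝ) : 0 ≤ empRisk S loss f :=
  mul_nonneg (by positivity) (Finset.sum_nonneg fun i _ => hl.nonneg _ _)

/-- The choice of the regularization coefficient. -/
lemma bounds_of_landscape_inequality {R N M q lam τ τ₁ ε B : ℝ} (hR : 0 ≤ R) (hM : 0 ≤ M)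
    (hτ₁ : 0 < τ₁) (hτ : τ₁ ≤ τ) (hε : 0 < ε) (hB : 0 < B) (hq0 : 0 ≤ q)
    (hq : q * B ^ 4 ≤ ε / 3) (hlam : lam = (τ * M + ε) / (36 * B ^ 4))
    (h : R + 2 * lam * N ^ 4 ≤ M + (q / 2 + 6 * lam) * (N ^ 2 * B ^ 2)) :
    R + lam * N ^ 4 ≤ (1 + τ) * M + ε ∧ N ^ 4 ≤ 36 * (1 + 1 / τ₁) * B ^ 4 := by
  have hτ0 : 0 < τ := by linarith
  have hT : 0 < τ * M + ε := by positivity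
  have hlam0 : 0 < lam := by rw [hlam]; positivity
  have hB4 : lam * B ^ 4 = (τ * M + ε) / 36 := by rw [hlam]; field_simp
  -- By the choice of `lam` the last term equals `(τ M + ε) / 2`; this is where the constant `36`
  -- comes from.
  have h1 : 6 * lam * (N ^ 2 * B ^ 2) ≤ lam * N ^ 4 / 2 + 18 * (lam * B ^ 4) := by
    have : 0 ≤ lam / 2 * (N ^ 2 - 6 * B ^ 2) ^ 2 := by positivity
    nlinarith
  -- Again a completed square, leaving `q² B⁴ / (8 lam)`. It is at most `ε / 2` because `q B⁴ ≤ ε /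
  -- 3` and `36 lam B⁴ ≥ ε`. Together with `h1` it uses up one of the two copies of `lam * N ^ 4`.
  have h2 : q / 2 * (N ^ 2 * B ^ 2) ≤ lam * N ^ 4 / 2 + ε / 2 := by
    have h3 : 0 ≤ (lam * N ^ 2 - q / 2 * B ^ 2) ^ 2 := sq_nonneg _
    have h4 : (q * B ^ 4) ^ 2 ≤ (ε / 3) ^ 2 := pow_le_pow_left₀ (by positivity) hq 2
    have h5 : q ^ 2 * B ^ 4 * (τ * M + ε) / 36 ≤ lam * (ε ^ 2 / 9) := by
      calc q ^ 2 * B ^ 4 * (τ * M + ε) / 36 = lam * (q * B ^ 4) ^ 2 := by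
            rw [mul_div_assoc, ← hB4]; ring
        _ ≤ _ := by
            refine mul_le_mul_of_nonneg_left (h4.trans (by nlinarith)) hlam0.le
    have h6 : q ^ 2 * B ^ 4 ≤ 4 * lam * ε := by
      have h7 : q ^ 2 * B ^ 4 * ε ≤ q ^ 2 * B ^ 4 * (τ * M + ε) :=
        mul_le_mul_of_nonneg_left (by nlinarith) (by positivity)
      have h8 : q ^ 2 * B ^ 4 * ε ≤ (4 * lam * ε) * ε := by nlinarith
      exact le_of_mul_le_mul_right h8 hε
    have h9 : lam * (q / 2 * (N ^ 2 * B ^ 2)) ≤ lam * (lam * N ^ 4 / 2 + ε / 2) := by nlinarith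
    exact le_of_mul_le_mul_left h9 hlam0
  have hfin : R + lam * N ^ 4 ≤ (1 + τ) * M + ε := by
    have : M * τ ≥ 0 := by positivity
    nlinarith
  refine ⟨hfin, ?_⟩
  -- The lower bound `τ₁` on `τ` is what bounds `M` by a multiple of `τ M`, hence of `lam B⁴`.
  have h3 : lam * N ^ 4 ≤ (1 + 1 / τ₁) * (τ * M + ε) := by
    have h4 : M ≤ 1 / τ₁ * (τ * M) := by
      rw [one_div, inv_mul_eq_div, le_div_iff₀ hτ₁, mul_comm]
      exact mul_le_mul_of_nonneg_right hτ hM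
    have h5 : 0 ≤ 1 / τ₁ * ε := by positivity
    nlinarith
  have h4 : lam * N ^ 4 ≤ lam * (36 * (1 + 1 / τ₁) * B ^ 4) := by
    calc _ ≤ _ := h3
      _ = _ := by rw [show lam * (36 * (1 + 1 / τ₁) * B ^ 4) =
        36 * (1 + 1 / τ₁) * (lam * B ^ 4) by ring, hB4]; ring
  exact le_of_mul_le_mul_left h4 hlam0

/-- The deterministic part of the optimization theorem. -/
theorem landscape (hl : IsLoss K loss) (hK : 0 < K) (hphi : ∀ t, |phi2 t| ≤ K)
    (hm : 0 < m) (hn : 0 < n) (ha : ∀ r, a r = 1 ∨ a r = -1) (hg : ∀ x, ‖g x‖ ^ 2 ≤ D)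
    (hA : A.PosSemidef) {c : ℝ} (hc : 0 < c)
    (h : ∀ u : Fin D → ℝ, c * (u ⬝ᵥ u) ≤ u ⬝ᵥ A.mulVec u) {ε τ τ₁ B C : ℝ} (hε : 0 < ε)
    (hτ₁ : 0 < τ₁) (hτ : τ₁ ≤ τ) (hB : 0 < B) (hC1 : 3 * K ^ 3 / c ^ 2 ≤ C)
    (hC2 : 36 * (1 + 1 / τ₁) ≤ C) (hmC : C * D ^ 2 * B ^ 4 * ε⁻¹ ≤ m) :
    ∃ M : ℝ, IsLeast ((fun W => empRisk S loss (model phi2 g a W0 W)) '' ball24 m A B) M ∧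
      ∃ lam : ℝ, 0 < lam ∧ ∀ W : Weights m D,
        IsSOSP (regRisk S loss phi2 g a W0 A lam) W →
          norm24 (rowMul W (psdSqrt A)) ≤ C * B ∧
          regRisk S loss phi2 g a W0 A lam W ≤ (1 + τ) * M + ε := by
  obtain ⟨U, hU, hmin⟩ := (isCompact_ball24 (m := m) hA hc h B).exists_isMinOn
    ⟨0, zero_mem_ball24 hB.le⟩
    (continuous_empRisk_model (S := S) (phi2 := phi2) (g := g) (a := a) (W0 := W0)
      hl).continuousOn
  set M := empRisk S loss (model phi2 g a W0 U) with hM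
  have hM0 : 0 ≤ M := empRisk_nonneg hl _
  have hτ0 : 0 < τ := by linarith
  refine ⟨M, ⟨⟨U, hU, rfl⟩, ?_⟩, (τ * M + ε) / (36 * B ^ 4), by positivity, fun W hW => ?_⟩
  · rintro _ ⟨W, hW, rfl⟩
    exact hmin hW
  have hmR : (0 : ℝ) < m := by exact_mod_cast hm
  have hlam : 0 < (τ * M + ε) / (36 * B ^ 4) := by positivity
  have h1 := empRisk_add_le_of_isSOSP hl hK hphi hn ha hg hA hc h hlam hW U
  set N := norm24 (rowMul W (psdSqrt A)) with hN
  have hN0 : 0 ≤ N := norm24_nonneg _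
  set q : ℝ := K ^ 3 * D ^ 2 / (m * c ^ 2) with hq
  have hq0 : 0 ≤ q := by positivity
  have hqB : q * B ^ 4 ≤ ε / 3 := by
    have h2 : 3 * K ^ 3 / c ^ 2 * D ^ 2 * B ^ 4 * ε⁻¹ ≤ m := le_trans (by gcongr) hmC
    have h3 : q * B ^ 4 = (3 * K ^ 3 / c ^ 2 * D ^ 2 * B ^ 4 * ε⁻¹) * (ε / (3 * m)) := by
      rw [hq]; field_simp
    rw [h3]
    calc _ ≤ m * (ε / (3 * m)) := by gcongr
      _ = ε / 3 := by field_simp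
  have hUB : norm24 (rowMul U (psdSqrt A)) ^ 2 ≤ B ^ 2 :=
    pow_le_pow_left₀ (norm24_nonneg _) hU 2
  have h2 := bounds_of_landscape_inequality (R := empRisk S loss (model phi2 g a W0 W)) (N := N)
    (empRisk_nonneg hl _) hM0 hτ₁ hτ hε hB hq0 hqB rfl (h1.trans (by gcongr))
  refine ⟨?_, h2.1⟩
  have hC : 1 ≤ C := by
    have : 0 ≤ 1 / τ₁ := by positivity
    linarith
  refine le_of_pow_le_pow_left₀ (n := 4) (by norm_num) (by positivity) ?_
  refine h2.2.trans ?_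
  rw [mul_pow]
  refine mul_le_mul_of_nonneg_right (hC2.trans ?_) (by positivity)
  exact le_self_pow₀ hC (by norm_num)

end Landscape

end QuadNTK

namespace QuadNTK

/-! ### Generalization -/

section ModelRegularity

variable {d D m : ℕ} {Y : Type*} [MeasurableSpace Y] {K : ℝ} {loss : ℝ → Y → ℝ}
  {phi2 : ℝ → ℝ} {g : Input d → EuclideanSpace ℝ (Fin D)} {a : Fin m → ℝ} {W0 : Weights m D}

lemma measurable_model (hphi : Measurable phi2) (hg : Measurable g) (W : Weights m D) :
    Measurable (model phi2 g a W0 W) := by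
  unfold model
  refine (Finset.measurable_sum _ fun r _ => ?_).const_mul _
  have h1 : ∀ w : EuclideanSpace ℝ (Fin D), Measurable fun x => (inner ℝ w (g x) : ℝ) :=
    fun w => measurable_const.inner hg
  exact ((hphi.comp (h1 _)).const_mul _).mul ((h1 _).pow_const 2)

lemma abs_model_le (hphi : ∀ t, |phi2 t| ≤ K) (ha : ∀ r, |a r| ≤ 1)
    (hg : ∀ x, ‖g x‖ ^ 2 ≤ D) (W : Weights m D) (x : Input d) :
    |model phi2 g a W0 W x| ≤ 1 / (2 * Real.sqrt m) * (m * (K * D)) * ‖W‖ ^ 2 := by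
  have hK : 0 ≤ K := (abs_nonneg _).trans (hphi 0)
  rw [model, abs_mul, abs_of_nonneg (by positivity : (0 : ℝ) ≤ 1 / (2 * Real.sqrt m)), mul_assoc]
  refine mul_le_mul_of_nonneg_left ?_ (by positivity)
  refine (Finset.abs_sum_le_sum_abs _ _).trans ?_
  calc _ ≤ ∑ _r : Fin m, K * D * ‖W‖ ^ 2 := by
        refine Finset.sum_le_sum fun r _ => ?_
        have h1 : |inner ℝ (W r) (g x)| ^ 2 ≤ (‖W r‖ * ‖g x‖) ^ 2 :=
          pow_le_pow_left₀ (abs_nonneg _) (abs_real_inner_le_norm _ _) 2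
        have h2 : ‖W r‖ ^ 2 ≤ ‖W‖ ^ 2 := pow_le_pow_left₀ (norm_nonneg _) (norm_le_pi_norm W r) 2
        rw [abs_mul, abs_mul, abs_pow]
        calc _ ≤ 1 * K * (‖W‖ ^ 2 * D) := by
              refine mul_le_mul (mul_le_mul (ha r) (hphi _) (abs_nonneg _) zero_le_one)
                (h1.trans ?_) (by positivity) (by positivity)
              rw [mul_pow]
              exact mul_le_mul h2 (hg x) (by positivity) (by positivity)
          _ = _ := by ring
    _ = _ := by simp; ring

lemma IsLoss.measurable_comp (hl : IsLoss K loss) {f : Input d → ℝ} (hf : Measurable f) :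
    Measurable fun z : Input d × Y => loss (f z.1) z.2 := by
  have h1 : Measurable (Function.uncurry loss) :=
    measurable_uncurry_of_continuous_of_measurable
      (fun y => (hl.differentiable y).continuous) hl.measurable
  exact h1.comp ((hf.comp measurable_fst).prodMk measurable_snd)

lemma IsLoss.abs_le (hl : IsLoss K loss) (t : ℝ) (y : Y) : |loss t y| ≤ 1 + |t| := by
  rw [abs_of_nonneg (hl.nonneg t y)]
  have h1 := (le_abs_self _).trans (hl.lipschitz y t 0)
  have h2 := hl.zero_le_one y
  rw [sub_zero] at h1
  linarith

/-- Dominated convergence with a bound that is locally uniform in `W`. Continuity is needed to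
replace the supremum over the ball by one over a countable dense set. -/
lemma continuous_risk_model {P : Measure (Input d × Y)} [IsProbabilityMeasure P]
    (hl : IsLoss K loss) (hphi : Measurable phi2) (hphiK : ∀ t, |phi2 t| ≤ K)
    (ha : ∀ r, |a r| ≤ 1) (hg : Measurable g) (hgD : ∀ x, ‖g x‖ ^ 2 ≤ D) :
    Continuous fun W => risk P loss (model phi2 g a W0 W) := by
  refine continuous_iff_continuousAt.2 fun W => ?_
  have hK : 0 ≤ K := (abs_nonneg _).trans (hphiK 0)
  set β := 1 / (2 * Real.sqrt m) * (m * (K * D)) with hβ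
  have hβ0 : 0 ≤ β := by positivity
  refine continuousAt_of_dominated (bound := fun _ => 1 + β * (‖W‖ + 1) ^ 2) ?_ ?_
    (integrable_const _) ?_
  · exact Filter.Eventually.of_forall fun V =>
      (hl.measurable_comp (measurable_model hphi hg V)).aestronglyMeasurable
  · have : ∀ᶠ V in nhds W, ‖V‖ < ‖W‖ + 1 :=
      continuous_norm.continuousAt.eventually_lt continuousAt_const (by linarith)
    filter_upwards [this] with V hV
    refine Filter.Eventually.of_forall fun z => ?_
    refine (hl.abs_le _ _).trans ?_
    have h1 := abs_model_le (W0 := W0) hphiK ha hgD V z.1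
    have h2 : β * ‖V‖ ^ 2 ≤ β * (‖W‖ + 1) ^ 2 := by gcongr
    linarith
  · refine Filter.Eventually.of_forall fun z => ?_
    exact ((hl.differentiable z.2).continuous.comp
      (contDiff_model phi2 g a W0 z.1).continuous).continuousAt

end ModelRegularity

/-! ### Operator norm of the empirical second moment -/

section OperatorNorm

open Matrix

variable {d D n : ℕ}

lemma dotProduct_mulVec_le_opNorm (M : Matrix (Fin D) (Fin D) ℝ) (u : Fin D → ℝ) :
    u ⬝ᵥ M *ᵥ u ≤ ‖Matrix.toEuclideanCLM (𝕜 := ℝ) M‖ * (u ⬝ᵥ u) := by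
  set v : EuclideanSpace ℝ (Fin D) := WithLp.toLp 2 u with hv
  have h1 : u ⬝ᵥ M *ᵥ u = inner ℝ v (Matrix.toEuclideanCLM (𝕜 := ℝ) M v) := by
    rw [dotProduct_eq_inner, Matrix.ofLp_toEuclideanCLM]
  have h2 : u ⬝ᵥ u = ‖v‖ ^ 2 := (norm_sq_eq_dotProduct v).symm
  rw [h1, h2]
  calc _ ≤ ‖v‖ * ‖Matrix.toEuclideanCLM (𝕜 := ℝ) M v‖ := real_inner_le_norm _ _
    _ ≤ ‖v‖ * (‖Matrix.toEuclideanCLM (𝕜 := ℝ) M‖ * ‖v‖) := by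
        gcongr; exact ContinuousLinearMap.le_opNorm _ _
    _ = _ := by ring

lemma opNorm_empCov_le {h : Input d → EuclideanSpace ℝ (Fin D)} {b : ℝ} (hb0 : 0 ≤ b)
    (hb : ∀ x, ‖h x‖ ^ 2 ≤ b) (xs : Fin n → Input d) :
    ‖Matrix.toEuclideanCLM (𝕜 := ℝ) (empCov h xs)‖ ≤ b := by
  refine ContinuousLinearMap.opNorm_le_bound _ hb0 fun v => ?_
  have h1 : Matrix.toEuclideanCLM (𝕜 := ℝ) (empCov h xs) v =
      (1 / (n : ℝ)) • ∑ i, inner ℝ (h (xs i)) v • h (xs i) := by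
    apply WithLp.ofLp_injective 2
    rw [Matrix.ofLp_toEuclideanCLM, empCov, smul_mulVec, sum_mulVec, WithLp.ofLp_smul,
      WithLp.ofLp_sum]
    congr 1
    refine Finset.sum_congr rfl fun i _ => ?_
    rw [vecMulVec_mulVec, WithLp.ofLp_smul, dotProduct_eq_inner]
    ext j; simp [mul_comm]
  rw [h1, norm_smul, Real.norm_of_nonneg (by positivity)]
  rcases Nat.eq_zero_or_pos n with hn | hn
  · subst hn; simp; positivity
  have hnR : (0 : ℝ) < n := by exact_mod_cast hn
  calc _ ≤ 1 / (n : ℝ) * ∑ _i : Fin n, b * ‖v‖ := by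
        refine mul_le_mul_of_nonneg_left ((norm_sum_le _ _).trans
          (Finset.sum_le_sum fun i _ => ?_)) (by positivity)
        rw [norm_smul]
        calc _ ≤ (‖h (xs i)‖ * ‖v‖) * ‖h (xs i)‖ :=
              mul_le_mul_of_nonneg_right (norm_inner_le_norm _ _) (norm_nonneg _)
          _ = ‖h (xs i)‖ ^ 2 * ‖v‖ := by ring
          _ ≤ _ := by gcongr; exact hb _
    _ = b * ‖v‖ := by simp; field_simp

lemma measurable_opNorm_empCov {h : Input d → EuclideanSpace ℝ (Fin D)} (hh : Measurable h) :
    Measurable fun xs : Fin n → Input d =>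
      ‖Matrix.toEuclideanCLM (𝕜 := ℝ) (empCov h xs)‖ := by
  have hcoord : ∀ i, Measurable fun x => h x i := fun i =>
    (measurable_pi_apply i).comp ((WithLp.measurable_ofLp 2 _).comp hh)
  have h1 : Measurable fun xs : Fin n → Input d => (fun i j => empCov h xs i j :
      Fin D → Fin D → ℝ) := by
    refine measurable_pi_lambda _ fun i => measurable_pi_lambda _ fun j => ?_
    have : ∀ xs : Fin n → Input d, empCov h xs i j =
        (1 / (n : ℝ)) * ∑ k, h (xs k) i * h (xs k) j := by
      intro xs
      simp [empCov, Matrix.sum_apply, vecMulVec_apply]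
    simp only [this]
    refine (Finset.measurable_sum _ fun k _ => ?_).const_mul _
    exact ((hcoord i).comp (measurable_pi_apply k)).mul ((hcoord j).comp (measurable_pi_apply k))
  let L : (Fin D → Fin D → ℝ) →ₗ[ℝ] (EuclideanSpace ℝ (Fin D) →L[ℝ] EuclideanSpace ℝ (Fin D)) :=
    { toFun := fun M => Matrix.toEuclideanCLM (𝕜 := ℝ) (Matrix.of M)
      map_add' := fun M N => by rw [← map_add]; rfl
      map_smul' := fun c M => by rw [RingHom.id_apply, ← map_smul]; rfl }
  have h2 : Continuous fun M => ‖L M‖ := L.continuous_of_finiteDimensional.norm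
  exact h2.measurable.comp h1

end OperatorNorm

/-! ### Rademacher complexity of the model class -/

section RademacherComplexity

open Matrix

lemma integral_sqrt_le {Ω : Type*} [MeasurableSpace Ω] {ν : Measure Ω} [IsProbabilityMeasure ν]
    {f : Ω → ℝ} (hf : ∀ x, 0 ≤ f x) (hfi : Integrable f ν) (hfs : Integrable (fun x => √(f x)) ν) :
    ∫ x, √(f x) ∂ν ≤ √(∫ x, f x ∂ν) :=
  Real.strictConcaveOn_sqrt.concaveOn.le_map_integral Real.continuous_sqrt.continuousOn isClosed_Ici
    (Filter.Eventually.of_forall hf) hfi hfs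

variable {d D m n : ℕ} {Y : Type*} [MeasurableSpace Y] {K : ℝ} {loss : ℝ → Y → ℝ}
  {phi2 : ℝ → ℝ} {g : Input d → EuclideanSpace ℝ (Fin D)} {a : Fin m → ℝ} {W0 : Weights m D}
  {A : Matrix (Fin D) (Fin D) ℝ}

/-- Cauchy–Schwarz against the constant vector; the factor `√m` cancels the normalization `1/√m` of
the model. -/
lemma sum_norm_sq_le_sqrt_mul (W : Weights m D) :
    ∑ r, ‖W r‖ ^ 2 ≤ √m * norm24 W ^ 2 := by
  refine le_of_pow_le_pow_left₀ two_ne_zero (by have := norm24_nonneg W; positivity) ?_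
  have := Finset.sum_mul_sq_le_sq_mul_sq Finset.univ (fun _ : Fin m => (1 : ℝ))
    (fun r => ‖W r‖ ^ 2)
  rw [mul_pow, Real.sq_sqrt (Nat.cast_nonneg m), ← pow_mul, norm24_pow_four]
  simpa [← pow_mul] using this

/-- The Rademacher average of the models with weights in a ball, for a fixed sample. -/
lemma rademacher_model_le {T : Type*} [Finite T] [Nonempty T] (hD : 0 < D) (hm : 0 < m)
    (hn : 0 < n) (hphi : ∀ t, |phi2 t| ≤ K) (ha : ∀ r, |a r| ≤ 1)
    (hA : A.PosSemidef) {c : ℝ} (hc : 0 < c)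
    (h : ∀ u : Fin D → ℝ, c * (u ⬝ᵥ u) ≤ u ⬝ᵥ A *ᵥ u) {B : ℝ} (W : T → Weights m D)
    (hW : ∀ t, W t ∈ ball24 m A B) {Bg : ℝ} (xs : Fin n → Input d) (hxs : ∀ i, ‖g (xs i)‖ ≤ Bg) :
    (Fintype.card (Fin n → ℤˣ) : ℝ)⁻¹ * ∑ s : Fin n → ℤˣ,
      ⨆ t, ∑ i, rsign (s i) * model phi2 g a W0 (W t) (xs i) ≤
      2 * B ^ 2 * √(K ^ 2 * (Bg ^ 2 / c) * (1 + Real.log (D * m)) *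
        (n * ‖Matrix.toEuclideanCLM (𝕜 := ℝ) (empCov (whiten A g) xs)‖)) := by
  have : Nonempty (Fin m) := ⟨⟨0, hm⟩⟩
  have hnR : (0 : ℝ) < n := by exact_mod_cast hn
  have hK : 0 ≤ K := (abs_nonneg _).trans (hphi 0)
  set hh : Fin n → Fin D → ℝ := fun i => (psdSqrt A)⁻¹ *ᵥ (g (xs i)).ofLp with hhh
  set Λ : ℝ := n * ‖Matrix.toEuclideanCLM (𝕜 := ℝ) (empCov (whiten A g) xs)‖ with hΛ
  have hΛ0 : 0 ≤ Λ := by positivity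
  have hsum : ∀ u : Fin D → ℝ, ∑ i, (hh i ⬝ᵥ u) ^ 2 ≤ Λ * (u ⬝ᵥ u) := by
    intro u
    have h1 := dotProduct_mulVec_le_opNorm (empCov (whiten A g) xs) u
    rw [dotProduct_empCov_mulVec, one_div, inv_mul_eq_div, div_le_iff₀ hnR] at h1
    calc _ ≤ _ := h1
      _ = _ := by rw [hΛ]; ring
  have hb : ∀ i, hh i ⬝ᵥ hh i ≤ Bg ^ 2 / c := by
    intro i
    rw [le_div_iff₀ hc, mul_comm]
    refine (inv_psdSqrt_mulVec_dotProduct_le hA hc h _).trans ?_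
    rw [← norm_sq_eq_dotProduct]
    exact pow_le_pow_left₀ (norm_nonneg _) (hxs i) 2
  obtain ⟨N, hN0, hN1, hN2⟩ := exists_khintchine_bound_rankOne (ρ := Fin m) hD
    (c := fun r i => a r * phi2 (inner ℝ (W0 r) (g (xs i)))) (h := hh) (K := K)
    (by positivity) hΛ0 (fun r i => by
      rw [abs_mul]
      calc _ ≤ 1 * K := mul_le_mul (ha r) (hphi _) (abs_nonneg _) zero_le_one
        _ = K := one_mul K) hb hsum
  -- For fixed signs the sum is a combination of quadratic forms in the whitened rows. Their
  -- matrices do not depend on the weights, so `N s` bounds all `t` at once.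
  have key : ∀ s : Fin n → ℤˣ, ⨆ t, ∑ i, rsign (s i) * model phi2 g a W0 (W t) (xs i) ≤
      B ^ 2 / 2 * N s := by
    intro s
    refine ciSup_le fun t => ?_
    have h1 : ∀ r i, inner ℝ (W t r) (g (xs i)) =
        hh i ⬝ᵥ (psdSqrt A *ᵥ (W t r).ofLp) := by
      intro r i
      rw [dotProduct_comm, dotProduct_eq_psdSqrt_dotProduct hA hc h, dotProduct_eq_inner]
    have h2 : ∑ i, rsign (s i) * model phi2 g a W0 (W t) (xs i) =
        1 / (2 * √m) * ∑ r, ∑ i, rsign (s i) *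
          (a r * phi2 (inner ℝ (W0 r) (g (xs i))) *
            (hh i ⬝ᵥ (psdSqrt A *ᵥ (W t r).ofLp)) ^ 2) := by
      rw [Finset.sum_comm, Finset.mul_sum]
      refine Finset.sum_congr rfl fun i _ => ?_
      rw [model, ← Finset.mul_sum]
      simp only [h1]
      ring
    have h3 : ∀ r, (psdSqrt A *ᵥ (W t r).ofLp) ⬝ᵥ (psdSqrt A *ᵥ (W t r).ofLp) =
        ‖rowMul (W t) (psdSqrt A) r‖ ^ 2 := by
      intro r
      rw [norm_sq_rowMul_psdSqrt hA, psdSqrt_mulVec_dotProduct hA]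
    have hsm : 0 < √(m : ℝ) := Real.sqrt_pos.2 (by exact_mod_cast hm)
    have h4 : norm24 (rowMul (W t) (psdSqrt A)) ^ 2 ≤ B ^ 2 :=
      pow_le_pow_left₀ (norm24_nonneg _) (hW t) 2
    rw [h2]
    calc _ ≤ 1 / (2 * √m) * ∑ r, N s * ‖rowMul (W t) (psdSqrt A) r‖ ^ 2 := by
          gcongr with r _
          rw [← h3]
          exact (le_abs_self _).trans (hN1 s r _)
      _ ≤ 1 / (2 * √m) * (N s * (√m * B ^ 2)) := by
          rw [← Finset.mul_sum]
          have := hN0 s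
          gcongr
          exact (sum_norm_sq_le_sqrt_mul _).trans (by gcongr)
      _ = _ := by field_simp
  calc _ ≤ (Fintype.card (Fin n → ℤˣ) : ℝ)⁻¹ * ∑ s, B ^ 2 / 2 * N s := by
        gcongr with s _; exact key s
    _ = B ^ 2 / 2 * ((Fintype.card (Fin n → ℤˣ) : ℝ)⁻¹ * ∑ s, N s) := by
        rw [← Finset.mul_sum]; ring
    _ ≤ B ^ 2 / 2 * (4 * √(K ^ 2 * (Bg ^ 2 / c) * Λ * (1 + Real.log (D * Fintype.card (Fin m))))) :=
        by gcongr
    _ = _ := by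
        rw [Fintype.card_fin, mul_right_comm (K ^ 2 * (Bg ^ 2 / c))]; ring

/-- Rademacher averages of a single bounded function. -/
lemma inv_card_mul_sum_abs_le {k : Fin n → ℝ} (hk : ∀ i, |k i| ≤ 1) :
    (Fintype.card (Fin n → ℤˣ) : ℝ)⁻¹ * ∑ s : Fin n → ℤˣ, |∑ i, rsign (s i) * k i| ≤ √n := by
  set c : ℝ := (Fintype.card (Fin n → ℤˣ) : ℝ) with hc
  have hc0 : 0 < c := card_signs_pos
  refine Real.le_sqrt_of_sq_le ?_
  have h1 := Real.pow_arith_mean_le_arith_mean_pow (Finset.univ : Finset (Fin n → ℤˣ))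
    (fun _ => c⁻¹) (fun s => |∑ i, rsign (s i) * k i|) (fun _ _ => by positivity)
    (by rw [Finset.sum_const, Finset.card_univ, nsmul_eq_mul, ← hc, mul_inv_cancel₀ hc0.ne'])
    (fun s _ => abs_nonneg _) 2
  rw [← Finset.mul_sum, ← Finset.mul_sum] at h1
  refine h1.trans ?_
  simp only [sq_abs]
  rw [sum_signs_sq, ← mul_assoc, inv_mul_cancel₀ hc0.ne', one_mul]
  calc _ ≤ ∑ _i : Fin n, (1 : ℝ) := Finset.sum_le_sum fun i _ => by
        rw [← sq_abs]; exact pow_le_one₀ (abs_nonneg _) (hk i)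
    _ = n := by simp

end RademacherComplexity

end QuadNTK

namespace QuadNTK

/-! ### Expected generalization gap -/

section GeneralizationGap

open Matrix

variable {d D m n : ℕ} {Y : Type*} [MeasurableSpace Y] {K : ℝ} {loss : ℝ → Y → ℝ}
  {phi2 : ℝ → ℝ} {g : Input d → EuclideanSpace ℝ (Fin D)} {a : Fin m → ℝ} {W0 : Weights m D}
  {A : Matrix (Fin D) (Fin D) ℝ} {P : Measure (Input d × Y)} [IsProbabilityMeasure P]

lemma measurable_whiten (hg : Measurable g) : Measurable (whiten A g) := by
  refine (WithLp.measurable_toLp 2 _).comp (measurable_pi_lambda _ fun i => ?_)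
  change Measurable fun x => ∑ j, (psdSqrt A)⁻¹ i j * (g x).ofLp j
  refine Finset.measurable_sum _ fun j _ => ?_
  exact (((measurable_pi_apply j).comp ((WithLp.measurable_ofLp 2 _).comp hg))).const_mul _

lemma norm_whiten_sq_le (hA : A.PosSemidef) {c : ℝ} (hc : 0 < c)
    (h : ∀ u : Fin D → ℝ, c * (u ⬝ᵥ u) ≤ u ⬝ᵥ A *ᵥ u) (hgD : ∀ x, ‖g x‖ ^ 2 ≤ D) (x : Input d) :
    ‖whiten A g x‖ ^ 2 ≤ D / c := by
  rw [le_div_iff₀ hc, mul_comm, norm_sq_eq_dotProduct]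
  refine (inv_psdSqrt_mulVec_dotProduct_le hA hc h _).trans ?_
  rw [← norm_sq_eq_dotProduct]
  exact hgD x

lemma measurePreserving_map_fst :
    MeasurePreserving (fun (S : Fin n → Input d × Y) i => (S i).1)
      (Measure.pi fun _ => P) (Measure.pi fun _ => P.fst) :=
  measurePreserving_pi _ _ fun _ => ⟨measurable_fst, rfl⟩

/-- The mean deviation of the loss at the zero model. -/
lemma integral_abs_zero_gap_le (hl : IsLoss K loss) :
    ∫ S : Fin n → Input d × Y, |n * ∫ z, loss 0 z.2 ∂P - ∑ i, loss 0 (S i).2|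
      ∂(Measure.pi fun _ => P) ≤ 2 * √n := by
  -- The absolute deviation of one function is the supremum over the class of that function and its
  -- negative, so the symmetrization theorem applies to it too.
  set F : Bool → Input d × Y → ℝ := fun b z => (if b then 1 else -1) * loss 0 z.2 with hF
  have hl0 : Measurable fun z : Input d × Y => loss 0 z.2 := (hl.measurable 0).comp measurable_snd
  have habs : ∀ y, |loss 0 y| ≤ 1 := fun y => by
    rw [abs_of_nonneg (hl.nonneg 0 y)]; exact hl.zero_le_one y
  have hFm : ∀ b, Measurable (F b) := fun b => hl0.const_mul _
  have hFb : ∀ b z, |F b z| ≤ 1 := by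
    intro b z
    rw [abs_mul]
    have : |(if b then (1 : ℝ) else -1)| = 1 := by cases b <;> simp
    rw [this, one_mul]; exact habs _
  have hi : |∫ z, loss 0 z.2 ∂P| ≤ 1 := by
    have := norm_integral_le_of_norm_le_const (μ := P) (f := fun z => loss 0 z.2) (C := 1)
      (Filter.Eventually.of_forall fun z => habs z.2)
    simpa using this
  have hsb : ∀ S : Fin n → Input d × Y, |∑ i, loss 0 (S i).2| ≤ n * 1 := fun S => by
    simpa using abs_sum_rsign_mul_le (fun _ => 1) fun i => habs (S i).2
  have hms : Measurable fun S : Fin n → Input d × Y => ∑ i, loss 0 (S i).2 :=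
    Finset.measurable_sum _ fun i _ => hl0.comp (measurable_pi_apply i)
  have hb : ∀ S : Fin n → Input d × Y,
      |n * ∫ z, loss 0 z.2 ∂P - ∑ i, loss 0 (S i).2| ≤ n + n * 1 := by
    intro S
    refine (abs_sub _ _).trans (add_le_add ?_ (hsb S))
    rw [abs_mul, Nat.abs_cast]
    exact mul_le_of_le_one_right (Nat.cast_nonneg n) hi
  have hD : ∀ b (S : Fin n → Input d × Y), n * ∫ z, F b z ∂P - ∑ i, F b (S i) =
      (if b then 1 else -1) * (n * ∫ z, loss 0 z.2 ∂P - ∑ i, loss 0 (S i).2) := by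
    intro b S
    simp only [hF]
    rw [integral_const_mul, ← Finset.mul_sum]; ring
  have h1 := integral_iSup_sub_le (μ := P) (n := n) hFm hFb
  refine le_trans (integral_mono ?_ ?_ fun S => ?_)
    (h1.trans (mul_le_mul_of_nonneg_left ?_ (by norm_num)))
  · exact integrable_of_abs_le (measurable_const.sub hms).abs fun S => by
      rw [abs_abs]; exact hb S
  · refine integrable_of_abs_le (Measurable.iSup fun b => ?_) (b := n + n * 1) fun S =>
      abs_iSup_le fun b => ?_
    · exact measurable_const.sub (Finset.measurable_sum _ fun i _ =>
        (hFm b).comp (measurable_pi_apply i))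
    · rw [hD, abs_mul]
      have : |(if b then (1 : ℝ) else -1)| = 1 := by cases b <;> simp
      rw [this, one_mul]; exact hb S
  · refine abs_le'.2 ⟨?_, ?_⟩
    · refine le_trans (le_of_eq ?_) (le_iSup_of_finite _ true)
      rw [hD]; simp
    · refine le_trans (le_of_eq ?_) (le_iSup_of_finite _ false)
      rw [hD]; simp
  · calc _ ≤ ∫ _S : Fin n → Input d × Y, √n ∂(Measure.pi fun _ => P) := by
          refine integral_mono ((integrable_finsetSum _ fun s _ => integrable_iSup_sum_rsign
            (μ := P) hFm hFb s).const_mul _) (integrable_const _) fun S => ?_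
          refine le_trans ?_ (inv_card_mul_sum_abs_le fun i => habs (S i).2)
          refine mul_le_mul_of_nonneg_left (Finset.sum_le_sum fun s _ => ciSup_le fun b => ?_)
            (by positivity)
          have : ∑ i, rsign (s i) * F b (S i) =
              (if b then 1 else -1) * ∑ i, rsign (s i) * loss 0 (S i).2 := by
            rw [Finset.mul_sum]
            exact Finset.sum_congr rfl fun i _ => by simp only [hF]; ring
          rw [this]
          refine (le_abs_self _).trans ?_
          rw [abs_mul]
          have : |(if b then (1 : ℝ) else -1)| = 1 := by cases b <;> simp
          rw [this, one_mul]
      _ = √n := by simp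

/-- The expected uniform deviation over a finite set of weights. -/
lemma integral_iSup_gap_le {T : Type*} [Fintype T] (hl : IsLoss K loss) (hK : 0 < K)
    (hphi : Measurable phi2) (hphiK : ∀ t, |phi2 t| ≤ K) (hD : 0 < D) (hm : 0 < m) (hn : 0 < n)
    (ha : ∀ r, |a r| ≤ 1) (hg : Measurable g) (hgD : ∀ x, ‖g x‖ ^ 2 ≤ D)
    (hA : A.PosSemidef) {c : ℝ} (hc : 0 < c)
    (h : ∀ u : Fin D → ℝ, c * (u ⬝ᵥ u) ≤ u ⬝ᵥ A *ᵥ u) {B Bg : ℝ} (hBg : 0 < Bg)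
    (hgB : ∀ᵐ x ∂P.fst, ‖g x‖ ≤ Bg) (W : T → Weights m D) (hW : ∀ t, W t ∈ ball24 m A B)
    {t₀ : T} (ht₀ : W t₀ = 0) :
    Integrable (fun S : Fin n → Input d × Y => ⨆ t, |risk P loss (model phi2 g a W0 (W t)) -
        empRisk S loss (model phi2 g a W0 (W t))|) (Measure.pi fun _ => P) ∧
    ∫ S : Fin n → Input d × Y, ⨆ t, |risk P loss (model phi2 g a W0 (W t)) -
        empRisk S loss (model phi2 g a W0 (W t))| ∂(Measure.pi fun _ => P) ≤
      8 * K / √c * (Bg ^ 2 * B ^ 2 * opMoment n Bg A g P.fst / √n * √(1 + Real.log (D * m))) +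
        2 * (1 / √n) := by
  have : Nonempty T := ⟨t₀⟩
  have hnR : (0 : ℝ) < n := by exact_mod_cast hn
  have hD1 : (1 : ℝ) ≤ D := by exact_mod_cast hD
  have hm1 : (1 : ℝ) ≤ m := by exact_mod_cast hm
  set L : ℝ := 1 + Real.log (D * m) with hL
  have hL0 : 0 ≤ L := by
    have : 0 ≤ Real.log (D * m) := Real.log_nonneg (by nlinarith)
    linarith
  set π : Measure (Fin n → Input d × Y) := Measure.pi fun _ => P with hπ
  set f : T → Input d → ℝ := fun t => model phi2 g a W0 (W t) with hf
  have hfm : ∀ t, Measurable (f t) := fun t => measurable_model hphi hg (W t)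
  set β := 1 / (2 * Real.sqrt m) * (m * (K * D)) with hβ
  have hβ0 : 0 ≤ β := by positivity
  set b : ℝ := 1 + β * ∑ t, ‖W t‖ ^ 2 with hb
  have hlb : ∀ t x y, |loss (f t x) y| ≤ b := by
    intro t x y
    refine (hl.abs_le _ _).trans (add_le_add_right ?_ 1)
    refine (abs_model_le hphiK ha hgD (W t) x).trans (mul_le_mul_of_nonneg_left ?_ hβ0)
    exact Finset.single_le_sum (f := fun t => ‖W t‖ ^ 2) (fun t _ => by positivity)
      (Finset.mem_univ t)
  set F : ℝ → T → Input d × Y → ℝ := fun σ t z => σ * loss (f t z.1) z.2 with hF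
  have hFm : ∀ σ t, Measurable (F σ t) := fun σ t => (hl.measurable_comp (hfm t)).const_mul σ
  have hFb : ∀ σ : ℝ, |σ| = 1 → ∀ t z, |F σ t z| ≤ b := by
    intro σ hσ t z
    rw [abs_mul, hσ, one_mul]; exact hlb _ _ _
  -- the bound for the Rademacher averages
  set κ' : ℝ := K ^ 2 * (Bg ^ 2 / c) * L with hκ'
  have hκ'0 : 0 ≤ κ' := by positivity
  set ν : (Fin n → Input d) → ℝ := fun xs =>
    ‖Matrix.toEuclideanCLM (𝕜 := ℝ) (empCov (whiten A g) xs)‖ with hν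
  have hνm : Measurable ν := measurable_opNorm_empCov (measurable_whiten hg)
  have hνb : ∀ xs, ν xs ≤ D / c := opNorm_empCov_le (by positivity) (norm_whiten_sq_le hA hc h hgD)
  have hν0 : ∀ xs, 0 ≤ ν xs := fun xs => norm_nonneg _
  have hνi : Integrable ν (Measure.pi fun _ => P.fst) :=
    integrable_of_abs_le hνm fun xs => by rw [abs_of_nonneg (hν0 xs)]; exact hνb xs
  set G : (Fin n → Input d) → ℝ := fun xs => 2 * B ^ 2 * √(κ' * (n * ν xs)) with hG
  have hsq : Integrable (fun xs => √(κ' * (n * ν xs))) (Measure.pi fun _ => P.fst) := by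
    refine integrable_of_abs_le (b := √(κ' * (n * (D / c)))) ?_ fun xs => ?_
    · exact ((hνm.const_mul _).const_mul _).sqrt
    · rw [abs_of_nonneg (Real.sqrt_nonneg _)]
      refine Real.sqrt_le_sqrt ?_
      have := hνb xs
      gcongr
  have hGi : Integrable G (Measure.pi fun _ => P.fst) := hsq.const_mul _
  have hmp := measurePreserving_map_fst (P := P) (n := n)
  have hGint : ∫ S, G (fun i => (S i).1) ∂π = ∫ xs, G xs ∂(Measure.pi fun _ => P.fst) := by
    have := integral_map (μ := π) hmp.measurable.aemeasurable (f := G)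
      (by rw [hmp.map_eq]; exact hGi.aestronglyMeasurable)
    rw [hmp.map_eq] at this
    exact this.symm
  -- The radius `Bg` is only an almost sure bound, so the Rademacher estimate holds for almost every
  -- sample. The sure bound `‖g x‖ ^ 2 ≤ D` serves for integrability.
  have hae : ∀ᵐ S ∂π, ∀ i, ‖g (S i).1‖ ≤ Bg := by
    have h1 : ∀ᵐ xs ∂(Measure.pi fun _ : Fin n => P.fst), ∀ i, ‖g (xs i)‖ ≤ Bg := by
      refine Filter.eventually_all.2 fun i => ?_
      exact (measurePreserving_eval (fun _ : Fin n => P.fst) i).quasiMeasurePreserving.ae hgB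
    exact hmp.quasiMeasurePreserving.ae h1
  have hrad : ∀ σ : ℝ, |σ| = 1 → ∀ S : Fin n → Input d × Y, (∀ i, ‖g (S i).1‖ ≤ Bg) →
      (Fintype.card (Fin n → ℤˣ) : ℝ)⁻¹ * ∑ s : Fin n → ℤˣ, ⨆ t, ∑ i, rsign (s i) * F σ t (S i) ≤
        G (fun i => (S i).1) := by
    intro σ hσ S hS
    have h1 := sum_iSup_contraction (fun t i => f t (S i).1)
      (fun i z => σ * loss z (S i).2) fun i x y => by
        rw [← mul_sub, abs_mul, hσ, one_mul]; exact hl.lipschitz _ _ _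
    have h2 := rademacher_model_le (W0 := W0) hD hm hn hphiK ha hA hc h W hW
      (fun i => (S i).1) hS
    refine le_trans (mul_le_mul_of_nonneg_left h1 (by positivity)) h2
  set J : ℝ := ∫ xs, G xs ∂(Measure.pi fun _ => P.fst) with hJ
  have hsym : ∀ σ : ℝ, |σ| = 1 → ∫ S : Fin n → Input d × Y,
      ⨆ t, (n * ∫ z, F σ t z ∂P - ∑ i, F σ t (S i)) ∂π ≤ 2 * J := by
    intro σ hσ
    refine (integral_iSup_sub_le (μ := P) (n := n) (hFm σ) (hFb σ hσ)).trans
      (mul_le_mul_of_nonneg_left ?_ (by norm_num))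
    rw [← hGint]
    refine integral_mono_ae ?_ ?_ ?_
    · exact (integrable_finsetSum _ fun s _ => integrable_iSup_sum_rsign (μ := P) (hFm σ)
        (hFb σ hσ) s).const_mul _
    · exact hmp.integrable_comp_of_integrable hGi
    · filter_upwards [hae] with S hS using hrad σ hσ S hS
  -- deviations
  set R : T → ℝ := fun t => ∫ z, loss (f t z.1) z.2 ∂P with hR
  have hRb : ∀ t, |R t| ≤ b := fun t => by
    have := norm_integral_le_of_norm_le_const (μ := P) (f := fun z => loss (f t z.1) z.2) (C := b)
      (Filter.Eventually.of_forall fun z => hlb t z.1 z.2)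
    simpa using this
  set Δ : T → (Fin n → Input d × Y) → ℝ := fun t S => n * R t - ∑ i, loss (f t (S i).1) (S i).2
    with hΔ
  have hΔF : ∀ σ t S, n * ∫ z, F σ t z ∂P - ∑ i, F σ t (S i) = σ * Δ t S := by
    intro σ t S
    simp only [hF, hΔ, hR]
    rw [integral_const_mul, ← Finset.mul_sum]; ring
  have hΔb : ∀ t S, |Δ t S| ≤ n * b + n * b := by
    intro t S
    refine (abs_sub _ _).trans (add_le_add ?_ ?_)
    · rw [abs_mul, Nat.abs_cast]
      exact mul_le_mul_of_nonneg_left (hRb t) (Nat.cast_nonneg n)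
    · simpa using abs_sum_rsign_mul_le (fun _ => 1) fun i => hlb t (S i).1 (S i).2
  have hΔm : ∀ t, Measurable (Δ t) := fun t =>
    measurable_const.sub (Finset.measurable_sum _ fun i _ =>
      (hl.measurable_comp (hfm t)).comp (measurable_pi_apply i))
  simp only [hΔF] at hsym
  have hsupi : ∀ σ : ℝ, |σ| = 1 → Integrable (fun S => ⨆ t, σ * Δ t S) π := fun σ hσ =>
    integrable_of_abs_le (Measurable.iSup fun t => (hΔm t).const_mul σ) fun S =>
      abs_iSup_le fun t => by rw [abs_mul, hσ, one_mul]; exact hΔb t S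
  have hΔ0 : ∀ S, Δ t₀ S = n * ∫ z, loss 0 z.2 ∂P - ∑ i, loss 0 (S i).2 := by
    intro S
    have : ∀ x, f t₀ x = 0 := by intro x; simp [hf, ht₀, model]
    simp only [hΔ, hR, this]
  have hΔ0i : ∫ S, |Δ t₀ S| ∂π ≤ 2 * √n := by
    simp only [hΔ0]
    exact integral_abs_zero_gap_le hl
  -- Contraction is one-sided, so each sign of the deviation has its own supremum. Either supremum
  -- could be negative, but it is at least `-|Δ t₀ S|`; the deviation of the zero model makes up for
  -- this and yields the separate `1/√n` term.
  have hpt : ∀ S, ⨆ t, |risk P loss (f t) - empRisk S loss (f t)| ≤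
      1 / n * ((⨆ t, 1 * Δ t S) + (⨆ t, -1 * Δ t S) + |Δ t₀ S|) := by
    intro S
    refine ciSup_le fun t => ?_
    have h1 : risk P loss (f t) - empRisk S loss (f t) = 1 / n * Δ t S := by
      simp only [risk, empRisk, hΔ, hR]; field_simp
    rw [h1, abs_mul, abs_of_nonneg (by positivity : (0 : ℝ) ≤ 1 / n)]
    refine mul_le_mul_of_nonneg_left ?_ (by positivity)
    have h2 := le_iSup_of_finite (fun t => 1 * Δ t S) t
    have h3 := le_iSup_of_finite (fun t => -1 * Δ t S) t
    have h4 := le_iSup_of_finite (fun t => 1 * Δ t S) t₀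
    have h5 := le_iSup_of_finite (fun t => -1 * Δ t S) t₀
    have h6 := le_abs_self (Δ t₀ S)
    have h7 := neg_abs_le (Δ t₀ S)
    rcases abs_cases (Δ t S) with ⟨h8, _⟩ | ⟨h8, _⟩ <;> linarith
  have hΔ0int : Integrable (fun S => |Δ t₀ S|) π :=
    integrable_of_abs_le (hΔm t₀).abs fun S => by rw [abs_abs]; exact hΔb t₀ S
  have hgi : Integrable (fun S => ⨆ t, |risk P loss (f t) - empRisk S loss (f t)|) π := by
    refine integrable_of_abs_le (Measurable.iSup fun t => ?_) (b := 1 / n * (n * b + n * b))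
      fun S => abs_iSup_le fun t => ?_
    · have h1 : ∀ S, |risk P loss (f t) - empRisk S loss (f t)| = |1 / n * Δ t S| := by
        intro S
        simp only [risk, empRisk, hΔ, hR]; congr 1; field_simp
      simp only [h1]
      exact ((hΔm t).const_mul _).abs
    · have h1 : risk P loss (f t) - empRisk S loss (f t) = 1 / n * Δ t S := by
        simp only [risk, empRisk, hΔ, hR]; field_simp
      rw [abs_abs, h1, abs_mul, abs_of_nonneg (by positivity : (0 : ℝ) ≤ 1 / n)]
      exact mul_le_mul_of_nonneg_left (hΔb t S) (by positivity)
  have hmain : ∫ S, ⨆ t, |risk P loss (f t) - empRisk S loss (f t)| ∂π ≤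
      1 / n * (2 * J + 2 * J + 2 * √n) := by
    have i1 := hsupi 1 (by simp)
    have i2 := hsupi (-1) (by simp)
    calc _ ≤ ∫ S, 1 / n * ((⨆ t, 1 * Δ t S) + (⨆ t, -1 * Δ t S) + |Δ t₀ S|) ∂π := by
          exact integral_mono hgi (((i1.add i2).add hΔ0int).const_mul _) hpt
      _ = 1 / n * ((∫ S, ⨆ t, 1 * Δ t S ∂π) + (∫ S, ⨆ t, -1 * Δ t S ∂π) +
          ∫ S, |Δ t₀ S| ∂π) := by
          have e := integral_add (i1.add i2) hΔ0int
          simp only [Pi.add_apply] at e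
          rw [integral_const_mul, e, integral_add i1 i2]
      _ ≤ _ := by
          refine mul_le_mul_of_nonneg_left ?_ (by positivity)
          exact add_le_add (add_le_add (hsym 1 (by simp)) (hsym (-1) (by simp))) hΔ0i
  refine ⟨hgi, hmain.trans ?_⟩
  set I : ℝ := ∫ xs, ν xs ∂(Measure.pi fun _ => P.fst) with hI
  have hI0 : 0 ≤ I := integral_nonneg hν0
  -- Jensen moves the expectation under the root, which is the form in which `opMoment` is defined.
  have hJle : J ≤ 2 * B ^ 2 * √(κ' * (n * I)) := by
    have h1 : J = 2 * B ^ 2 * ∫ xs, √(κ' * (n * ν xs)) ∂(Measure.pi fun _ => P.fst) :=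
      integral_const_mul _ _
    rw [h1]
    refine mul_le_mul_of_nonneg_left ?_ (by positivity)
    refine (integral_sqrt_le (fun xs => by have := hν0 xs; positivity)
      ((hνi.const_mul _).const_mul _) hsq).trans (le_of_eq ?_)
    rw [integral_const_mul, integral_const_mul]
  have hM : opMoment n Bg A g P.fst = √I / Bg := by
    rw [opMoment, Real.sqrt_mul (by positivity), Real.sqrt_inv, Real.sqrt_sq hBg.le,
      inv_mul_eq_div]
  have hsn : 0 < √(n : ℝ) := Real.sqrt_pos.2 hnR
  have hsc : 0 < √c := Real.sqrt_pos.2 hc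
  have hs : √(κ' * (n * I)) = K * (Bg / √c) * √L * (√n * √I) := by
    rw [Real.sqrt_mul hκ'0, Real.sqrt_mul (Nat.cast_nonneg n), hκ',
      Real.sqrt_mul (by positivity), Real.sqrt_mul (by positivity), Real.sqrt_sq hK.le,
      Real.sqrt_div (by positivity), Real.sqrt_sq hBg.le]
  rw [hM]
  calc _ ≤ 1 / n * (2 * (2 * B ^ 2 * √(κ' * (n * I))) + 2 * (2 * B ^ 2 * √(κ' * (n * I))) +
        2 * √n) := by gcongr
    _ = _ := by
        rw [hs]
        have hnn : (n : ℝ) = √n * √n := (Real.mul_self_sqrt hnR.le).symm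
        rw [show (1 : ℝ) / n = 1 / (√n * √n) by rw [← hnn]]
        field_simp
        ring

/-- The bound on the expected generalization gap. -/
theorem expectedGap_le (hl : IsLoss K loss) (hK : 0 < K)
    (hphi : Measurable phi2) (hphiK : ∀ t, |phi2 t| ≤ K) (hD : 0 < D) (hm : 0 < m) (hn : 0 < n)
    (ha : ∀ r, |a r| ≤ 1) (hg : Measurable g) (hgD : ∀ x, ‖g x‖ ^ 2 ≤ D)
    (hA : A.PosSemidef) {c : ℝ} (hc : 0 < c)
    (h : ∀ u : Fin D → ℝ, c * (u ⬝ᵥ u) ≤ u ⬝ᵥ A *ᵥ u) {B Bg : ℝ} (hB : 0 < B) (hBg : 0 < Bg)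
    (hgB : ∀ᵐ x ∂P.fst, ‖g x‖ ≤ Bg) :
    expectedGap n P loss phi2 g a W0 A B ≤ ENNReal.ofReal
      (8 * K / √c * (Bg ^ 2 * B ^ 2 * opMoment n Bg A g P.fst / √n * √(1 + Real.log (D * m))) +
        2 * (1 / √n)) := by
  set gap : Weights m D → (Fin n → Input d × Y) → ℝ := fun W S =>
    |risk P loss (model phi2 g a W0 W) - empRisk S loss (model phi2 g a W0 W)| with hgap
  have hne : Nonempty (ball24 m A B) := ⟨⟨0, zero_mem_ball24 hB.le⟩⟩
  set w : ℕ → ball24 m A B := TopologicalSpace.denseSeq (ball24 m A B) with hw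
  -- The zero weights are put in front of the dense sequence, so that every finite initial segment
  -- contains the reference point `t₀`.
  set V : ℕ → Weights m D := fun k => Nat.casesOn k 0 fun k => w k with hV
  have hVmem : ∀ k, V k ∈ ball24 m A B := by
    intro k
    cases k with
    | zero => exact zero_mem_ball24 hB.le
    | succ k => exact (w k).2
  set fN : ℕ → (Fin n → Input d × Y) → ENNReal := fun N S =>
    ENNReal.ofReal (⨆ t : Fin (N + 1), gap (V t) S) with hfN
  have hgapm : ∀ W, Measurable (gap W) := by
    intro W
    refine (measurable_const.sub ?_).abs
    refine (Finset.measurable_sum _ fun i _ => ?_).const_mul _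
    exact (hl.measurable_comp (measurable_model hphi hg W)).comp (measurable_pi_apply i)
  have hfm : ∀ N, Measurable (fN N) := fun N =>
    (Measurable.iSup fun t => hgapm _).ennreal_ofReal
  have hmono : Monotone fN := by
    intro N N' hNN S
    refine ENNReal.ofReal_le_ofReal (ciSup_le fun t => ?_)
    exact le_iSup_of_finite (fun t : Fin (N' + 1) => gap (V t) S) ⟨t, by omega⟩
  have hsup : ∀ S, ⨆ W ∈ ball24 m A B, ENNReal.ofReal (gap W S) ≤ ⨆ N, fN N S := by
    intro S
    refine iSup₂_le fun W hW => ?_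
    have hcont : Continuous fun W => ENNReal.ofReal (gap W S) :=
      ENNReal.continuous_ofReal.comp
        ((continuous_risk_model hl hphi hphiK ha hg hgD).sub (continuous_empRisk_model hl)).abs
    refine (TopologicalSpace.denseRange_denseSeq (ball24 m A B)).induction_on
      (p := fun W : ball24 m A B => ENNReal.ofReal (gap W S) ≤ ⨆ N, fN N S) ⟨W, hW⟩
      (isClosed_le (hcont.comp continuous_subtype_val) continuous_const) fun k => ?_
    refine le_trans (ENNReal.ofReal_le_ofReal ?_) (le_iSup (fun N => fN N S) (k + 1))
    exact le_iSup_of_finite (fun t : Fin (k + 1 + 1) => gap (V t) S) (Fin.last (k + 1))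
  refine (lintegral_mono hsup).trans ?_
  -- Monotone convergence along the initial segments: the bound for finite classes does not depend
  -- on their size.
  rw [lintegral_iSup hfm hmono]
  refine iSup_le fun N => ?_
  have h1 := integral_iSup_gap_le (P := P) (n := n) (W0 := W0) hl hK hphi hphiK hD hm hn ha hg hgD
    hA hc h hBg hgB (fun t : Fin (N + 1) => V t) (fun t => hVmem t) (t₀ := 0) rfl
  refine le_trans (le_of_eq ?_) (ENNReal.ofReal_le_ofReal h1.2)
  rw [ofReal_integral_eq_lintegral_ofReal]
  · exact h1.1
  · exact Filter.Eventually.of_forall fun S => Real.iSup_nonneg fun t => abs_nonneg _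

end GeneralizationGap

end QuadNTK

namespace QuadNTK

/-! ### Random initialization -/

section Initialization

instance : IsProbabilityMeasure rademacher := by
  constructor
  simp only [rademacher, Measure.smul_apply, Measure.add_apply, measure_univ]
  rw [ENNReal.smul_def, smul_eq_mul, one_add_one_eq_two, ENNReal.coe_inv two_ne_zero]
  exact ENNReal.inv_mul_cancel (by simp) (by simp)

lemma ae_rademacher : ∀ᵐ t ∂rademacher, |t| ≤ 1 := by
  rw [rademacher]
  refine Measure.ae_smul_measure ?_ _
  rw [ae_add_measure_iff]
  constructor <;> simp [ae_dirac_eq]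

instance (m D : ℕ) : IsProbabilityMeasure (initLaw m D) := by
  unfold initLaw; infer_instance

/-- The output signs enter the generalization bound only through this estimate, which costs no
probability; all of `δ` is spent on the covariance. -/
lemma ae_initLaw (m D : ℕ) : ∀ᵐ ω ∂initLaw m D, ∀ r, |ω.1 r| ≤ 1 := by
  have h1 : ∀ᵐ a ∂(Measure.pi fun _ : Fin m => rademacher), ∀ r, |a r| ≤ 1 := by
    refine Filter.eventually_all.2 fun r => ?_
    exact (measurePreserving_eval (fun _ : Fin m => rademacher) r).quasiMeasurePreserving.ae
      ae_rademacher
  exact Measure.quasiMeasurePreserving_fst.ae h1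

/-- An event about the second component that holds with high probability, combined with an almost
sure event about the first component. -/
lemma WithProbAtLeast.prod {Ω Ω' : Type*} [MeasurableSpace Ω] [MeasurableSpace Ω'] {μ : Measure Ω}
    {ν : Measure Ω'} [IsProbabilityMeasure μ] [IsProbabilityMeasure ν] {δ : ℝ} {p : Ω → Prop}
    {q : Ω' → Prop} {r : Ω × Ω' → Prop} (hp : ∀ᵐ ω ∂μ, p ω) (hq : WithProbAtLeast ν δ q)
    (h : ∀ ω, p ω.1 → q ω.2 → r ω) : WithProbAtLeast (μ.prod ν) δ r := by
  have hsub : {ω | ¬ r ω} ⊆ {ω | ¬ p ω} ×ˢ Set.univ ∪ Set.univ ×ˢ {ω | ¬ q ω} := by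
    intro ω hω
    by_contra hcon
    simp only [Set.mem_union, Set.mem_prod, Set.mem_ofPred_eq, Set.mem_univ, and_true, true_and,
      not_or, not_not] at hcon
    exact hω (h ω hcon.1 hcon.2)
  refine (measure_mono hsub).trans ((measure_union_le _ _).trans ?_)
  rw [Measure.prod_prod, Measure.prod_prod, ae_iff.1 hp]
  rw [zero_mul, zero_add, measure_univ, one_mul]
  exact hq

end Initialization

end QuadNTK

theorem mainTheorem2 :
    -- (1) Optimization
    (∀ (κ K τ₁ τ₂ : ℝ), 0 < κ → 0 < K → 0 < τ₁ → τ₁ ≤ τ₂ → ∃ C : ℝ, 0 < C ∧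
      ∀ (Y : Type*) [MeasurableSpace Y] (loss : ℝ → Y → ℝ) (phi2 : ℝ → ℝ) (d D m n n₀ : ℕ)
        (P : Measure (QuadNTK.Input d × Y)) [IsProbabilityMeasure P]
        (V : Fin D → EuclideanSpace ℝ (Fin d)) (b : Fin D → ℝ)
        (a : Fin m → ℝ) (W0 : QuadNTK.Weights m D) (S : Fin n → QuadNTK.Input d × Y)
        (ε δ τ B : ℝ),
        QuadNTK.IsLoss K loss → Measurable phi2 → (∀ t, |phi2 t| ≤ K) →
        0 < D → 0 < m → 0 < n → 0 < ε → 0 < δ → τ₁ ≤ τ → τ ≤ τ₂ → 0 < B →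
        (∀ r, a r = 1 ∨ a r = -1) →
        (QuadNTK.cov (QuadNTK.feature V b) P.fst - κ • 1).PosSemidef →
        C * D ^ 2 * B ^ 4 * ε⁻¹ ≤ m →
        C * (δ ^ 2)⁻¹ * D * (1 + Real.log D) ≤ n₀ →
        QuadNTK.WithProbAtLeast (Measure.pi fun _ : Fin n₀ => P.fst) δ fun xs =>
          ∃ M : ℝ,
            IsLeast ((fun W => QuadNTK.empRisk S loss
                (QuadNTK.model phi2 (QuadNTK.feature V b) a W0 W)) ''
              QuadNTK.ball24 m (QuadNTK.empCov (QuadNTK.feature V b) xs) B) M ∧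
            ∃ lam : ℝ, 0 < lam ∧
              ∀ W : QuadNTK.Weights m D,
                QuadNTK.IsSOSP (QuadNTK.regRisk S loss phi2 (QuadNTK.feature V b) a W0
                  (QuadNTK.empCov (QuadNTK.feature V b) xs) lam) W →
                QuadNTK.norm24 (QuadNTK.rowMul W
                    (QuadNTK.psdSqrt (QuadNTK.empCov (QuadNTK.feature V b) xs))) ≤ C * B ∧
                QuadNTK.regRisk S loss phi2 (QuadNTK.feature V b) a W0
                    (QuadNTK.empCov (QuadNTK.feature V b) xs) lam W ≤ (1 + τ) * M + ε) ∧
    -- (2) Generalization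
    (∀ (κ K : ℝ), 0 < κ → 0 < K → ∃ C : ℝ, 0 < C ∧
      ∀ (Y : Type*) [MeasurableSpace Y] (loss : ℝ → Y → ℝ) (phi2 : ℝ → ℝ) (d D m n n₀ : ℕ)
        (P : Measure (QuadNTK.Input d × Y)) [IsProbabilityMeasure P]
        (V : Fin D → EuclideanSpace ℝ (Fin d)) (b : Fin D → ℝ)
        (δ Bw Bg : ℝ),
        QuadNTK.IsLoss K loss → Measurable phi2 → (∀ t, |phi2 t| ≤ K) →
        0 < D → 0 < m → 0 < n → 0 < δ → 0 < Bw → 0 < Bg →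
        (∀ᵐ x ∂P.fst, ‖QuadNTK.feature V b x‖ ≤ Bg) →
        (QuadNTK.cov (QuadNTK.feature V b) P.fst - κ • 1).PosSemidef →
        C * (δ ^ 2)⁻¹ * D * (1 + Real.log D) ≤ n₀ →
        QuadNTK.WithProbAtLeast
          ((QuadNTK.initLaw m D).prod (Measure.pi fun _ : Fin n₀ => P.fst)) δ fun ω =>
          QuadNTK.expectedGap n P loss phi2 (QuadNTK.feature V b) ω.1.1 ω.1.2
              (QuadNTK.empCov (QuadNTK.feature V b) ω.2) Bw ≤
            ENNReal.ofReal (C *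
              (Bg ^ 2 * Bw ^ 2 *
                  QuadNTK.opMoment n Bg (QuadNTK.empCov (QuadNTK.feature V b) ω.2)
                    (QuadNTK.feature V b) P.fst / Real.sqrt n *
                  Real.sqrt (1 + Real.log (D * m)) +
                1 / Real.sqrt n))) := by
  constructor
  · intro κ K τ₁ τ₂ hκ hK hτ₁ _
    -- One summand for each requirement: the width with `c = κ/2`, where `3 K³ / c² = 12 K³ / κ²`;
    -- the norm bound; and the sample size for the covariance.
    refine ⟨12 * K ^ 3 / κ ^ 2 + 36 * (1 + 1 / τ₁) + 1024 / κ, by positivity, ?_⟩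
    intro Y _ loss phi2 d D m n n₀ P _ V b a W0 S ε δ τ B hl _ hphi hD hm hn hε hδ hτ _ hB ha hcov
      hmC hn₀
    have hL0 : 0 ≤ Real.log D := Real.log_nonneg (by exact_mod_cast hD)
    have h1 : 0 ≤ 12 * K ^ 3 / κ ^ 2 := by positivity
    have h2 : 0 ≤ 36 * (1 + 1 / τ₁) := by positivity
    have h3 : 0 ≤ 1024 / κ := by positivity
    have hn₀' : 1024 * κ⁻¹ * (δ ^ 2)⁻¹ * D * (1 + Real.log D) ≤ n₀ := by
      refine le_trans ?_ hn₀
      gcongr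
      rw [← div_eq_mul_inv]
      linarith
    refine (measure_mono fun xs hxs => ?_).trans (QuadNTK.withProbAtLeast_empCov_lower hD
      (QuadNTK.measurable_feature V b) (QuadNTK.norm_feature_sq_le V b) hκ hcov hδ hn₀')
    refine fun hlow => hxs ?_
    refine QuadNTK.landscape hl hK hphi hm hn ha (QuadNTK.norm_feature_sq_le V b)
      (QuadNTK.empCov_posSemidef _ xs) (half_pos hκ) hlow hε hτ₁ hτ hB ?_ (by linarith) hmC
    have h4 : 3 * K ^ 3 / (κ / 2) ^ 2 = 12 * K ^ 3 / κ ^ 2 := by field_simp; ring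
    linarith
  · intro κ K hκ hK
    refine ⟨8 * K / √(κ / 2) + 2 + 1024 / κ, by positivity, ?_⟩
    intro Y _ loss phi2 d D m n n₀ P _ V b δ Bw Bg hl hphi hphiK hD hm hn hδ hBw hBg hgB hcov hn₀
    have hL0 : 0 ≤ Real.log D := Real.log_nonneg (by exact_mod_cast hD)
    have h1 : 0 ≤ 8 * K / √(κ / 2) := by positivity
    have h3 : 0 ≤ 1024 / κ := by positivity
    have hn₀' : 1024 * κ⁻¹ * (δ ^ 2)⁻¹ * D * (1 + Real.log D) ≤ n₀ := by
      refine le_trans ?_ hn₀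
      gcongr
      rw [← div_eq_mul_inv]
      linarith
    refine QuadNTK.WithProbAtLeast.prod (QuadNTK.ae_initLaw m D)
      (QuadNTK.withProbAtLeast_empCov_lower hD (QuadNTK.measurable_feature V b)
        (QuadNTK.norm_feature_sq_le V b) hκ hcov hδ hn₀') fun ω ha hlow => ?_
    refine (QuadNTK.expectedGap_le (P := P) hl hK hphi hphiK hD hm hn ha
      (QuadNTK.measurable_feature V b) (QuadNTK.norm_feature_sq_le V b)
      (QuadNTK.empCov_posSemidef _ ω.2) (half_pos hκ) hlow hBw hBg hgB).trans
      (ENNReal.ofReal_le_ofReal ?_)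
    rw [mul_add]
    have hM : 0 ≤ QuadNTK.opMoment n Bg (QuadNTK.empCov (QuadNTK.feature V b) ω.2)
        (QuadNTK.feature V b) P.fst := Real.sqrt_nonneg _
    gcongr <;> linarith
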